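/- Let $p>1$ and consider on the real line the nonlinear heat equation $$u_t=\partial_x^2u+|u|^{p-1}u,\qquad u(x,0)=u_0(x).\qquad (1)$$ By a solution of (1) on $[0,\tau)$, $\tau>0$, we mean a measurable real function $u$ on $\mathbb R\times[0,\tau)$ with $u(\cdot,0)=u_0$ which is bounded in $L^\infty(\mathbb R)$ on every compact subinterval of $[0,\tau)$, is continuous from $(0,\tau)$ to $L^\infty(\mathbb R)$, and satisfies (1) in the sense of Duhamel's formula $$u(t)=e^{t\partial_x^2}u_0+\int_0^te^{(t-s)\partial_x^2}\,|u(s)|^{p-1}u(s)\,ds\qquad(0<t<\tau),$$ where $e^{t\partial_x^2}$ is the heat semigroup, with kernel $(4\pi t)^{-1/2}e^{-(x-y)^2/(4t)}$. For $T>0$ put $$S_T(f)=T^{\frac12\frac{p+3}{p-1}}\int\Big(\tfrac12|f'|^2-\tfrac1{p+1}|f|^{p+1}\Big)\rho\Big(\frac x{\sqrt T}\Big)dx+\frac12\,\frac1{p-1}\,T^{-\frac12\frac{p-5}{p-1}}\int|f|^2\rho\Big(\frac x{\sqrt T}\Big)dx,\qquad \rho(y)=e^{-y^2/4}.$$ **Theorem.**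 Let $u_0\in L^\infty(\mathbb R)$ have a weak derivative $u_0'\in L^1_{\rm loc}(\mathbb R)$, and suppose that for some $T>0$ and some $x_0\in\mathbb R$ one has $\int|u_0'(x+x_0)|^2\rho(x/\sqrt T)\,dx<\infty$ and $S_T(u_0(\cdot+x_0))<0$. Then the solution of (1) blows up at some finite time $t^*\le T$. That is, there are $t^*\in(0,T]$ and a solution $u$ of (1) on $[0,t^*)$ such that $\|u(\cdot,t)\|_{L^\infty}\to\infty$ as $t\uparrow t^*$; moreover every solution of (1) on an interval $[0,\tau)$ satisfies $\tau\le t^*$ and coincides with $u$ (almost everywhere in $x$, for each $t\in[0,\tau)$). -/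

import Mathlib

open MeasureTheory Filter Topology Set
open scoped ContDiff ENNReal

/-- `g` is the weak derivative of `f` on the real line: both are locally integrable and
`∫ f φ' = - ∫ g φ` for every smooth compactly supported test function `φ`. -/
def HasWeakDerivative (f g : ℝ → ℝ) : Prop :=
  LocallyIntegrable f volume ∧ LocallyIntegrable g volume ∧
    ∀ φ : ℝ → ℝ, ContDiff ℝ ∞ φ → HasCompactSupport φ →
      ∫ x, f x * deriv φ x = - ∫ x, g x * φ x

/-- The Gaussian weight `ρ(y) = exp(-y² / 4)`. -/
noncomputable def gaussWeight (y : ℝ) : ℝ := Real.exp (-(y ^ 2) / 4)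

/-- The functional `S_T(f)`, where `f'` is the (weak) derivative of `f`. The integration variable
is `x = √T y`, so that the weight is `ρ(y) = ρ(x / √T) = exp(-x² / (4T))`. -/
noncomputable def energyST (p T : ℝ) (f f' : ℝ → ℝ) : ℝ :=
  T ^ ((1 / 2) * ((p + 3) / (p - 1))) *
      (∫ x, ((1 / 2) * |f' x| ^ 2 - (1 / (p + 1)) * |f x| ^ (p + 1)) *
        gaussWeight (x / Real.sqrt T)) +
    (1 / 2) * (1 / (p - 1)) * T ^ (-(1 / 2) * ((p - 5) / (p - 1))) *
      ∫ x, |f x| ^ 2 * gaussWeight (x / Real.sqrt T)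

/-- The heat kernel of `∂ₓ²` on the line, for `t > 0`. -/
noncomputable def heatKernel (t x : ℝ) : ℝ :=
  (Real.sqrt (4 * Real.pi * t))⁻¹ * Real.exp (-(x ^ 2) / (4 * t))

/-- The heat semigroup `(e^{t ∂ₓ²} f)(x)`, for `t > 0`. -/
noncomputable def heatFlow (t : ℝ) (f : ℝ → ℝ) (x : ℝ) : ℝ :=
  ∫ y, heatKernel t (x - y) * f y

/-- `u` (with `u t x` the value at time `t` and position `x`) is an `L^∞` solution on `[0, τ)` of
`u_t = u_xx + |u|^{p-1} u`, `u(·, 0) = u₀`, in the sense of Duhamel's formula. -/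
structure IsNLHSolution (p : ℝ) (u₀ : ℝ → ℝ) (τ : ℝ) (u : ℝ → ℝ → ℝ) : Prop where
  pos : 0 < τ
  /-- joint measurability in time and space -/
  aemeas : AEStronglyMeasurable (Function.uncurry u)
    ((volume.restrict (Ioo 0 τ)).prod (volume : Measure ℝ))
  /-- every time slice is in `L^∞` -/
  memLp : ∀ t ∈ Ico 0 τ, MemLp (u t) ∞ volume
  /-- the `L^∞` norm is bounded on compact subintervals of `[0, τ)` -/
  bounded : ∀ t₁ ∈ Ico 0 τ, ∃ M : ℝ, ∀ t ∈ Icc 0 t₁,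
    eLpNorm (u t) ∞ volume ≤ ENNReal.ofReal M
  /-- `u` is continuous on `(0, τ)` with values in `L^∞` -/
  cont : ∀ t ∈ Ioo 0 τ, Tendsto (fun s => eLpNorm (u s - u t) ∞ volume) (𝓝 t) (𝓝 0)
  /-- initial condition -/
  initial : u 0 =ᵐ[volume] u₀
  /-- Duhamel's formula -/
  duhamel : ∀ t ∈ Ioo 0 τ, u t =ᵐ[volume] fun x =>
    heatFlow t u₀ x +
      ∫ s in (0 : ℝ)..t, heatFlow (t - s) (fun y => |u s y| ^ (p - 1) * u s y) x

/-!
A solution that stays bounded up to time `T` is viewed in similarity variables around `(x₀, T)`,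
`w(s, z) = θ ^ (1 / (p - 1)) u(T - θ, x₀ + √(2θ) z)` with `θ = T e^{-s}`. Then `w` is bounded on
`[0, ∞)` and `w_s = -A w + |w|^{p-1} w`, where `A = 1 / (p - 1) - (∂_z² - z ∂_z) / 2` is
self-adjoint in `L²` of the standard Gaussian measure, with the Hermite functions as eigenfunctions
and the eigenvalues `n / 2 + 1 / (p - 1)`. This is a gradient flow for the energy
`E = ⟨A w, w⟩ / 2 - ∫ |w|^{p+1} / (p + 1)`, so `E` does not increase, and
`d/ds ‖w‖² = -2 ⟨A w, w⟩ + 2 ∫ |w|^{p+1} ≥ -4 E ≥ -4 E(0)`. If `E(0) < 0`, then `‖w‖²` grows at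
least linearly, which contradicts boundedness. The functional `S_T` is the initial energy, up to the
factor `√(4π)` (`energyST_eq`), so no solution stays bounded up to time `T`.

To avoid any regularity theory, the flow is handled through its Hermite coefficients only. The heat
flow acts on them by multiplication (`integral_heatFlow_mul_hermiteFun`), since in the Gaussian
variable it is the Ornstein–Uhlenbeck semigroup. Hence Duhamel's formula becomes a scalar
differential equation for each coefficient (`IsTruncatedFamily.hasDerivAt_integral_selfSim`), and
the weak derivative of the initial value enters only through Bessel's inequality
(`HasWeakDerivative.sum_hermite_le`). The decay of the energy (`IsGradientFlow.energy_le`) is proved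
by summing coordinate inequalities over short time steps in which the nonlinear term is frozen; the
error is quadratic in the step, because the trajectory is Hölder continuous of exponent `1/2` in
`L²`. The growth of the norm is `IsGradientFlow.linear_growth`.

The solution is built from the problems with nonlinearity truncated at the levels `M`, which are
globally Lipschitz and have global solutions (`exists_isMildFlow`). A solution up to time `t` that
is bounded by `M` is the same thing as a truncated solution that does not exceed its level up to `t`
(`IsBelow`). The blow-up alternative and uniqueness follow (`IsTruncatedFamily.exists_blowup`).
-/

/-! ### Gradient flows in a Hilbert space, in eigencoordinates -/

theorem integrableOn_Icc_of_continuousOn_Ioi {g : ℝ → ℝ} (hg : ContinuousOn g (Ioi 0))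
    {C : ℝ} (hC : ∀ s, 0 ≤ s → |g s| ≤ C) {r s : ℝ} (hr : 0 ≤ r) :
    IntegrableOn g (Icc r s) volume := by
  rw [integrableOn_Icc_iff_integrableOn_Ioc]
  refine IntegrableOn.of_bound (C := C) (by simp) ?_ ?_
  · exact (hg.mono fun x hx => lt_of_le_of_lt hr hx.1).aestronglyMeasurable measurableSet_Ioc
  · refine (ae_restrict_iff' measurableSet_Ioc).2 (ae_of_all _ fun x hx => ?_)
    exact hC x (hr.trans hx.1.le)

/-- The energy inequality for one eigencoordinate `a' = -l a + f`: the increment of `l a² / 2 - c a`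
has derivative `(f - c - a') a' ≤ (f - c)² / 4`. -/
theorem coord_energy_le {a f : ℝ → ℝ} {l B : ℝ} (ha : ContinuousOn a (Ici 0))
    (hd : ∀ s, 0 < s → HasDerivAt a (-l * a s + f s) s) (hf : ContinuousOn f (Ioi 0))
    (hB : ∀ s, 0 ≤ s → |f s| ≤ B) (c : ℝ) {r s : ℝ} (hr : 0 ≤ r) (hrs : r ≤ s) :
    l / 2 * (a s ^ 2 - a r ^ 2) - c * (a s - a r) ≤ ∫ x in r..s, (f x - c) ^ 2 / 4 := by
  have key := intervalIntegral.sub_le_integral_of_hasDeriv_right_of_le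
    (g := fun x => l / 2 * a x ^ 2 - c * a x)
    (g' := fun x => l / 2 * (2 * a x * (-l * a x + f x)) - c * (-l * a x + f x))
    (φ := fun x => (f x - c) ^ 2 / 4) hrs ?_ ?_ ?_ ?_
  · have : l / 2 * (a s ^ 2 - a r ^ 2) - c * (a s - a r) =
      (l / 2 * a s ^ 2 - c * a s) - (l / 2 * a r ^ 2 - c * a r) := by ring
    rw [this]; exact key
  · have : ContinuousOn a (Icc r s) := ha.mono fun x hx => hr.trans hx.1
    fun_prop
  · intro x hx
    have h := hd x (hr.trans_lt hx.1)
    have h2 := ((h.pow 2).const_mul (l / 2)).sub (h.const_mul c)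
    refine (h2.congr_deriv ?_).hasDerivWithinAt
    simp
  · refine integrableOn_Icc_of_continuousOn_Ioi (C := (B + |c|) ^ 2 / 4) (by fun_prop) ?_ hr
    intro x hx
    rw [abs_of_nonneg (by positivity)]
    have h1 : |f x - c| ≤ B + |c| := (abs_sub _ _).trans (by gcongr; exact hB x hx)
    have := sq_le_sq' (by linarith [neg_abs_le (f x - c)]) ((le_abs_self _).trans h1)
    linarith
  · intro x hx
    nlinarith [sq_nonneg (f x - c - 2 * (-l * a x + f x))]

/-- A function that increases over each short interval by at most the square of its length does not
increase: subdivide into `m` equal steps and let `m → ∞`. -/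
theorem le_of_forall_le_add_sq {E : ℝ → ℝ} {S C : ℝ} (hS : 0 ≤ S)
    (h : ∀ r s, 0 ≤ r → r ≤ s → s ≤ S → E s ≤ E r + C * (s - r) ^ 2) : E S ≤ E 0 := by
  have main : ∀ m : ℕ, 0 < m → E S ≤ E 0 + C * S ^ 2 / m := by
    intro m hm
    have hm' : (0 : ℝ) < m := by exact_mod_cast hm
    have ind : ∀ i : ℕ, i ≤ m → E (i * (S / m)) ≤ E 0 + i * (C * (S / m) ^ 2) := by
      intro i
      induction i with
      | zero => simp
      | succ k ih =>
        intro hk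
        have h1 := ih (by omega)
        have h2 := h (k * (S / m)) ((k + 1 : ℕ) * (S / m)) (by positivity)
          (by gcongr; simp) (by
            have : ((k + 1 : ℕ) : ℝ) ≤ m := by exact_mod_cast hk
            calc ((k + 1 : ℕ) : ℝ) * (S / m) ≤ m * (S / m) := by gcongr
              _ = S := by field_simp)
        have h3 : ((k + 1 : ℕ) : ℝ) * (S / m) - k * (S / m) = S / m := by push_cast; ring
        rw [h3] at h2
        push_cast at *
        linarith
    have h1 := ind m le_rfl
    have h2 : (m : ℝ) * (S / m) = S := by field_simp
    have h3 : (m : ℝ) * (C * (S / m) ^ 2) = C * S ^ 2 / m := by field_simp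
    rwa [h2, h3] at h1
  have lim : Tendsto (fun m : ℕ => E 0 + C * S ^ 2 / (m : ℝ)) atTop (𝓝 (E 0 + 0)) :=
    tendsto_const_nhds.add (tendsto_const_div_atTop_nhds_zero_nat _)
  rw [add_zero] at lim
  exact ge_of_tendsto lim (by filter_upwards [eventually_gt_atTop 0] with m hm using main m hm)

section GradientFlow

variable {H : Type*} [NormedAddCommGroup H] [InnerProductSpace ℝ H]

/-- A trajectory `w` of the gradient flow `w' = -A w + f` in a Hilbert space, written in an
orthonormal eigenbasis `b` of `A` (with eigenvalues `l n`), where `f` is the gradient along `w` of a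
convex potential whose value at `w s` is `φ s`. Nothing is required of `A` but what its eigenvalues
say, and the equation is required only coordinatewise and for positive times. The constant `B`
bounds `f`, `Λ` is a Lipschitz constant of `f` as a function of `w`, and `Q` bounds `⟨A w, w⟩` at
the initial time. -/
structure IsGradientFlow (b : HilbertBasis ℕ ℝ H) (l : ℕ → ℝ) (w f : ℝ → H) (φ : ℝ → ℝ)
    (B Λ Q : ℝ) : Prop where
  nonneg : ∀ n, 0 ≤ l n
  cont : ∀ n, ContinuousOn (fun s => inner ℝ (b n) (w s)) (Ici 0)
  deriv : ∀ n s, 0 < s → HasDerivAt (fun s => inner ℝ (b n) (w s))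
    (-l n * inner ℝ (b n) (w s) + inner ℝ (b n) (f s)) s
  cont_source : ∀ n, ContinuousOn (fun s => inner ℝ (b n) (f s)) (Ioi 0)
  bound : ∀ s, 0 ≤ s → ‖f s‖ ≤ B
  lipschitz : ∀ r s, 0 ≤ r → 0 ≤ s → ‖f s - f r‖ ≤ Λ * ‖w s - w r‖
  convex : ∀ r s, 0 ≤ r → 0 ≤ s → inner ℝ (f r) (w s - w r) ≤ φ s - φ r
  initial : ∀ N, ∑ n ∈ Finset.range N, l n * inner ℝ (b n) (w 0) ^ 2 ≤ Q

theorem HilbertBasis.sum_sq_inner_le (b : HilbertBasis ℕ ℝ H) (x : H) (N : ℕ) :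
    ∑ n ∈ Finset.range N, inner ℝ (b n) x ^ 2 ≤ ‖x‖ ^ 2 := by
  have := b.orthonormal.sum_inner_products_le x (s := Finset.range N)
  simpa using this

theorem HilbertBasis.hasSum_sq_inner (b : HilbertBasis ℕ ℝ H) (x : H) :
    HasSum (fun n => inner ℝ (b n) x ^ 2) (‖x‖ ^ 2) := by
  have := b.hasSum_inner_mul_inner x x
  rw [real_inner_self_eq_norm_sq] at this
  refine this.congr_fun fun n => ?_
  rw [real_inner_comm]; ring

namespace IsGradientFlow

variable {b : HilbertBasis ℕ ℝ H} {l : ℕ → ℝ} {w f : ℝ → H} {φ : ℝ → ℝ} {B Λ Q : ℝ}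

theorem abs_inner_source_le (h : IsGradientFlow b l w f φ B Λ Q) (n : ℕ) {s : ℝ} (hs : 0 ≤ s) :
    |inner ℝ (b n) (f s)| ≤ B := by
  refine (abs_real_inner_le_norm _ _).trans ?_
  rw [b.orthonormal.1 n, one_mul]
  exact h.bound s hs

/-- The sum of `coord_energy_le` over finitely many coordinates. -/
theorem sum_energy_le (h : IsGradientFlow b l w f φ B Λ Q) (v : H) (N : ℕ) {r s D : ℝ}
    (hr : 0 ≤ r) (hrs : r ≤ s) (hD : ∀ x ∈ Icc r s, ‖f x - v‖ ^ 2 ≤ D) :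
    ∑ n ∈ Finset.range N, (l n / 2 * (inner ℝ (b n) (w s) ^ 2 - inner ℝ (b n) (w r) ^ 2)
      - inner ℝ (b n) v * inner ℝ (b n) (w s - w r)) ≤ D / 4 * (s - r) := by
  have hint : ∀ n, IntervalIntegrable
      (fun x => (inner ℝ (b n) (f x) - inner ℝ (b n) v) ^ 2 / 4) volume r s := by
    intro n
    rw [intervalIntegrable_iff_integrableOn_Icc_of_le hrs]
    have := h.cont_source n
    refine integrableOn_Icc_of_continuousOn_Ioi (C := (B + ‖v‖) ^ 2 / 4) (by fun_prop) ?_ hr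
    intro x hx
    rw [abs_of_nonneg (by positivity), ← inner_sub_right]
    have h1 : |inner ℝ (b n) (f x - v)| ≤ B + ‖v‖ := by
      refine (abs_real_inner_le_norm _ _).trans ?_
      rw [b.orthonormal.1 n, one_mul]
      exact (norm_sub_le _ _).trans (by gcongr; exact h.bound x hx)
    have := sq_le_sq' (by linarith [neg_abs_le (inner ℝ (b n) (f x - v))])
      ((le_abs_self _).trans h1)
    linarith
  calc _ ≤ ∑ n ∈ Finset.range N, ∫ x in r..s,
        (inner ℝ (b n) (f x) - inner ℝ (b n) v) ^ 2 / 4 := by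
        refine Finset.sum_le_sum fun n _ => ?_
        rw [inner_sub_right]
        exact coord_energy_le (h.cont n) (h.deriv n) (h.cont_source n)
          (fun s hs => h.abs_inner_source_le n hs) _ hr hrs
    _ = ∫ x in r..s, ∑ n ∈ Finset.range N, (inner ℝ (b n) (f x) - inner ℝ (b n) v) ^ 2 / 4 := by
        rw [intervalIntegral.integral_finsetSum]
        exact fun n _ => hint n
    _ ≤ ∫ _ in r..s, D / 4 := by
        refine intervalIntegral.integral_mono_on hrs ?_ (by simp) fun x hx => ?_
        · simpa only [Finset.sum_fn] using IntervalIntegrable.sum (Finset.range N) fun n _ => hint n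
        · rw [← Finset.sum_div]
          have := b.sum_sq_inner_le (f x - v) N
          simp only [inner_sub_right] at this
          linarith [hD x hx]
    _ = D / 4 * (s - r) := by simp; ring

/-- The trajectory stays in the form domain of `A`. -/
theorem sum_le (h : IsGradientFlow b l w f φ B Λ Q) (N : ℕ) {s : ℝ} (hs : 0 ≤ s) :
    ∑ n ∈ Finset.range N, l n * inner ℝ (b n) (w s) ^ 2 ≤ Q + B ^ 2 * s / 2 := by
  have h1 := h.sum_energy_le 0 N le_rfl hs (D := B ^ 2) (by
    intro x hx
    rw [sub_zero]
    gcongr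
    exact h.bound x hx.1)
  have h2 := h.initial N
  simp only [inner_zero_right, zero_mul, sub_zero, mul_sub, Finset.sum_sub_distrib] at h1
  have e : ∀ s, ∑ n ∈ Finset.range N, l n / 2 * inner ℝ (b n) (w s) ^ 2 =
      (∑ n ∈ Finset.range N, l n * inner ℝ (b n) (w s) ^ 2) / 2 := by
    intro s; rw [Finset.sum_div]; exact Finset.sum_congr rfl fun n _ => by ring
  rw [e, e] at h1
  linarith

theorem summable (h : IsGradientFlow b l w f φ B Λ Q) {s : ℝ} (hs : 0 ≤ s) :
    Summable fun n => l n * inner ℝ (b n) (w s) ^ 2 :=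
  summable_of_sum_range_le (fun n => mul_nonneg (h.nonneg n) (sq_nonneg _)) fun N => h.sum_le N hs

/-- The trajectory is Hölder continuous of exponent `1/2`, locally uniformly. -/
theorem norm_sub_sq_le (h : IsGradientFlow b l w f φ B Λ Q) {r s : ℝ} (hr : 0 ≤ r)
    (hrs : r ≤ s) : ‖w s - w r‖ ^ 2 ≤ (Q + B ^ 2 * s) * (s - r) := by
  have hs := hr.trans hrs
  rcases hrs.eq_or_lt with rfl | hlt
  · simp
  have hlim := (b.hasSum_sq_inner (w s - w r)).tendsto_sum_nat
  refine le_of_tendsto' hlim fun N => ?_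
  -- coordinatewise, test with the constant `c = -(a s - a r) / (s - r)`
  have hδ : 0 < s - r := sub_pos.2 hlt
  have hint : ∀ n, IntervalIntegrable (fun x => inner ℝ (b n) (f x) ^ 2) volume r s := by
    intro n
    rw [intervalIntegrable_iff_integrableOn_Icc_of_le hrs]
    have := h.cont_source n
    refine integrableOn_Icc_of_continuousOn_Ioi (C := B ^ 2) (by fun_prop) ?_ hr
    intro x hx
    rw [abs_of_nonneg (by positivity), ← sq_abs]
    gcongr
    exact h.abs_inner_source_le n hx
  have hc : ∀ n, inner ℝ (b n) (w s - w r) ^ 2 ≤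
      (s - r) * ((∫ x in r..s, inner ℝ (b n) (f x) ^ 2) + l n * inner ℝ (b n) (w r) ^ 2) := by
    intro n
    set D := inner ℝ (b n) (w s - w r) with hD
    have h1 := coord_energy_le (h.cont n) (h.deriv n) (h.cont_source n)
          (fun s hs => h.abs_inner_source_le n hs) (-(D / (s - r))) hr hrs
    rw [← inner_sub_right, ← hD] at h1
    have h2 : ∫ x in r..s, (inner ℝ (b n) (f x) - -(D / (s - r))) ^ 2 / 4 ≤
        ∫ x in r..s, (inner ℝ (b n) (f x) ^ 2 / 2 + (D / (s - r)) ^ 2 / 2) := by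
      refine intervalIntegral.integral_mono_on hrs ?_ ?_ fun x hx => ?_
      · rw [intervalIntegrable_iff_integrableOn_Icc_of_le hrs]
        have := h.cont_source n
        refine integrableOn_Icc_of_continuousOn_Ioi
          (C := (B + |D / (s - r)|) ^ 2 / 4) (by fun_prop) ?_ hr
        intro x hx
        rw [abs_of_nonneg (by positivity), sub_neg_eq_add, ← sq_abs]
        gcongr
        exact (abs_add_le _ _).trans (by gcongr; exact h.abs_inner_source_le n hx)
      · exact ((hint n).div_const 2).add (by simp)
      · nlinarith [sq_nonneg (inner ℝ (b n) (f x) - D / (s - r))]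
    rw [intervalIntegral.integral_add ((hint n).div_const 2) (by simp),
      intervalIntegral.integral_div _ (fun x => (inner ℝ (b n) (f x) - _) ^ 2),
      intervalIntegral.integral_div _ (fun x => inner ℝ (b n) (f x) ^ 2)] at h2
    rw [intervalIntegral.integral_div] at h1
    simp only [intervalIntegral.integral_const, smul_eq_mul] at h2
    have h3 : 0 ≤ l n / 2 * inner ℝ (b n) (w s) ^ 2 :=
      mul_nonneg (by linarith [h.nonneg n]) (sq_nonneg _)
    have h4 : (s - r) * ((D / (s - r)) ^ 2 / 2) = D ^ 2 / (s - r) / 2 := by field_simp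
    have h5 : -(D / (s - r)) * D = - (D ^ 2 / (s - r)) := by field_simp
    rw [h4] at h2
    rw [h5] at h1
    have h6 : D ^ 2 / (s - r) ≤
        (∫ x in r..s, inner ℝ (b n) (f x) ^ 2) + l n * inner ℝ (b n) (w r) ^ 2 := by linarith
    rw [div_le_iff₀ hδ] at h6
    linarith
  calc _ ≤ ∑ n ∈ Finset.range N, (s - r) *
        ((∫ x in r..s, inner ℝ (b n) (f x) ^ 2) + l n * inner ℝ (b n) (w r) ^ 2) :=
        Finset.sum_le_sum fun n _ => hc n
    _ = (s - r) * ((∫ x in r..s, ∑ n ∈ Finset.range N, inner ℝ (b n) (f x) ^ 2) +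
        ∑ n ∈ Finset.range N, l n * inner ℝ (b n) (w r) ^ 2) := by
        rw [← Finset.mul_sum, Finset.sum_add_distrib, intervalIntegral.integral_finsetSum]
        exact fun n _ => hint n
    _ ≤ (s - r) * (B ^ 2 * (s - r) + (Q + B ^ 2 * r / 2)) := by
        gcongr
        · calc _ ≤ ∫ _ in r..s, B ^ 2 := by
                refine intervalIntegral.integral_mono_on hrs ?_ (by simp) fun x hx => ?_
                · simpa only [Finset.sum_fn] using
                    IntervalIntegrable.sum (Finset.range N) fun n _ => hint n
                · refine (b.sum_sq_inner_le (f x) N).trans ?_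
                  gcongr
                  exact h.bound x (hr.trans hx.1)
            _ = B ^ 2 * (s - r) := by simp; ring
        · exact h.sum_le N hr
    _ ≤ (Q + B ^ 2 * s) * (s - r) := by
        have : 0 ≤ B ^ 2 * r := by positivity
        nlinarith

/-- The energy `½ ⟨A w, w⟩ - φ` does not exceed its initial value. Over a short step of length `δ`
the source is frozen at the left end point, which costs `O(δ²)` because the trajectory is
`1/2`-Hölder; convexity bounds the frozen term by the increment of the potential. -/
theorem energy_le (h : IsGradientFlow b l w f φ B Λ Q) {s : ℝ} (hs : 0 ≤ s) :
    (∑' n, l n * inner ℝ (b n) (w s) ^ 2) / 2 - φ s ≤ Q / 2 - φ 0 := by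
  have h0 : ∑' n, l n * inner ℝ (b n) (w 0) ^ 2 ≤ Q :=
    le_of_tendsto' (h.summable le_rfl).hasSum.tendsto_sum_nat h.initial
  suffices (∑' n, l n * inner ℝ (b n) (w s) ^ 2) / 2 - φ s ≤
      (∑' n, l n * inner ℝ (b n) (w 0) ^ 2) / 2 - φ 0 by linarith
  refine le_of_forall_le_add_sq
    (E := fun s => (∑' n, l n * inner ℝ (b n) (w s) ^ 2) / 2 - φ s)
    (C := Λ ^ 2 * (Q + B ^ 2 * s) / 4) hs fun r x hr hrx hxs => ?_
  have hx := hr.trans hrx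
  have hQ : 0 ≤ Q := by simpa using h.initial 0
  have hstep : ∀ N, ∑ n ∈ Finset.range N,
      (l n / 2 * (inner ℝ (b n) (w x) ^ 2 - inner ℝ (b n) (w r) ^ 2)
      - inner ℝ (b n) (f r) * inner ℝ (b n) (w x - w r)) ≤
        (Λ ^ 2 * ((Q + B ^ 2 * s) * (x - r))) / 4 * (x - r) := by
    intro N
    refine h.sum_energy_le (f r) N hr hrx fun y hy => ?_
    have hy0 := hr.trans hy.1
    calc ‖f y - f r‖ ^ 2 ≤ (Λ * ‖w y - w r‖) ^ 2 := by
          gcongr; exact h.lipschitz r y hr hy0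
      _ = Λ ^ 2 * ‖w y - w r‖ ^ 2 := by ring
      _ ≤ Λ ^ 2 * ((Q + B ^ 2 * y) * (y - r)) := by
          gcongr; exact h.norm_sub_sq_le hr hy.1
      _ ≤ Λ ^ 2 * ((Q + B ^ 2 * s) * (x - r)) := by
          have := hy.1; have := hy.2
          have : 0 ≤ y - r := by linarith
          gcongr
          linarith
  have hsum : HasSum (fun n => l n / 2 * (inner ℝ (b n) (w x) ^ 2 - inner ℝ (b n) (w r) ^ 2)
      - inner ℝ (b n) (f r) * inner ℝ (b n) (w x - w r))
      (((∑' n, l n * inner ℝ (b n) (w x) ^ 2) / 2 -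
        (∑' n, l n * inner ℝ (b n) (w r) ^ 2) / 2) - inner ℝ (f r) (w x - w r)) := by
    have h1 := ((h.summable hx).hasSum.div_const 2).sub ((h.summable hr).hasSum.div_const 2)
    have h2 := h1.sub (b.hasSum_inner_mul_inner (f r) (w x - w r))
    refine h2.congr_fun fun n => ?_
    rw [real_inner_comm (b n) (f r)]
    ring
  have hle := le_of_tendsto' hsum.tendsto_sum_nat hstep
  have hc := h.convex r x hr hx
  have e : Λ ^ 2 * ((Q + B ^ 2 * s) * (x - r)) / 4 * (x - r) =
    Λ ^ 2 * (Q + B ^ 2 * s) / 4 * (x - r) ^ 2 := by ring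
  rw [e] at hle
  linarith

/-- With superquadratic potential, negative initial energy forces the squared norm to grow at least
linearly: `(‖w‖²)' = -2 ⟨A w, w⟩ + 2 ⟨f, w⟩ = -4 E + 2 (⟨f, w⟩ - 2 φ) ≥ -4 E(0)`, where `E` is the
energy. As `‖w‖²` need not be differentiable, this is integrated for the partial sums over the
eigenbasis. -/
theorem linear_growth (h : IsGradientFlow b l w f φ B Λ Q)
    (hφ : ∀ s, 0 ≤ s → 2 * φ s ≤ inner ℝ (f s) (w s)) {W : ℝ} (hW : ∀ s, 0 ≤ s → ‖w s‖ ≤ W)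
    {s : ℝ} (hs : 0 ≤ s) : 4 * (φ 0 - Q / 2) * s ≤ ‖w s‖ ^ 2 := by
  have hB0 : 0 ≤ B := (norm_nonneg _).trans (h.bound 0 le_rfl)
  have hW0 : 0 ≤ W := (norm_nonneg _).trans (hW 0 le_rfl)
  set G : ℕ → ℝ → ℝ := fun N x => ∑ n ∈ Finset.range N, inner ℝ (b n) (f x) * inner ℝ (b n) (w x)
  have hGlim : ∀ x, Tendsto (fun N => G N x) atTop (𝓝 (inner ℝ (f x) (w x))) := by
    intro x
    have := (b.hasSum_inner_mul_inner (f x) (w x)).tendsto_sum_nat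
    exact this.congr fun N => Finset.sum_congr rfl fun n _ => by rw [real_inner_comm (b n) (f x)]
  have hGc : ∀ N, ContinuousOn (G N) (Ioi 0) := fun N =>
    continuousOn_finsetSum _ fun n _ =>
      (h.cont_source n).mul ((h.cont n).mono Ioi_subset_Ici_self)
  have hGb : ∀ N x, 0 ≤ x → |G N x| ≤ B * W := by
    intro N x hx
    have h1 := Finset.sum_mul_sq_le_sq_mul_sq (Finset.range N)
      (fun n => inner ℝ (b n) (f x)) (fun n => inner ℝ (b n) (w x))
    refine abs_le_of_sq_le_sq (h1.trans ?_) (by positivity)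
    rw [mul_pow]
    refine mul_le_mul ?_ ?_ (Finset.sum_nonneg fun _ _ => sq_nonneg _) (sq_nonneg B)
    · exact (b.sum_sq_inner_le _ N).trans (by gcongr; exact h.bound x hx)
    · exact (b.sum_sq_inner_le _ N).trans (by gcongr; exact hW x hx)
  have hGm : AEStronglyMeasurable (fun x => inner ℝ (f x) (w x)) (volume.restrict (Icc 0 s)) := by
    refine aestronglyMeasurable_of_tendsto_ae atTop (f := fun N => G N) (fun N => ?_)
      (ae_of_all _ hGlim)
    exact (integrableOn_Icc_of_continuousOn_Ioi (hGc N) (hGb N) le_rfl).aestronglyMeasurable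
  have hFb : ∀ x, 0 ≤ x → |inner ℝ (f x) (w x)| ≤ B * W := fun x hx =>
    (abs_real_inner_le_norm _ _).trans
      (mul_le_mul (h.bound x hx) (hW x hx) (norm_nonneg _) hB0)
  have hFint : IntegrableOn (fun x => inner ℝ (f x) (w x)) (Icc 0 s) := by
    refine IntegrableOn.of_bound (C := B * W) (by simp) hGm ?_
    exact (ae_restrict_iff' measurableSet_Icc).2 (ae_of_all _ fun x hx => hFb x hx.1)
  have hGint : ∀ N, IntegrableOn (G N) (Icc 0 s) := fun N =>
    integrableOn_Icc_of_continuousOn_Ioi (hGc N) (hGb N) le_rfl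
  have hconst : IntegrableOn (fun _ : ℝ => 4 * (φ 0 - Q / 2)) (Icc 0 s) :=
    integrableOn_const (by simp)
  have hmain : ∀ N, ∫ x in (0 : ℝ)..s, (4 * (φ 0 - Q / 2) + 2 * (G N x - inner ℝ (f x) (w x))) ≤
      ‖w s‖ ^ 2 := by
    intro N
    have key := intervalIntegral.integral_le_sub_of_hasDeriv_right_of_le
      (g := fun x => ∑ n ∈ Finset.range N, inner ℝ (b n) (w x) ^ 2)
      (g' := fun x => ∑ n ∈ Finset.range N, 2 * inner ℝ (b n) (w x) *
        (-l n * inner ℝ (b n) (w x) + inner ℝ (b n) (f x)))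
      (φ := fun x => 4 * (φ 0 - Q / 2) + 2 * (G N x - inner ℝ (f x) (w x))) hs ?_ ?_ ?_ ?_
    · have h1 := b.sum_sq_inner_le (w s) N
      have h2 : 0 ≤ ∑ n ∈ Finset.range N, inner ℝ (b n) (w 0) ^ 2 :=
        Finset.sum_nonneg fun _ _ => sq_nonneg _
      linarith
    · exact continuousOn_finsetSum _ fun n _ => ((h.cont n).mono fun x hx => hx.1).pow 2
    · intro x hx
      refine HasDerivAt.hasDerivWithinAt ?_
      refine HasDerivAt.fun_sum fun n _ => ?_
      refine ((h.deriv n x hx.1).pow 2).congr_deriv ?_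
      simp
    · exact hconst.add (((hGint N).sub hFint).const_mul 2)
    · intro x hx
      have h1 := h.energy_le hx.1.le
      have h2 : ∑ n ∈ Finset.range N, l n * inner ℝ (b n) (w x) ^ 2 ≤
          ∑' n, l n * inner ℝ (b n) (w x) ^ 2 :=
        (h.summable hx.1.le).sum_le_tsum _ fun n _ => mul_nonneg (h.nonneg n) (sq_nonneg _)
      have h3 := hφ x hx.1.le
      have h4 : ∑ n ∈ Finset.range N, 2 * inner ℝ (b n) (w x) *
        (-l n * inner ℝ (b n) (w x) + inner ℝ (b n) (f x)) =
          -2 * (∑ n ∈ Finset.range N, l n * inner ℝ (b n) (w x) ^ 2) + 2 * G N x := by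
        simp only [G, Finset.mul_sum, ← Finset.sum_add_distrib]
        exact Finset.sum_congr rfl fun n _ => by ring
      rw [h4]
      linarith
  have hlim : Tendsto (fun N => ∫ x in (0 : ℝ)..s,
      (4 * (φ 0 - Q / 2) + 2 * (G N x - inner ℝ (f x) (w x)))) atTop
      (𝓝 (∫ x in (0 : ℝ)..s, 4 * (φ 0 - Q / 2))) := by
    refine intervalIntegral.tendsto_integral_filter_of_dominated_convergence
      (fun _ => |4 * (φ 0 - Q / 2)| + 4 * (B * W)) (Eventually.of_forall fun N => ?_)
      (Eventually.of_forall fun N => ae_of_all _ fun x hx => ?_) (by simp)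
      (ae_of_all _ fun x hx => ?_)
    · rw [uIoc_of_le hs]
      exact ((hconst.add (((hGint N).sub hFint).const_mul 2)).mono_set
        Ioc_subset_Icc_self).aestronglyMeasurable
    · rw [uIoc_of_le hs] at hx
      have h1 := hGb N x hx.1.le
      have h2 := hFb x hx.1.le
      rw [Real.norm_eq_abs]
      refine (abs_add_le _ _).trans ?_
      rw [abs_mul 2, abs_two]
      have := abs_sub (G N x) (inner ℝ (f x) (w x))
      linarith
    · have := (((hGlim x).sub_const (inner ℝ (f x) (w x))).const_mul 2).const_add
        (4 * (φ 0 - Q / 2))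
      simpa using this
  have := le_of_tendsto' hlim hmain
  rwa [intervalIntegral.integral_const, smul_eq_mul, sub_zero, mul_comm] at this

end IsGradientFlow

end GradientFlow

/-! ### Hermite polynomials in the Gaussian space -/

/-- The standard Gaussian measure on the line. -/
noncomputable abbrev gauss : Measure ℝ := ProbabilityTheory.gaussianReal 0 1

/-- The density of `gauss`. -/
noncomputable abbrev gaussDensity : ℝ → ℝ := ProbabilityTheory.gaussianPDFReal 0 1

theorem gaussDensity_eq (x : ℝ) :
    gaussDensity x = (Real.sqrt (2 * Real.pi))⁻¹ * Real.exp (-(x ^ 2) / 2) := by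
  simp [ProbabilityTheory.gaussianPDFReal]

theorem hasDerivAt_gaussDensity (x : ℝ) : HasDerivAt gaussDensity (-x * gaussDensity x) x := by
  have e : gaussDensity = fun x => (Real.sqrt (2 * Real.pi))⁻¹ * Real.exp (-(x ^ 2) / 2) :=
    funext gaussDensity_eq
  rw [e]
  have h := (((hasDerivAt_pow 2 x).neg.div_const 2).exp).const_mul (Real.sqrt (2 * Real.pi))⁻¹
  refine h.congr_deriv ?_
  simp; ring

theorem integral_gauss (f : ℝ → ℝ) : ∫ x, f x ∂gauss = ∫ x, gaussDensity x * f x := by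
  simpa using ProbabilityTheory.integral_gaussianReal_eq_integral_smul (μ := 0) (v := 1)
    (f := f) one_ne_zero

theorem integrable_gauss_iff (f : ℝ → ℝ) :
    Integrable f gauss ↔ Integrable (fun x => gaussDensity x * f x) volume := by
  rw [gauss, ProbabilityTheory.gaussianReal_of_var_ne_zero _ one_ne_zero,
    integrable_withDensity_iff_integrable_smul' (ProbabilityTheory.measurable_gaussianPDF _ _)
      (ae_of_all _ fun _ => ProbabilityTheory.gaussianPDF_lt_top)]
  simp

theorem integrable_pow_gauss (n : ℕ) : Integrable (fun x : ℝ => x ^ n) gauss := by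
  refine ProbabilityTheory.integrable_pow_of_mem_interior_integrableExpSet (X := fun x => x) ?_ n
  rw [ProbabilityTheory.integrableExpSet_fun_id_gaussianReal]
  simp

theorem integrable_polynomial_gauss (q : Polynomial ℝ) :
    Integrable (fun x => q.eval x) gauss := by
  induction q using Polynomial.induction_on' with
  | add p q hp hq => exact (hp.add hq).congr (ae_of_all _ fun x => by simp)
  | monomial n a =>
    exact ((integrable_pow_gauss n).const_mul a).congr (ae_of_all _ fun x => by simp)

theorem memLp_polynomial_gauss (q : Polynomial ℝ) : MemLp (fun x => q.eval x) 2 gauss := by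
  rw [memLp_two_iff_integrable_sq q.continuous.aestronglyMeasurable]
  exact (integrable_polynomial_gauss (q ^ 2)).congr (ae_of_all _ fun x => by simp)

theorem integrable_id_mul_polynomial_gauss (q : Polynomial ℝ) :
    Integrable (fun x => x * q.eval x) gauss :=
  (integrable_polynomial_gauss (Polynomial.X * q)).congr (ae_of_all _ fun x => by simp)

/-- Gaussian integration by parts. -/
theorem integral_mul_polynomial_gauss (q : Polynomial ℝ) :
    ∫ x, x * q.eval x ∂gauss = ∫ x, q.derivative.eval x ∂gauss := by
  have h1 : Integrable (fun x => gaussDensity x * q.eval x) volume :=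
    (integrable_gauss_iff _).1 (integrable_polynomial_gauss q)
  have i1 := integrable_id_mul_polynomial_gauss q
  have i2 := integrable_polynomial_gauss q.derivative
  have h2 : Integrable (fun x => gaussDensity x * (q.derivative.eval x - x * q.eval x)) volume :=
    (integrable_gauss_iff _).1 (i2.sub i1)
  have h3 := integral_eq_zero_of_hasDerivAt_of_integrable
    (f := fun x => gaussDensity x * q.eval x)
    (f' := fun x => gaussDensity x * (q.derivative.eval x - x * q.eval x)) (fun x => by
      refine ((hasDerivAt_gaussDensity x).mul (q.hasDerivAt x)).congr_deriv ?_
      ring) h2 h1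
  rw [← integral_gauss (fun x => q.derivative.eval x - x * q.eval x), integral_sub i2 i1] at h3
  linarith

/-- The (probabilists') Hermite polynomial, with real coefficients. -/
noncomputable def hermitePoly (n : ℕ) : Polynomial ℝ :=
  (Polynomial.hermite n).map (Int.castRingHom ℝ)

theorem hermitePoly_zero : hermitePoly 0 = 1 := by simp [hermitePoly]

theorem hermitePoly_succ (n : ℕ) : hermitePoly (n + 1) =
    Polynomial.X * hermitePoly n - Polynomial.derivative (hermitePoly n) := by
  simp [hermitePoly, Polynomial.hermite_succ, Polynomial.derivative_map]

theorem derivative_hermitePoly_succ (n : ℕ) : Polynomial.derivative (hermitePoly (n + 1)) =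
    ((n : Polynomial ℝ) + 1) * hermitePoly n := by
  induction n with
  | zero => simp [hermitePoly_succ, hermitePoly_zero]
  | succ k ih =>
    rw [hermitePoly_succ (k + 1), Polynomial.derivative_sub, Polynomial.derivative_mul, ih]
    simp only [Polynomial.derivative_X, Polynomial.derivative_mul, Polynomial.derivative_add,
      Polynomial.derivative_natCast, Polynomial.derivative_one]
    rw [hermitePoly_succ k]
    push_cast
    ring

theorem hermitePoly_succ_succ (n : ℕ) : hermitePoly (n + 2) =
    Polynomial.X * hermitePoly (n + 1) - ((n : Polynomial ℝ) + 1) * hermitePoly n := by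
  rw [hermitePoly_succ (n + 1), derivative_hermitePoly_succ]

theorem integral_mul_hermitePoly_succ (q : Polynomial ℝ) (n : ℕ) :
    ∫ x, (q * hermitePoly (n + 1)).eval x ∂gauss =
      ∫ x, (q.derivative * hermitePoly n).eval x ∂gauss := by
  have h := integral_mul_polynomial_gauss (q * hermitePoly n)
  have e1 : ∀ x, (q * hermitePoly (n + 1)).eval x = x * (q * hermitePoly n).eval x -
      (q * (hermitePoly n).derivative).eval x := by
    intro x; rw [hermitePoly_succ]; simp; ring
  have e2 : ∀ x, (q * hermitePoly n).derivative.eval x = (q.derivative * hermitePoly n).eval x +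
      (q * (hermitePoly n).derivative).eval x := by
    intro x; simp [Polynomial.derivative_mul]
  have i1 := integrable_id_mul_polynomial_gauss (q * hermitePoly n)
  simp_rw [e2] at h
  simp_rw [e1]
  rw [integral_add (integrable_polynomial_gauss _) (integrable_polynomial_gauss _)] at h
  rw [integral_sub i1 (integrable_polynomial_gauss _)]
  linarith

theorem integral_hermitePoly_mul (m n : ℕ) :
    ∫ x, (hermitePoly m).eval x * (hermitePoly n).eval x ∂gauss =
      if m = n then (n.factorial : ℝ) else 0 := by
  simp_rw [← Polynomial.eval_mul]
  induction n generalizing m with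
  | zero =>
    cases m with
    | zero => simp [hermitePoly_zero]
    | succ m =>
      rw [mul_comm, integral_mul_hermitePoly_succ]
      simp [hermitePoly_zero]
  | succ n ih =>
    rw [integral_mul_hermitePoly_succ]
    cases m with
    | zero => simp [hermitePoly_zero]
    | succ m =>
      have : ∀ x, ((hermitePoly (m + 1)).derivative * hermitePoly n).eval x =
          ((m : ℝ) + 1) * (hermitePoly m * hermitePoly n).eval x := by
        intro x; rw [derivative_hermitePoly_succ]; simp; ring
      simp_rw [this]
      rw [integral_const_mul, ih]
      by_cases h : m = n
      · subst h; simp [Nat.factorial_succ]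
      · simp [h]

/-- The Ornstein–Uhlenbeck semigroup acts diagonally on Hermite polynomials. -/
theorem integral_hermitePoly_add (n : ℕ) {c s : ℝ} (hcs : c ^ 2 + s ^ 2 = 1) (z : ℝ) :
    ∫ y, (hermitePoly n).eval (c * z + s * y) ∂gauss = c ^ n * (hermitePoly n).eval z := by
  have ecomp : ∀ (q : Polynomial ℝ) y,
      q.eval (c * z + s * y) =
        (q.comp (Polynomial.C (c * z) + Polynomial.C s * Polynomial.X)).eval y := by
    intro q y; simp
  have hint : ∀ q : Polynomial ℝ, Integrable (fun y => q.eval (c * z + s * y)) gauss := by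
    intro q; simp_rw [ecomp]; exact integrable_polynomial_gauss _
  have hint' : ∀ q : Polynomial ℝ, Integrable (fun y => y * q.eval (c * z + s * y)) gauss := by
    intro q; simp_rw [ecomp]; exact integrable_id_mul_polynomial_gauss _
  have stein : ∀ q : Polynomial ℝ, ∫ y, y * q.eval (c * z + s * y) ∂gauss =
      s * ∫ y, q.derivative.eval (c * z + s * y) ∂gauss := by
    intro q
    simp_rw [ecomp]
    rw [integral_mul_polynomial_gauss, ← integral_const_mul]
    congr 1; ext y
    simp [Polynomial.derivative_comp]
  have key : ∀ q : Polynomial ℝ, ∫ y, (Polynomial.X * q).eval (c * z + s * y) ∂gauss =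
      c * z * (∫ y, q.eval (c * z + s * y) ∂gauss) +
        s ^ 2 * ∫ y, q.derivative.eval (c * z + s * y) ∂gauss := by
    intro q
    have : ∀ y, (Polynomial.X * q).eval (c * z + s * y) =
        c * z * q.eval (c * z + s * y) + s * (y * q.eval (c * z + s * y)) := by
      intro y; simp; ring
    simp_rw [this]
    rw [integral_add ((hint q).const_mul _) ((hint' q).const_mul _), integral_const_mul,
      integral_const_mul, stein]
    ring
  induction n using Nat.twoStepInduction with
  | zero => simp [hermitePoly_zero]
  | one =>
    have h := key 1
    rw [hermitePoly_succ, hermitePoly_zero]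
    simpa using h
  | more n ih0 ih1 =>
    rw [hermitePoly_succ_succ]
    simp only [Polynomial.eval_sub]
    have e : ∀ x, (((n : Polynomial ℝ) + 1) * hermitePoly n).eval x =
      ((n : ℝ) + 1) * (hermitePoly n).eval x := by intro x; simp
    rw [integral_sub (hint _) (hint _), key, derivative_hermitePoly_succ, ih1]
    simp_rw [e]
    rw [integral_const_mul, ih0]
    simp
    linear_combination (c ^ n * (n + 1) * (hermitePoly n).eval z) * hcs

theorem integrable_mul_of_memLp_two {f g : ℝ → ℝ} {μ : Measure ℝ} (hf : MemLp f 2 μ)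
    (hg : MemLp g 2 μ) : Integrable (fun x => f x * g x) μ := hf.integrable_mul hg

theorem memLp_exp_mul_abs_gauss (t : ℝ) : MemLp (fun x => Real.exp (t * |x|)) 2 gauss := by
  rw [memLp_two_iff_integrable_sq (by fun_prop)]
  have h := ProbabilityTheory.integrable_exp_mul_abs (X := fun x : ℝ => x) (μ := gauss)
    (t := 2 * t) (ProbabilityTheory.integrable_exp_mul_gaussianReal _)
    (ProbabilityTheory.integrable_exp_mul_gaussianReal _)
  refine h.congr (ae_of_all _ fun x => ?_)
  simp only
  rw [← Real.exp_nat_mul]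
  congr 1
  push_cast
  ring

/-- A square integrable function orthogonal to all Hermite polynomials vanishes: all its moments
vanish, so the Fourier transforms of the measures with densities `f⁺` and `f⁻` agree. -/
theorem ae_eq_zero_of_integral_hermitePoly {f : ℝ → ℝ} (hf : MemLp f 2 gauss)
    (h : ∀ n, ∫ x, f x * (hermitePoly n).eval x ∂gauss = 0) : f =ᵐ[gauss] 0 := by
  have hint : ∀ q : Polynomial ℝ, Integrable (fun x => f x * q.eval x) gauss := fun q =>
    integrable_mul_of_memLp_two hf (memLp_polynomial_gauss q)
  -- by the recursion `x Heₙ₊₁ = Heₙ₊₂ + (n + 1) Heₙ` all mixed moments `∫ f xᵏ Heₙ` vanish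
  have hmom : ∀ k n, ∫ x, f x * (Polynomial.X ^ k * hermitePoly n).eval x ∂gauss = 0 := by
    intro k
    induction k with
    | zero => simpa using h
    | succ k ih =>
      intro n
      cases n with
      | zero =>
        have := ih 1
        rw [hermitePoly_succ] at this
        simpa [hermitePoly_zero, pow_succ] using this
      | succ n =>
        have e : ∀ x, f x * (Polynomial.X ^ (k + 1) * hermitePoly (n + 1)).eval x =
            f x * (Polynomial.X ^ k * hermitePoly (n + 2)).eval x +
              ((n : ℝ) + 1) * (f x * (Polynomial.X ^ k * hermitePoly n).eval x) := by
          intro x; rw [hermitePoly_succ_succ]; simp; ring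
        simp_rw [e]
        rw [integral_add (hint _) ((hint _).const_mul _), integral_const_mul, ih, ih]
        simp
  have hpow : ∀ k, ∫ x, f x * x ^ k ∂gauss = 0 := by
    intro k; simpa [hermitePoly_zero] using hmom k 0
  -- expand the exponential; Gaussian exponential moments allow termwise integration
  have hfour : ∀ t : ℝ, ∫ x, (f x : ℂ) * Complex.exp (t * x * Complex.I) ∂gauss = 0 := by
    intro t
    have hs := hasSum_integral_of_dominated_convergence (μ := gauss)
      (F := fun k x => (f x : ℂ) * ((t * x * Complex.I) ^ k / (k.factorial : ℂ)))
      (f := fun x => (f x : ℂ) * Complex.exp (t * x * Complex.I))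
      (fun k x => |f x| * ((|t| * |x|) ^ k / k.factorial)) (fun k => ?_) (fun k => ?_) ?_ ?_ ?_
    · refine hs.unique ?_
      convert hasSum_zero using 1
      ext k
      have e : ∀ x : ℝ, (f x : ℂ) * ((t * x * Complex.I) ^ k / (k.factorial : ℂ)) =
          ((t * Complex.I) ^ k / (k.factorial : ℂ)) * ((f x * x ^ k : ℝ) : ℂ) := by
        intro x; push_cast; ring
      simp_rw [e]
      rw [integral_const_mul, integral_complex_ofReal, hpow]
      simp
    · have : AEStronglyMeasurable (fun x => (f x : ℂ)) gauss :=
        Complex.continuous_ofReal.comp_aestronglyMeasurable hf.1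
      exact this.mul (by fun_prop)
    · refine ae_of_all _ fun x => le_of_eq ?_
      simp
    · exact ae_of_all _ fun x =>
        (Real.summable_pow_div_factorial (|t| * |x|)).mul_left _
    · have e : ∀ x, ∑' k : ℕ, |f x| * ((|t| * |x|) ^ k / k.factorial) =
          |f x| * Real.exp (|t| * |x|) := by
        intro x
        rw [tsum_mul_left, Real.exp_eq_exp_ℝ, NormedSpace.exp_eq_tsum_div]
      simp_rw [e]
      exact integrable_mul_of_memLp_two hf.abs (memLp_exp_mul_abs_gauss _)
    · refine ae_of_all _ fun x => HasSum.mul_left _ ?_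
      rw [Complex.exp_eq_exp_ℂ]
      exact NormedSpace.expSeries_div_hasSum_exp _
  have hexp : ∀ {g : ℝ → ℝ} (t : ℝ), Integrable g gauss → Integrable (fun x : ℝ =>
      (ENNReal.ofReal (g x)).toReal • Complex.exp (t * x * Complex.I)) gauss := by
    intro g t hg
    refine hg.norm.mono' ?_ (ae_of_all _ fun x => ?_)
    · exact hg.1.aemeasurable.ennreal_ofReal.ennreal_toReal.aestronglyMeasurable.smul
        (by fun_prop)
    · rw [norm_smul, ENNReal.toReal_ofReal']
      have : ‖Complex.exp (t * x * Complex.I)‖ = 1 := by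
        rw [← Complex.ofReal_mul, Complex.norm_exp_ofReal_mul_I]
      rw [this, mul_one, Real.norm_eq_abs, Real.norm_eq_abs, abs_of_nonneg (le_max_right _ _)]
      exact max_le (le_abs_self _) (abs_nonneg _)
  have hf1 : Integrable f gauss := hf.integrable (by norm_num)
  set μ₁ := gauss.withDensity (fun x => ENNReal.ofReal (f x))
  set μ₂ := gauss.withDensity (fun x => ENNReal.ofReal (-f x))
  have : IsFiniteMeasure μ₁ := isFiniteMeasure_withDensity_ofReal hf1.2
  have : IsFiniteMeasure μ₂ := isFiniteMeasure_withDensity_ofReal hf1.neg.2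
  have hm1 : AEMeasurable (fun x => ENNReal.ofReal (f x)) gauss := hf1.1.aemeasurable.ennreal_ofReal
  have hm2 : AEMeasurable (fun x => ENNReal.ofReal (-f x)) gauss :=
    hf1.1.aemeasurable.neg.ennreal_ofReal
  have hμ : μ₁ = μ₂ := by
    refine Measure.ext_of_charFun ?_
    ext t
    rw [charFun_apply_real, charFun_apply_real,
      integral_withDensity_eq_integral_toReal_smul₀ hm1 (by simp),
      integral_withDensity_eq_integral_toReal_smul₀ hm2 (by simp), ← sub_eq_zero,
      ← integral_sub (hexp t hf1)
        (hexp (g := fun x => -f x) t hf1.neg), ← hfour t]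
    congr 1; ext x
    rw [← sub_smul, ENNReal.toReal_ofReal', ENNReal.toReal_ofReal',
      Complex.real_smul]
    congr 2
    rcases le_total 0 (f x) with h0 | h0
    · rw [max_eq_left h0, max_eq_right (by linarith), sub_zero]
    · rw [max_eq_right h0, max_eq_left (by linarith)]; ring
  have hae := (withDensity_eq_iff hm1 hm2 ?_).1 hμ
  · filter_upwards [hae] with x hx
    have h1 := congrArg ENNReal.toReal hx
    simp only [ENNReal.toReal_ofReal'] at h1
    rcases le_total 0 (f x) with h0 | h0
    · rw [max_eq_left h0, max_eq_right (by linarith)] at h1; exact h1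
    · rw [max_eq_right h0, max_eq_left (by linarith)] at h1; simp; linarith
  · exact (lintegral_ofReal_le_lintegral_enorm f).trans_lt hf1.2 |>.ne

/-- The normalized Hermite function `Heₙ / √n!`. -/
noncomputable def hermiteFun (n : ℕ) (x : ℝ) : ℝ :=
  (hermitePoly n).eval x / Real.sqrt n.factorial

theorem memLp_hermiteFun (n : ℕ) : MemLp (hermiteFun n) 2 gauss := by
  have : hermiteFun n = fun x => (hermitePoly n).eval x * (Real.sqrt n.factorial)⁻¹ := by
    ext x; rw [hermiteFun, div_eq_mul_inv]
  rw [this]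
  exact (memLp_polynomial_gauss (hermitePoly n)).mul_const _

theorem orthonormal_hermiteFun :
    Orthonormal ℝ (fun n => (memLp_hermiteFun n).toLp (hermiteFun n)) := by
  rw [orthonormal_iff_ite]
  intro m n
  have : inner ℝ ((memLp_hermiteFun m).toLp (hermiteFun m))
      ((memLp_hermiteFun n).toLp (hermiteFun n)) =
      ∫ x, hermiteFun m x * hermiteFun n x ∂gauss := by
    rw [L2.inner_def]
    refine integral_congr_ae ?_
    filter_upwards [(memLp_hermiteFun m).coeFn_toLp, (memLp_hermiteFun n).coeFn_toLp] with x h1 h2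
    rw [h1, h2]; simp [mul_comm]
  rw [this]
  have e : ∀ x, hermiteFun m x * hermiteFun n x =
      ((hermitePoly m).eval x * (hermitePoly n).eval x) *
        (Real.sqrt m.factorial * Real.sqrt n.factorial)⁻¹ := by
    intro x; simp [hermiteFun]; ring
  simp_rw [e]
  rw [integral_mul_const, integral_hermitePoly_mul]
  split_ifs with h
  · subst h
    rw [Real.mul_self_sqrt (by positivity), mul_inv_cancel₀ (by positivity)]
  · simp

/-- The orthonormal basis of normalized Hermite functions. -/
noncomputable def hermiteBasis : HilbertBasis ℕ ℝ (Lp ℝ 2 gauss) :=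
  HilbertBasis.mkOfOrthogonalEqBot orthonormal_hermiteFun (by
    rw [Submodule.eq_bot_iff]
    intro f hf
    rw [Submodule.mem_orthogonal] at hf
    have h0 : f =ᵐ[gauss] 0 := by
      refine ae_eq_zero_of_integral_hermitePoly (Lp.memLp f) fun n => ?_
      have h1 := hf _ (Submodule.subset_span ⟨n, rfl⟩)
      rw [L2.inner_def] at h1
      have h2 : ∫ x, f x * (hermitePoly n).eval x ∂gauss =
          Real.sqrt n.factorial *
            ∫ x, inner ℝ ((memLp_hermiteFun n).toLp (hermiteFun n) x) (f x) ∂gauss := by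
        rw [← integral_const_mul]
        refine integral_congr_ae ?_
        filter_upwards [(memLp_hermiteFun n).coeFn_toLp] with x h3
        rw [h3]
        have : Real.sqrt n.factorial ≠ 0 := by positivity
        simp [hermiteFun]
        field_simp
      rw [h2, h1, mul_zero]
    exact (Lp.eq_zero_iff_ae_eq_zero).2 h0)

theorem inner_hermiteBasis (n : ℕ) {g : ℝ → ℝ} (hg : MemLp g 2 gauss) :
    inner ℝ (hermiteBasis n) (hg.toLp g) = ∫ x, g x * hermiteFun n x ∂gauss := by
  rw [hermiteBasis, HilbertBasis.coe_mkOfOrthogonalEqBot, L2.inner_def]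
  refine integral_congr_ae ?_
  filter_upwards [(memLp_hermiteFun n).coeFn_toLp, hg.coeFn_toLp] with x h1 h2
  rw [h1, h2]; simp

/-! ### The heat semigroup -/

theorem heatKernel_nonneg (t x : ℝ) : 0 ≤ heatKernel t x := by
  unfold heatKernel; positivity

theorem continuous_heatKernel (t : ℝ) : Continuous (heatKernel t) := by
  unfold heatKernel; fun_prop

theorem measurable_uncurry_heatKernel : Measurable (Function.uncurry heatKernel) := by
  unfold heatKernel Function.uncurry
  fun_prop

theorem heatKernel_eq_gaussianPDFReal {t : ℝ} (ht : 0 < t) :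
    heatKernel t = ProbabilityTheory.gaussianPDFReal 0 (2 * t).toNNReal := by
  ext x
  simp only [heatKernel, ProbabilityTheory.gaussianPDFReal, sub_zero,
    Real.coe_toNNReal (2 * t) (by positivity)]
  congr 2
  · ring_nf
  · ring_nf

theorem integrable_heatKernel {t : ℝ} (ht : 0 < t) : Integrable (heatKernel t) := by
  rw [heatKernel_eq_gaussianPDFReal ht]
  exact ProbabilityTheory.integrable_gaussianPDFReal _ _

theorem integral_heatKernel {t : ℝ} (ht : 0 < t) : ∫ x, heatKernel t x = 1 := by
  rw [heatKernel_eq_gaussianPDFReal ht]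
  exact ProbabilityTheory.integral_gaussianPDFReal_eq_one _
    (by simpa using ht)

theorem integrable_heatKernel_sub {t : ℝ} (ht : 0 < t) (x : ℝ) :
    Integrable (fun y => heatKernel t (x - y)) := (integrable_heatKernel ht).comp_sub_left x

theorem integral_heatKernel_sub {t : ℝ} (ht : 0 < t) (x : ℝ) :
    ∫ y, heatKernel t (x - y) = 1 := by
  rw [integral_sub_left_eq_self (heatKernel t) volume x, integral_heatKernel ht]

theorem integrable_heatKernel_sub_mul {t : ℝ} (ht : 0 < t) (x : ℝ) {f : ℝ → ℝ} {B : ℝ}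
    (hf : AEStronglyMeasurable f volume) (hB : ∀ᵐ y, |f y| ≤ B) :
    Integrable (fun y => heatKernel t (x - y) * f y) :=
  (integrable_heatKernel_sub ht x).mul_bdd hf hB

theorem heatFlow_congr_ae {f g : ℝ → ℝ} (h : f =ᵐ[volume] g) (t x : ℝ) :
    heatFlow t f x = heatFlow t g x :=
  integral_congr_ae (h.mono fun y hy => by simp only [hy])

theorem abs_heatFlow_le {t : ℝ} (ht : 0 < t) (x : ℝ) {f : ℝ → ℝ} {B : ℝ}
    (hB : ∀ᵐ y, |f y| ≤ B) : |heatFlow t f x| ≤ B := by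
  have h := norm_integral_le_of_norm_le (f := fun y => heatKernel t (x - y) * f y)
    ((integrable_heatKernel_sub ht x).mul_const B) (hB.mono fun y hy => by
      rw [Real.norm_eq_abs, abs_mul, abs_of_nonneg (heatKernel_nonneg _ _)]
      exact mul_le_mul_of_nonneg_left hy (heatKernel_nonneg _ _))
  rwa [integral_mul_const, integral_heatKernel_sub ht, one_mul] at h

theorem heatFlow_sub {t : ℝ} (ht : 0 < t) (x : ℝ) {f g : ℝ → ℝ} {B C : ℝ}
    (hf : AEStronglyMeasurable f volume) (hB : ∀ᵐ y, |f y| ≤ B)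
    (hg : AEStronglyMeasurable g volume) (hC : ∀ᵐ y, |g y| ≤ C) :
    heatFlow t f x - heatFlow t g x = heatFlow t (fun y => f y - g y) x := by
  unfold heatFlow
  rw [← integral_sub (integrable_heatKernel_sub_mul ht x hf hB)
    (integrable_heatKernel_sub_mul ht x hg hC)]
  simp only [mul_sub]

/-- Only the normalisation of the heat kernel decreases in time; its exponential factor increases. -/
theorem sqrt_div_mul_heatKernel_le {t t' : ℝ} (ht : 0 < t) (htt : t ≤ t') (x : ℝ) :
    Real.sqrt (t / t') * heatKernel t x ≤ heatKernel t' x := by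
  have ht' := ht.trans_le htt
  unfold heatKernel
  have e : Real.sqrt (t / t') * (Real.sqrt (4 * Real.pi * t))⁻¹ =
      (Real.sqrt (4 * Real.pi * t'))⁻¹ := by
    rw [Real.sqrt_div ht.le, Real.sqrt_mul (by positivity) t, Real.sqrt_mul (by positivity) t']
    have := Real.sqrt_pos.2 ht
    have := Real.sqrt_pos.2 ht'
    field_simp
  rw [← mul_assoc, e]
  gcongr ?_ * Real.exp ?_
  rw [neg_div, neg_div, neg_le_neg_iff]
  gcongr

/-- Continuity of the heat semigroup in time, uniformly in space. It comes from the pointwise bound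
`√(t / t') k_t ≤ k_t'`, which gives `∫ |k_t' - k_t| ≤ 2 (1 - √(t / t'))`. -/
theorem abs_heatFlow_sub_le {t t' : ℝ} (ht : 0 < t) (htt : t ≤ t') (x : ℝ) {f : ℝ → ℝ} {B : ℝ}
    (hf : AEStronglyMeasurable f volume) (hB : ∀ᵐ y, |f y| ≤ B) :
    |heatFlow t' f x - heatFlow t f x| ≤ 2 * B * (1 - Real.sqrt (t / t')) := by
  have ht' := ht.trans_le htt
  set r := Real.sqrt (t / t') with hr
  have hr1 : r ≤ 1 := by
    rw [hr, Real.sqrt_le_one]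
    exact (div_le_one ht').2 htt
  have h : ∀ᵐ y, ‖heatKernel t' (x - y) * f y - heatKernel t (x - y) * f y‖ ≤
      (heatKernel t' (x - y) + (1 - 2 * r) * heatKernel t (x - y)) * B := by
    filter_upwards [hB] with y hy
    have h1 := sqrt_div_mul_heatKernel_le ht htt (x - y)
    have h2 := heatKernel_nonneg t (x - y)
    rw [← hr] at h1
    rw [← sub_mul, Real.norm_eq_abs, abs_mul]
    have h3 : |heatKernel t' (x - y) - heatKernel t (x - y)| ≤
        heatKernel t' (x - y) + (1 - 2 * r) * heatKernel t (x - y) := by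
      rw [abs_le]; constructor <;> nlinarith
    exact mul_le_mul h3 hy (abs_nonneg _) ((abs_nonneg _).trans h3)
  have i1 := integrable_heatKernel_sub ht x
  have i2 := integrable_heatKernel_sub ht' x
  have := norm_integral_le_of_norm_le ((i2.add (i1.const_mul (1 - 2 * r))).mul_const B) h
  rw [integral_sub (integrable_heatKernel_sub_mul ht' x hf hB)
    (integrable_heatKernel_sub_mul ht x hf hB)] at this
  simp only [Pi.add_apply] at this
  rw [integral_mul_const, integral_add i2 (i1.const_mul _), integral_const_mul,
    integral_heatKernel_sub ht, integral_heatKernel_sub ht'] at this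
  refine this.trans (le_of_eq ?_)
  ring

theorem tendstoUniformly_heatFlow {t : ℝ} (ht : 0 < t) {f : ℝ → ℝ} {B : ℝ}
    (hf : AEStronglyMeasurable f volume) (hB : ∀ᵐ y, |f y| ≤ B) :
    TendstoUniformly (fun s => heatFlow s f) (heatFlow t f) (𝓝 t) := by
  have hlim : Tendsto (fun s => 2 * B * (1 - Real.sqrt (min s t / max s t))) (𝓝 t) (𝓝 0) := by
    have hc : ContinuousAt (fun s => 2 * B * (1 - Real.sqrt (min s t / max s t))) t := by
      have : max t t ≠ 0 := by simpa using ht.ne'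
      fun_prop (disch := assumption)
    have := hc.tendsto
    simpa [ht.ne'] using this
  rw [Metric.tendstoUniformly_iff]
  intro ε hε
  filter_upwards [hlim.eventually (gt_mem_nhds hε), lt_mem_nhds ht] with s h1 h2 x
  refine lt_of_le_of_lt ?_ h1
  rw [Real.dist_eq]
  rcases le_total s t with h | h
  · rw [min_eq_left h, max_eq_right h]
    exact abs_heatFlow_sub_le h2 h x hf hB
  · rw [min_eq_right h, max_eq_left h, abs_sub_comm]
    exact abs_heatFlow_sub_le ht h x hf hB

theorem continuous_heatFlow {t : ℝ} (ht : 0 < t) {f : ℝ → ℝ} {B : ℝ}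
    (hf : AEStronglyMeasurable f volume) (hB : ∀ᵐ y, |f y| ≤ B) : Continuous (heatFlow t f) := by
  rw [continuous_iff_continuousAt]
  intro x₀
  refine continuousAt_of_dominated (bound := fun y => (Real.sqrt (4 * Real.pi * t))⁻¹ *
    Real.exp (1 / (4 * t)) * Real.exp (-(1 / (8 * t)) * (y - x₀) ^ 2) * B) ?_ ?_ ?_ ?_
  · refine Eventually.of_forall fun x => ?_
    exact (integrable_heatKernel_sub_mul ht x hf hB).aestronglyMeasurable
  · filter_upwards [Metric.ball_mem_nhds x₀ one_pos] with x hx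
    filter_upwards [hB] with y hy
    rw [norm_mul, Real.norm_of_nonneg (heatKernel_nonneg _ _)]
    refine mul_le_mul ?_ hy (abs_nonneg _) (by positivity)
    rw [heatKernel, mul_assoc (_)⁻¹, ← Real.exp_add]
    gcongr ?_ * Real.exp ?_
    rw [Metric.mem_ball, Real.dist_eq] at hx
    have h1 : (x - x₀) ^ 2 ≤ 1 := by
      rw [← sq_abs]; exact pow_le_one₀ (abs_nonneg _) hx.le
    have h2 : -(x - y) ^ 2 ≤ 1 - (y - x₀) ^ 2 / 2 := by
      nlinarith [sq_nonneg ((x - y) + (x - x₀))]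
    calc -(x - y) ^ 2 / (4 * t) ≤ (1 - (y - x₀) ^ 2 / 2) / (4 * t) := by gcongr
      _ = _ := by field_simp; ring
  · refine Integrable.mul_const (Integrable.const_mul ?_ _) _
    exact (integrable_exp_neg_mul_sq (b := 1 / (8 * t)) (by positivity)).comp_sub_right x₀
  · refine ae_of_all _ fun y => ?_
    have := continuous_heatKernel t
    fun_prop

theorem heatFlow_eq_integral_gauss {t : ℝ} (ht : 0 < t) (f : ℝ → ℝ) (x : ℝ) :
    heatFlow t f x = ∫ z, f (x + Real.sqrt (2 * t) * z) ∂gauss := by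
  set c := Real.sqrt (2 * t) with hc
  have hc0 : 0 < c := Real.sqrt_pos.2 (by positivity)
  have hc2 : c ^ 2 = 2 * t := Real.sq_sqrt (by positivity)
  rw [integral_gauss]
  have e : ∀ z, gaussDensity z * f (x + c * z) =
      (fun y => c * (heatKernel t (x - y) * f y)) (x + c * z) := by
    intro z
    simp only
    rw [gaussDensity_eq, ← mul_assoc]
    congr 1
    rw [heatKernel, ← mul_assoc]
    have e1 : Real.sqrt (4 * Real.pi * t) = c * Real.sqrt (2 * Real.pi) := by
      rw [hc, ← Real.sqrt_mul (by positivity)]; congr 1; ring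
    congr 1
    · rw [e1]; field_simp
    · congr 1
      have : (x - (x + c * z)) ^ 2 = (2 * t) * z ^ 2 := by rw [← hc2]; ring
      rw [this]; field_simp; ring
  simp_rw [e]
  rw [Measure.integral_comp_mul_left (fun z => (fun y => c * (heatKernel t (x - y) * f y)) (x + z)) c,
    integral_add_left_eq_self (fun y => c * (heatKernel t (x - y) * f y)) x, integral_const_mul,
    abs_of_pos (inv_pos.2 hc0), smul_eq_mul, ← mul_assoc, inv_mul_cancel₀ hc0.ne', one_mul]
  rfl

theorem integrable_bdd_mul_hermiteFun {f : ℝ → ℝ} (hf : Measurable f) {B : ℝ}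
    (hB : ∀ y, |f y| ≤ B) (n : ℕ) : Integrable (fun z => f z * hermiteFun n z) gauss :=
  ((memLp_hermiteFun n).integrable (by norm_num)).bdd_mul hf.aestronglyMeasurable
    (ae_of_all _ hB)

/-- In the Gaussian variable seen from `x₀` at backward time `b`, the heat flow over a time `a` is
the Ornstein–Uhlenbeck semigroup: it multiplies the `n`-th Hermite coefficient by
`(b / (a + b)) ^ (n / 2)`. -/
theorem integral_heatFlow_mul_hermiteFun {a b : ℝ} (ha : 0 < a) (hb : 0 < b) {f : ℝ → ℝ}
    (hf : Measurable f) {B : ℝ} (hB : ∀ y, |f y| ≤ B) (x₀ : ℝ) (n : ℕ) :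
    ∫ z, heatFlow a f (x₀ + Real.sqrt (2 * b) * z) * hermiteFun n z ∂gauss =
      Real.sqrt (b / (a + b)) ^ n *
        ∫ z, f (x₀ + Real.sqrt (2 * (a + b)) * z) * hermiteFun n z ∂gauss := by
  set R := Real.sqrt (2 * (a + b)) with hR
  set c := Real.sqrt (b / (a + b)) with hc
  set s := Real.sqrt (a / (a + b)) with hs
  have hcs : c ^ 2 + s ^ 2 = 1 := by
    rw [hc, hs, Real.sq_sqrt (by positivity), Real.sq_sqrt (by positivity)]
    field_simp; ring
  have hRc : Real.sqrt (2 * b) = R * c := by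
    rw [hR, hc, ← Real.sqrt_mul (by positivity)]; congr 1; field_simp
  have hRs : Real.sqrt (2 * a) = R * s := by
    rw [hR, hs, ← Real.sqrt_mul (by positivity)]; congr 1; field_simp
  obtain ⟨θ, hθc, hθs⟩ : ∃ θ, Real.cos θ = c ∧ Real.sin θ = s := by
    refine ⟨Real.arccos c, Real.cos_arccos ?_ ?_, ?_⟩
    · linarith [Real.sqrt_nonneg (b / (a + b))]
    · nlinarith [Real.sqrt_nonneg (b / (a + b))]
    · rw [Real.sin_arccos, hs]
      have : 1 - c ^ 2 = s ^ 2 := by linarith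
      rw [this, Real.sqrt_sq (Real.sqrt_nonneg _)]
  have hrot : (gauss.prod gauss).map (ContinuousLinearMap.rotation θ) = gauss.prod gauss :=
    ProbabilityTheory.IsGaussian.map_rotation_eq_self
      (by simp) θ
  set h : ℝ × ℝ → ℝ := fun q => f (x₀ + R * q.1) * hermiteFun n (c * q.1 - s * q.2) with hh
  have hH : Measurable (hermiteFun n) := by
    unfold hermiteFun
    exact (hermitePoly n).continuous.measurable.div_const _
  have hm : Measurable h := by fun_prop
  have hcomp : ∀ q, h (ContinuousLinearMap.rotation θ q) =
      f (x₀ + R * c * q.1 + R * s * q.2) * hermiteFun n q.1 := by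
    intro q
    simp only [hh, ContinuousLinearMap.rotation_apply, hθc, hθs, smul_eq_mul]
    congr 2
    · ring
    · linear_combination q.1 * hcs
  have hi1 : Integrable (fun q : ℝ × ℝ => f (x₀ + R * c * q.1 + R * s * q.2) * hermiteFun n q.1)
      (gauss.prod gauss) := by
    have : Integrable (fun q : ℝ × ℝ => hermiteFun n q.1) (gauss.prod gauss) :=
      ((memLp_hermiteFun n).integrable (by norm_num)).comp_fst _
    refine this.bdd_mul (c := B) ?_ (ae_of_all _ fun q => hB _)
    exact (hf.comp (by fun_prop)).aestronglyMeasurable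
  have hi2 : Integrable h (gauss.prod gauss) := by
    rw [← hrot, integrable_map_measure hm.aestronglyMeasurable (by fun_prop)]
    exact hi1.congr (ae_of_all _ fun q => (hcomp q).symm)
  calc ∫ z, heatFlow a f (x₀ + Real.sqrt (2 * b) * z) * hermiteFun n z ∂gauss
      = ∫ z, ∫ y, f (x₀ + R * c * z + R * s * y) * hermiteFun n z ∂gauss ∂gauss := by
        congr 1; ext z
        rw [heatFlow_eq_integral_gauss ha, integral_mul_const, hRc, hRs]
    _ = ∫ q, h (ContinuousLinearMap.rotation θ q) ∂(gauss.prod gauss) := by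
        simp_rw [hcomp]
        exact (integral_prod _ hi1).symm
    _ = ∫ q, h q ∂(gauss.prod gauss) := by
        conv_rhs => rw [← hrot]
        rw [integral_map (by fun_prop) hm.aestronglyMeasurable]
    _ = ∫ z, f (x₀ + R * z) * ∫ y, hermiteFun n (c * z - s * y) ∂gauss ∂gauss := by
        rw [integral_prod _ hi2]
        simp only [hh, integral_const_mul]
    _ = c ^ n * ∫ z, f (x₀ + R * z) * hermiteFun n z ∂gauss := by
        rw [← integral_const_mul]
        congr 1; ext z
        have := integral_hermitePoly_add n (c := c) (s := -s) (by rw [neg_sq]; exact hcs) z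
        simp only [hermiteFun, integral_div]
        simp only [neg_mul, ← sub_eq_add_neg] at this
        rw [this]
        ring

/-! ### Duhamel integrals -/

/-- The Duhamel integral `∫₀ᵗ e^{(t-s)∂²} g(s) ds`. -/
noncomputable def duhamel (g : ℝ → ℝ → ℝ) (t x : ℝ) : ℝ :=
  ∫ s in (0 : ℝ)..t, heatFlow (t - s) (g s) x

/-- A source term on `(0, S)`, measurable and bounded by `B`. -/
structure IsSource (g : ℝ → ℝ → ℝ) (S B : ℝ) : Prop where
  meas : AEStronglyMeasurable (Function.uncurry g) ((volume.restrict (Ioo 0 S)).prod volume)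
  slice : ∀ s ∈ Ioo 0 S, AEStronglyMeasurable (g s) volume
  bound : ∀ s ∈ Ioo 0 S, ∀ y, |g s y| ≤ B

theorem IsSource.mono {g : ℝ → ℝ → ℝ} {S B S' : ℝ} (h : IsSource g S B) (hS : S' ≤ S) :
    IsSource g S' B where
  meas := by
    have := h.meas
    rw [Measure.restrict_prod_eq_prod_univ] at this ⊢
    exact this.mono_set (prod_mono (Ioo_subset_Ioo_right hS) Subset.rfl)
  slice s hs := h.slice s ⟨hs.1, hs.2.trans_le hS⟩
  bound s hs := h.bound s ⟨hs.1, hs.2.trans_le hS⟩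

theorem IsSource.of_measurable {g : ℝ → ℝ → ℝ} {B : ℝ} (hg : Measurable (Function.uncurry g))
    (hB : ∀ s y, |g s y| ≤ B) (S : ℝ) : IsSource g S B where
  meas := hg.aestronglyMeasurable
  slice _ _ := (hg.comp (measurable_const.prodMk measurable_id)).aestronglyMeasurable
  bound s _ y := hB s y

theorem duhamel_eq_Ioo {g : ℝ → ℝ → ℝ} {t : ℝ} (ht : 0 ≤ t) (x : ℝ) :
    duhamel g t x = ∫ s in Ioo 0 t, heatFlow (t - s) (g s) x := by
  rw [duhamel, intervalIntegral.integral_of_le ht, integral_Ioc_eq_integral_Ioo]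

theorem abs_setIntegral_heatFlow_le {g : ℝ → ℝ → ℝ} {a c t x : ℝ} {b : ℝ → ℝ} (hct : c ≤ t)
    (hb : ∀ s ∈ Ioo a c, ∀ᵐ y, |g s y| ≤ b s) (hi : IntegrableOn b (Ioo a c)) :
    |∫ s in Ioo a c, heatFlow (t - s) (g s) x| ≤ ∫ s in Ioo a c, b s := by
  rw [← Real.norm_eq_abs]
  refine norm_integral_le_of_norm_le hi ?_
  refine (ae_restrict_iff' measurableSet_Ioo).2 (ae_of_all _ fun s hs => ?_)
  exact abs_heatFlow_le (sub_pos.2 (hs.2.trans_le hct)) x (hb s hs)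

theorem abs_duhamel_le {g : ℝ → ℝ → ℝ} {t x : ℝ} {b : ℝ → ℝ} (ht : 0 ≤ t)
    (hb : ∀ s ∈ Ioo 0 t, ∀ᵐ y, |g s y| ≤ b s) (hi : IntervalIntegrable b volume 0 t) :
    |duhamel g t x| ≤ ∫ s in (0 : ℝ)..t, b s := by
  rw [duhamel_eq_Ioo ht, intervalIntegral.integral_of_le ht, integral_Ioc_eq_integral_Ioo]
  exact abs_setIntegral_heatFlow_le le_rfl hb
    ((intervalIntegrable_iff_integrableOn_Ioo_of_le ht).1 hi)

namespace IsSource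

variable {g : ℝ → ℝ → ℝ} {S B : ℝ}

theorem abs_duhamel_le (h : IsSource g S B) {t : ℝ} (ht : 0 ≤ t) (htS : t ≤ S) (x : ℝ) :
    |duhamel g t x| ≤ B * t := by
  refine (_root_.abs_duhamel_le (b := fun _ => B) ht (fun s hs => ae_of_all _
    (h.bound s ⟨hs.1, hs.2.trans_le htS⟩)) (by simp)).trans (le_of_eq ?_)
  simp [mul_comm]

theorem aestronglyMeasurable (h : IsSource g S B) (t x : ℝ) :
    AEStronglyMeasurable (fun s => heatFlow (t - s) (g s) x) (volume.restrict (Ioo 0 S)) := by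
  have hm : AEStronglyMeasurable (fun q : ℝ × ℝ => heatKernel (t - q.1) (x - q.2) * g q.1 q.2)
      ((volume.restrict (Ioo 0 S)).prod volume) := by
    refine AEStronglyMeasurable.mul ?_ h.meas
    exact (measurable_uncurry_heatKernel.comp
      (((measurable_const.sub measurable_fst)).prodMk
        (measurable_const.sub measurable_snd))).aestronglyMeasurable
  exact hm.integral_prod_right'

theorem integrableOn (h : IsSource g S B) {t : ℝ} (htS : S ≤ t) (x : ℝ) :
    IntegrableOn (fun s => heatFlow (t - s) (g s) x) (Ioo 0 S) := by
  refine IntegrableOn.of_bound (C := B) (by simp) (h.aestronglyMeasurable t x) ?_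
  refine (ae_restrict_iff' measurableSet_Ioo).2 (ae_of_all _ fun s hs => ?_)
  exact abs_heatFlow_le (sub_pos.2 (hs.2.trans_le htS)) x (ae_of_all _ (h.bound s hs))

theorem duhamel_sub {k : ℝ → ℝ → ℝ} {C : ℝ} (h : IsSource g S B) (hk : IsSource k S C)
    (hS : 0 ≤ S) (x : ℝ) :
    duhamel g S x - duhamel k S x = duhamel (fun s y => g s y - k s y) S x := by
  rw [duhamel_eq_Ioo hS, duhamel_eq_Ioo hS, duhamel_eq_Ioo hS,
    ← integral_sub (h.integrableOn le_rfl x) (hk.integrableOn le_rfl x)]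
  refine setIntegral_congr_fun measurableSet_Ioo fun s hs => ?_
  exact heatFlow_sub (sub_pos.2 hs.2) x (h.slice s hs) (ae_of_all _ (h.bound s hs))
    (hk.slice s hs) (ae_of_all _ (hk.bound s hs))

theorem nonneg (h : IsSource g S B) (hS : 0 < S) : 0 ≤ B :=
  (abs_nonneg _).trans (h.bound (S / 2) ⟨by linarith, by linarith⟩ 0)

/-- Continuity of the Duhamel integral in time: the first term comes from the new part of the
source, the second from `abs_heatFlow_sub_le`. -/
theorem abs_duhamel_sub_le (h : IsSource g S B) {t t' : ℝ} (ht : 0 < t) (htt : t < t')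
    (htS : t' ≤ S) (x : ℝ) : |duhamel g t' x - duhamel g t x| ≤
      B * (t' - t) + 4 * B * (Real.sqrt (t' - t) * Real.sqrt t') := by
  have ht' := ht.trans htt
  have hB : 0 ≤ B := h.nonneg (ht'.trans_le htS)
  have h' := h.mono htS
  have h0 := h.mono (htt.le.trans htS)
  have hi := h'.integrableOn le_rfl x
  have hi1 : IntegrableOn (fun s => heatFlow (t' - s) (g s) x) (Ioo 0 t) :=
    hi.mono_set (Ioo_subset_Ioo_right htt.le)
  have hi2 : IntegrableOn (fun s => heatFlow (t' - s) (g s) x) (Ico t t') :=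
    hi.mono_set fun s hs => ⟨ht.trans_le hs.1, hs.2⟩
  have e1 : duhamel g t' x = (∫ s in Ioo 0 t, heatFlow (t' - s) (g s) x) +
      ∫ s in Ioo t t', heatFlow (t' - s) (g s) x := by
    rw [duhamel_eq_Ioo ht'.le, ← Ioo_union_Ico_eq_Ioo ht htt.le,
      setIntegral_union (Set.disjoint_left.2 fun s hs hs' => absurd hs.2 (not_lt.2 hs'.1))
        measurableSet_Ico hi1 hi2, integral_Ico_eq_integral_Ioo]
  have e2 : |∫ s in Ioo t t', heatFlow (t' - s) (g s) x| ≤ B * (t' - t) := by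
    refine (abs_setIntegral_heatFlow_le (b := fun _ => B) le_rfl (fun s hs => ae_of_all _
      (h'.bound s ⟨ht.trans hs.1, hs.2⟩)) (by simp)).trans (le_of_eq ?_)
    simp [htt.le, mul_comm]
  -- for `s < t` use `1 - √(1 - q) ≤ √q` with `q = (t' - t) / (t' - s)`, integrable in `s`
  have e3 : |(∫ s in Ioo 0 t, heatFlow (t' - s) (g s) x) - duhamel g t x| ≤
      4 * B * (Real.sqrt (t' - t) * Real.sqrt t') := by
    rw [duhamel_eq_Ioo ht.le, ← integral_sub hi1 (h0.integrableOn le_rfl x)]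
    have hder : ∀ s ∈ uIcc 0 t, HasDerivAt
        (fun s => -(4 * B * (Real.sqrt (t' - t) * Real.sqrt (t' - s))))
        (2 * B * (Real.sqrt (t' - t) / Real.sqrt (t' - s))) s := by
      intro s hs
      rw [uIcc_of_le ht.le] at hs
      have hpos : 0 < t' - s := by linarith [hs.2]
      have := ((((hasDerivAt_id s).const_sub t').sqrt hpos.ne').const_mul
        (Real.sqrt (t' - t))).const_mul (4 * B) |>.neg
      refine this.congr_deriv ?_
      simp only [id]
      have := Real.sqrt_pos.2 hpos
      field_simp
      ring
    have hcont : ContinuousOn (fun s => 2 * B * (Real.sqrt (t' - t) / Real.sqrt (t' - s)))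
        (uIcc 0 t) := by
      intro s hs
      rw [uIcc_of_le ht.le] at hs
      have hpos : 0 < t' - s := by linarith [hs.2]
      have : Real.sqrt (t' - s) ≠ 0 := (Real.sqrt_pos.2 hpos).ne'
      exact ContinuousAt.continuousWithinAt (by fun_prop (disch := assumption))
    have hint := hcont.intervalIntegrable (μ := volume)
    have hval := intervalIntegral.integral_eq_sub_of_hasDerivAt hder hint
    rw [← Real.norm_eq_abs]
    refine (norm_integral_le_of_norm_le ((intervalIntegrable_iff_integrableOn_Ioo_of_le ht.le).1 hint)
      ?_).trans ?_
    · refine (ae_restrict_iff' measurableSet_Ioo).2 (ae_of_all _ fun s hs => ?_)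
      have hs1 : 0 < t - s := sub_pos.2 hs.2
      have hs2 : 0 < t' - s := by linarith
      refine (abs_heatFlow_sub_le hs1 (by linarith) x (h0.slice s hs)
        (ae_of_all _ (h0.bound s hs))).trans ?_
      refine mul_le_mul_of_nonneg_left ?_ (by positivity)
      rw [← Real.sqrt_div (by linarith)]
      set q := (t' - t) / (t' - s) with hq
      have hq1 : (t - s) / (t' - s) = 1 - q := by rw [hq]; field_simp; ring
      have hq0 : 0 ≤ q := by rw [hq]; exact div_nonneg (by linarith) hs2.le
      have hq2 : q ≤ 1 := by rw [hq, div_le_one hs2]; linarith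
      rw [hq1]
      have h1 := Real.sqrt_nonneg (1 - q)
      have h2 := Real.sqrt_nonneg q
      have h3 := Real.sq_sqrt hq0
      have h4 := Real.sq_sqrt (sub_nonneg.2 hq2)
      nlinarith
    · rw [← integral_Ioc_eq_integral_Ioo, ← intervalIntegral.integral_of_le ht.le, hval, sub_zero]
      have : 0 ≤ 4 * B * (Real.sqrt (t' - t) * Real.sqrt (t' - t)) := by positivity
      linarith
  rw [e1]
  calc _ = |(∫ s in Ioo t t', heatFlow (t' - s) (g s) x) +
        ((∫ s in Ioo 0 t, heatFlow (t' - s) (g s) x) - duhamel g t x)| := by congr 1; ring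
    _ ≤ _ := (abs_add_le _ _).trans (add_le_add e2 e3)

theorem tendstoUniformly_duhamel (h : IsSource g S B) {t : ℝ} (ht : 0 < t) (htS : t < S) :
    TendstoUniformly (duhamel g) (duhamel g t) (𝓝 t) := by
  have hlim : Tendsto (fun s => B * (max s t - min s t) +
      4 * B * (Real.sqrt (max s t - min s t) * Real.sqrt (max s t))) (𝓝 t) (𝓝 0) := by
    have hc : Continuous (fun s => B * (max s t - min s t) +
      4 * B * (Real.sqrt (max s t - min s t) * Real.sqrt (max s t))) := by fun_prop
    have := hc.tendsto t
    simpa using this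
  rw [Metric.tendstoUniformly_iff]
  intro ε hε
  filter_upwards [hlim.eventually (gt_mem_nhds hε), lt_mem_nhds ht, gt_mem_nhds htS]
    with s h1 h2 h3 x
  refine lt_of_le_of_lt ?_ h1
  rw [Real.dist_eq]
  rcases lt_trichotomy s t with hst | rfl | hst
  · rw [min_eq_left hst.le, max_eq_right hst.le]
    exact h.abs_duhamel_sub_le h2 hst htS.le x
  · simp
  · rw [min_eq_right hst.le, max_eq_left hst.le, abs_sub_comm]
    exact h.abs_duhamel_sub_le ht hst h3.le x

theorem continuous_duhamel (h : IsSource g S B) {t : ℝ} (ht : 0 < t) (htS : t ≤ S) :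
    Continuous (duhamel g t) := by
  have e : duhamel g t = fun x => ∫ s in Ioo 0 t, heatFlow (t - s) (g s) x :=
    funext fun x => duhamel_eq_Ioo ht.le x
  rw [e]
  have h' := h.mono htS
  refine continuous_of_dominated (bound := fun _ => B) (fun x => h'.aestronglyMeasurable t x)
    (fun x => ?_) (by simp) ?_
  · refine (ae_restrict_iff' measurableSet_Ioo).2 (ae_of_all _ fun s hs => ?_)
    exact abs_heatFlow_le (sub_pos.2 hs.2) x (ae_of_all _ (h'.bound s hs))
  · refine (ae_restrict_iff' measurableSet_Ioo).2 (ae_of_all _ fun s hs => ?_)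
    exact continuous_heatFlow (sub_pos.2 hs.2) (h'.slice s hs) (ae_of_all _ (h'.bound s hs))

end IsSource

/-- The right-hand side of Duhamel's formula, with source `g`. -/
noncomputable def mildMap (u₀ : ℝ → ℝ) (g : ℝ → ℝ → ℝ) (t x : ℝ) : ℝ :=
  heatFlow t u₀ x + duhamel g t x

theorem mildMap_congr {u₀ : ℝ → ℝ} {g h : ℝ → ℝ → ℝ} {t : ℝ} (ht : 0 ≤ t)
    (hgh : ∀ s ∈ Ioo 0 t, g s =ᵐ[volume] h s) (x : ℝ) :
    mildMap u₀ g t x = mildMap u₀ h t x := by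
  rw [mildMap, mildMap, duhamel_eq_Ioo ht, duhamel_eq_Ioo ht]
  congr 1
  exact setIntegral_congr_fun measurableSet_Ioo fun s hs => heatFlow_congr_ae (hgh s hs) _ _

section MildMap

variable {u₀ : ℝ → ℝ} {B₀ : ℝ} {g : ℝ → ℝ → ℝ} {S B : ℝ}

theorem abs_mildMap_le (hB₀ : ∀ᵐ y, |u₀ y| ≤ B₀) (h : IsSource g S B) {t : ℝ} (ht : 0 < t)
    (htS : t ≤ S) (x : ℝ) : |mildMap u₀ g t x| ≤ B₀ + B * t :=
  (abs_add_le _ _).trans (add_le_add (abs_heatFlow_le ht x hB₀) (h.abs_duhamel_le ht.le htS x))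

theorem tendstoUniformly_mildMap (hu₀ : AEStronglyMeasurable u₀ volume)
    (hB₀ : ∀ᵐ y, |u₀ y| ≤ B₀) (h : IsSource g S B) {t : ℝ} (ht : 0 < t) (htS : t < S) :
    TendstoUniformly (mildMap u₀ g) (mildMap u₀ g t) (𝓝 t) :=
  (tendstoUniformly_heatFlow ht hu₀ hB₀).add (h.tendstoUniformly_duhamel ht htS)

theorem continuous_mildMap (hu₀ : AEStronglyMeasurable u₀ volume)
    (hB₀ : ∀ᵐ y, |u₀ y| ≤ B₀) (h : IsSource g S B) {t : ℝ} (ht : 0 < t) (htS : t ≤ S) :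
    Continuous (mildMap u₀ g t) :=
  (continuous_heatFlow ht hu₀ hB₀).add (h.continuous_duhamel ht htS)

theorem continuousOn_mildMap (hu₀ : AEStronglyMeasurable u₀ volume)
    (hB₀ : ∀ᵐ y, |u₀ y| ≤ B₀) (h : ∀ S, IsSource g S B) :
    ContinuousOn (Function.uncurry (mildMap u₀ g)) (Ioi 0 ×ˢ univ) := by
  rintro ⟨t, x⟩ ⟨ht, -⟩
  refine ContinuousAt.continuousWithinAt ?_
  have ht : 0 < t := ht
  have h1 := (continuous_mildMap hu₀ hB₀ (h (t + 1)) ht (by linarith)).continuousAt (x := x)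
  have h2 := tendstoUniformly_mildMap hu₀ hB₀ (h (t + 1)) ht (by linarith)
  rw [Metric.continuousAt_iff'] at h1 ⊢
  rw [Metric.tendstoUniformly_iff] at h2
  intro ε hε
  have h3 := (continuous_fst.tendsto (t, x)).eventually (h2 (ε / 2) (by positivity))
  have h4 := (continuous_snd.tendsto (t, x)).eventually (h1 (ε / 2) (by positivity))
  filter_upwards [h3, h4] with q h5 h6
  have h7 := h5 q.2
  rw [dist_comm] at h7
  calc _ ≤ dist (mildMap u₀ g q.1 q.2) (mildMap u₀ g t q.2) +
        dist (mildMap u₀ g t q.2) (mildMap u₀ g t x) := dist_triangle _ _ _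
    _ < ε := by linarith

end MildMap

/-! ### The problem with bounded Lipschitz nonlinearity -/

/-- `u` is the global mild solution of `u_t = u_xx + N(u)`, `u(·, 0) = u₀`, given by its
representative that is continuous for positive times. -/
structure IsMildFlow (N : ℝ → ℝ) (u₀ : ℝ → ℝ) (u : ℝ → ℝ → ℝ) : Prop where
  meas : Measurable (Function.uncurry u)
  initial : u 0 = u₀
  eq : ∀ t, 0 < t → ∀ x, u t x = mildMap u₀ (fun s y => N (u s y)) t x

section Lipschitz

variable {N : ℝ → ℝ} {K B : ℝ} {u₀ : ℝ → ℝ} {B₀ : ℝ}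

/-- Picard iteration in a norm with exponential weight in time. A global solution exists because `N`
is globally Lipschitz. -/
theorem exists_isMildFlow (hK : 0 < K) (hN : ∀ a b, |N a - N b| ≤ K * |a - b|)
    (hB : ∀ a, |N a| ≤ B) (hu₀ : Measurable u₀) (hB₀ : ∀ y, |u₀ y| ≤ B₀) :
    ∃ u, IsMildFlow N u₀ u := by
  have hNc : Continuous N :=
    (LipschitzWith.of_dist_le_mul (K := ⟨K, hK.le⟩) fun a b => hN a b).continuous
  -- functions of `(log t, x)` carrying the weight `e^{-2Kt}`, in which the map is a contraction
  let ext : BoundedContinuousFunction (ℝ × ℝ) ℝ → ℝ → ℝ → ℝ := fun b s y =>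
    if 0 < s then Real.exp (2 * K * s) * b (Real.log s, y) else u₀ y
  have ext_meas : ∀ b, Measurable (Function.uncurry (ext b)) := by
    intro b
    refine Measurable.ite (measurableSet_lt measurable_const measurable_fst) ?_ ?_
    · have := b.continuous.measurable
      fun_prop
    · fun_prop
  have src : ∀ b S, IsSource (fun s y => N (ext b s y)) S B := fun b S =>
    IsSource.of_measurable (g := fun s y => N (ext b s y)) (hNc.measurable.comp (ext_meas b))
      (fun s y => hB _) S
  have hB0 : 0 ≤ B := (abs_nonneg _).trans (hB 0)
  have hbd : ∀ b t x, 0 < t → |Real.exp (-(2 * K * t)) *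
      mildMap u₀ (fun s y => N (ext b s y)) t x| ≤ B₀ + B / (2 * K) := by
    intro b t x ht
    have h1 := abs_mildMap_le (ae_of_all _ hB₀) (src b t) ht le_rfl x
    have h2 : 0 ≤ B₀ := (abs_nonneg _).trans (hB₀ 0)
    rw [abs_mul, abs_of_pos (Real.exp_pos _)]
    have h3 : Real.exp (-(2 * K * t)) ≤ 1 := by rw [Real.exp_le_one_iff]; nlinarith
    have h4 : Real.exp (-(2 * K * t)) * (2 * K * t) ≤ 1 := by
      have := Real.add_one_le_exp (2 * K * t)
      rw [Real.exp_neg, inv_mul_le_iff₀ (Real.exp_pos _)]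
      linarith
    calc _ ≤ Real.exp (-(2 * K * t)) * (B₀ + B * t) := by gcongr
      _ = Real.exp (-(2 * K * t)) * B₀ + Real.exp (-(2 * K * t)) * (2 * K * t) * (B / (2 * K)) := by
          field_simp
      _ ≤ 1 * B₀ + 1 * (B / (2 * K)) := by gcongr
      _ = _ := by ring
  have hcont : ∀ b, Continuous fun q : ℝ × ℝ => Real.exp (-(2 * K * Real.exp q.1)) *
      mildMap u₀ (fun s y => N (ext b s y)) (Real.exp q.1) q.2 := by
    intro b
    have h1 := continuousOn_mildMap hu₀.aestronglyMeasurable (ae_of_all _ hB₀) (src b)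
    have h2 : Continuous fun q : ℝ × ℝ =>
        Function.uncurry (mildMap u₀ (fun s y => N (ext b s y))) (Real.exp q.1, q.2) :=
      h1.comp_continuous (by fun_prop) fun q => ⟨Real.exp_pos _, mem_univ _⟩
    have h3 : Continuous fun q : ℝ × ℝ => Real.exp (-(2 * K * Real.exp q.1)) := by fun_prop
    exact h3.mul h2
  let Ψ : BoundedContinuousFunction (ℝ × ℝ) ℝ → BoundedContinuousFunction (ℝ × ℝ) ℝ := fun b =>
    BoundedContinuousFunction.ofNormedAddCommGroup _ (hcont b) (B₀ + B / (2 * K))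
      fun q => hbd b _ _ (Real.exp_pos _)
  have hΨ : ContractingWith (1 / 2) Ψ := by
    refine ⟨by norm_num, LipschitzWith.of_dist_le_mul fun b c => ?_⟩
    rw [BoundedContinuousFunction.dist_le (by positivity)]
    rintro ⟨σ, x⟩
    set t := Real.exp σ with ht
    have ht0 : 0 < t := Real.exp_pos _
    have e : Ψ b (σ, x) - Ψ c (σ, x) = Real.exp (-(2 * K * t)) *
        duhamel (fun s y => N (ext b s y) - N (ext c s y)) t x := by
      rw [← (src b t).duhamel_sub (src c t) ht0.le]
      simp only [Ψ, BoundedContinuousFunction.coe_ofNormedAddCommGroup, mildMap, ← ht]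
      ring
    rw [Real.dist_eq, e, abs_mul, abs_of_pos (Real.exp_pos _)]
    have h1 : |duhamel (fun s y => N (ext b s y) - N (ext c s y)) t x| ≤
        ∫ s in (0 : ℝ)..t, K * (Real.exp (2 * K * s) * dist b c) := by
      refine abs_duhamel_le ht0.le (fun s hs => ae_of_all _ fun y => ?_)
        (Continuous.intervalIntegrable (by fun_prop) _ _)
      refine (hN _ _).trans ?_
      gcongr
      simp only [ext, if_pos hs.1]
      rw [← mul_sub, abs_mul, abs_of_pos (Real.exp_pos _)]
      gcongr
      exact BoundedContinuousFunction.dist_coe_le_dist (f := b) (g := c) _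
    have h2 : ∫ s in (0 : ℝ)..t, K * (Real.exp (2 * K * s) * dist b c) =
        (Real.exp (2 * K * t) - 1) / 2 * dist b c := by
      have : ∀ s ∈ uIcc 0 t, HasDerivAt (fun s => Real.exp (2 * K * s) / 2 * dist b c)
          (K * (Real.exp (2 * K * s) * dist b c)) s := by
        intro s _
        have := ((((hasDerivAt_id s).const_mul (2 * K)).exp).div_const 2).mul_const (dist b c)
        refine this.congr_deriv ?_
        simp; ring
      rw [intervalIntegral.integral_eq_sub_of_hasDerivAt this
        (Continuous.intervalIntegrable (by fun_prop) _ _)]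
      simp; ring
    rw [h2] at h1
    have h3 : Real.exp (-(2 * K * t)) * Real.exp (2 * K * t) = 1 := by
      rw [← Real.exp_add]; simp
    have h4 : 0 ≤ dist b c := dist_nonneg
    calc _ ≤ Real.exp (-(2 * K * t)) * ((Real.exp (2 * K * t) - 1) / 2 * dist b c) := by gcongr
      _ = (1 - Real.exp (-(2 * K * t))) / 2 * dist b c := by linear_combination (dist b c / 2) * h3
      _ ≤ _ := by
        push_cast
        gcongr
        linarith [Real.exp_pos (-(2 * K * t))]
  obtain ⟨b, hb⟩ : ∃ b, Ψ b = b := ⟨_, hΨ.fixedPoint_isFixedPt⟩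
  refine ⟨ext b, ext_meas b, ?_, fun t ht x => ?_⟩
  · ext y; simp [ext]
  · have h1 : b (Real.log t, x) = Real.exp (-(2 * K * t)) *
        mildMap u₀ (fun s y => N (ext b s y)) t x := by
      conv_lhs => rw [← hb]
      simp only [Ψ, BoundedContinuousFunction.coe_ofNormedAddCommGroup, Real.exp_log ht]
    have h2 : Real.exp (2 * K * t) * Real.exp (-(2 * K * t)) = 1 := by
      rw [← Real.exp_add]; simp
    simp only [ext, if_pos ht]
    rw [h1, ← mul_assoc, h2, one_mul]

namespace IsMildFlow

variable {u : ℝ → ℝ → ℝ}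

theorem isSource (h : IsMildFlow N u₀ u) (hNc : Continuous N) (hB : ∀ a, |N a| ≤ B) (S : ℝ) :
    IsSource (fun s y => N (u s y)) S B :=
  IsSource.of_measurable (g := fun s y => N (u s y)) (hNc.measurable.comp h.meas)
    (fun _ _ => hB _) S

theorem eq_mildMap (h : IsMildFlow N u₀ u) {t : ℝ} (ht : 0 < t) :
    u t = mildMap u₀ (fun s y => N (u s y)) t := funext (h.eq t ht)

theorem tendstoUniformly (h : IsMildFlow N u₀ u) (hNc : Continuous N) (hB : ∀ a, |N a| ≤ B)
    (hu₀ : Measurable u₀) (hB₀ : ∀ y, |u₀ y| ≤ B₀) {t : ℝ} (ht : 0 < t) :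
    TendstoUniformly u (u t) (𝓝 t) := by
  have := tendstoUniformly_mildMap hu₀.aestronglyMeasurable (ae_of_all _ hB₀)
    (h.isSource hNc hB (t + 1)) ht (by linarith)
  rw [h.eq_mildMap ht]
  rw [Metric.tendstoUniformly_iff] at this ⊢
  intro ε hε
  filter_upwards [this ε hε, lt_mem_nhds ht] with s h1 hs x
  rw [h.eq_mildMap hs]
  exact h1 x

theorem continuousOn (h : IsMildFlow N u₀ u) (hNc : Continuous N) (hB : ∀ a, |N a| ≤ B)
    (hu₀ : Measurable u₀) (hB₀ : ∀ y, |u₀ y| ≤ B₀) :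
    ContinuousOn (Function.uncurry u) (Ioi 0 ×ˢ univ) :=
  (continuousOn_mildMap hu₀.aestronglyMeasurable (ae_of_all _ hB₀)
    (h.isSource hNc hB)).congr fun q hq => h.eq q.1 hq.1 q.2

theorem continuous (h : IsMildFlow N u₀ u) (hNc : Continuous N) (hB : ∀ a, |N a| ≤ B)
    (hu₀ : Measurable u₀) (hB₀ : ∀ y, |u₀ y| ≤ B₀) {t : ℝ} (ht : 0 < t) : Continuous (u t) := by
  rw [h.eq_mildMap ht]
  exact continuous_mildMap hu₀.aestronglyMeasurable (ae_of_all _ hB₀)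
    (h.isSource hNc hB t) ht le_rfl

/-- Uniqueness: any measurable solution on `(0, S)` agrees with the global one, by iterating
Duhamel's formula. -/
theorem ae_eq_of_duhamel (h : IsMildFlow N u₀ u) (hK : 0 < K)
    (hN : ∀ a b, |N a - N b| ≤ K * |a - b|) (hB : ∀ a, |N a| ≤ B)
    {v : ℝ → ℝ → ℝ} {S : ℝ} (hv : IsSource (fun s y => N (v s y)) S B)
    (heq : ∀ t ∈ Ioo 0 S, v t =ᵐ[volume] mildMap u₀ (fun s y => N (v s y)) t) :
    ∀ t ∈ Ioo 0 S, v t =ᵐ[volume] u t := by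
  have hNc : Continuous N :=
    (LipschitzWith.of_dist_le_mul (K := ⟨K, hK.le⟩) fun a b => hN a b).continuous
  have hu := h.isSource hNc hB
  have hdiff : ∀ t ∈ Ioo 0 S, ∀ᵐ x, v t x - u t x =
      duhamel (fun s y => N (v s y) - N (u s y)) t x := by
    intro t ht
    filter_upwards [heq t ht] with x hx
    rw [hx, h.eq t ht.1, mildMap, mildMap, ← (hv.mono ht.2.le).duhamel_sub (hu t) ht.1.le]
    ring
  -- the bounds need not be measurable in time, so Gronwall's inequality is replaced by iteration
  have hind : ∀ n : ℕ, ∀ t ∈ Ioo 0 S, ∀ᵐ x,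
      |v t x - u t x| ≤ 2 * B * K ^ n * (t ^ (n + 1) / (n + 1).factorial) := by
    intro n
    induction n with
    | zero =>
      intro t ht
      filter_upwards [heq t ht] with x hx
      rw [hx, h.eq t ht.1, mildMap, mildMap, add_sub_add_left_eq_sub]
      have h1 := hv.abs_duhamel_le ht.1.le ht.2.le x
      have h2 := (hu t).abs_duhamel_le ht.1.le le_rfl x
      have := abs_sub (duhamel (fun s y => N (v s y)) t x) (duhamel (fun s y => N (u s y)) t x)
      simp
      linarith
    | succ n ih =>
      intro t ht
      filter_upwards [hdiff t ht] with x hx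
      rw [hx]
      refine (abs_duhamel_le (b := fun s => K * (2 * B * K ^ n *
        (s ^ (n + 1) / (n + 1).factorial))) ht.1.le (fun s hs => ?_)
        (Continuous.intervalIntegrable (by fun_prop) _ _)).trans (le_of_eq ?_)
      · filter_upwards [ih s ⟨hs.1, hs.2.trans ht.2⟩] with y hy
        exact (hN _ _).trans (by gcongr)
      · simp only [intervalIntegral.integral_const_mul, intervalIntegral.integral_div, integral_pow]
        rw [Nat.factorial_succ (n + 1)]
        push_cast
        field_simp
        simp
        ring
  intro t ht
  have hall := ae_all_iff.2 fun n => hind n t ht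
  filter_upwards [hall] with x hx
  have hlim : Tendsto (fun n : ℕ => 2 * B * K ^ n * (t ^ (n + 1) / (n + 1).factorial)) atTop
      (𝓝 0) := by
    have h1 :=
      (FloorSemiring.tendsto_pow_div_factorial_atTop (K * t)).comp (tendsto_add_atTop_nat 1)
    have h2 := h1.const_mul (2 * B / K)
    rw [mul_zero] at h2
    refine h2.congr fun n => ?_
    simp only [Function.comp]
    field_simp
    ring
  have := ge_of_tendsto' hlim hx
  linarith [abs_nonpos_iff.1 this]

/-- Duhamel's formula tested against Hermite functions in the Gaussian variable centred at `x₀` with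
backward time `T - t`. -/
theorem integral_mul_hermiteFun (h : IsMildFlow N u₀ u) (hNc : Continuous N)
    (hB : ∀ a, |N a| ≤ B) (hu₀ : Measurable u₀) (hB₀ : ∀ y, |u₀ y| ≤ B₀) {t T : ℝ} (ht : 0 < t)
    (htT : t < T) (x₀ : ℝ) (n : ℕ) :
    ∫ z, u t (x₀ + Real.sqrt (2 * (T - t)) * z) * hermiteFun n z ∂gauss =
      Real.sqrt ((T - t) / T) ^ n *
        (∫ z, u₀ (x₀ + Real.sqrt (2 * T) * z) * hermiteFun n z ∂gauss) +
      ∫ r in (0 : ℝ)..t, Real.sqrt ((T - t) / (T - r)) ^ n *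
        ∫ z, N (u r (x₀ + Real.sqrt (2 * (T - r)) * z)) * hermiteFun n z ∂gauss := by
  set c := Real.sqrt (2 * (T - t)) with hc
  have hb : 0 < T - t := sub_pos.2 htT
  have hs := h.isSource hNc hB t
  have hgm : Measurable (Function.uncurry fun s y => N (u s y)) := hNc.measurable.comp h.meas
  have hHi : Integrable (hermiteFun n) gauss := (memLp_hermiteFun n).integrable (by norm_num)
  have hH : Measurable (hermiteFun n) := by
    unfold hermiteFun
    exact (hermitePoly n).continuous.measurable.div_const _
  have h1 : Integrable (fun z => heatFlow t u₀ (x₀ + c * z) * hermiteFun n z) gauss := by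
    refine integrable_bdd_mul_hermiteFun (B := B₀) ?_ (fun z => ?_) n
    · exact ((continuous_heatFlow ht hu₀.aestronglyMeasurable (ae_of_all _ hB₀)).comp
        (by fun_prop)).measurable
    · exact abs_heatFlow_le ht _ (ae_of_all _ hB₀)
  have h2 : Integrable (fun z => duhamel (fun s y => N (u s y)) t (x₀ + c * z) *
      hermiteFun n z) gauss := by
    refine integrable_bdd_mul_hermiteFun (B := B * t) ?_ (fun z => ?_) n
    · exact ((hs.continuous_duhamel ht le_rfl).comp (by fun_prop)).measurable
    · exact hs.abs_duhamel_le ht.le le_rfl _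
  have h3 : Integrable (Function.uncurry fun (z r : ℝ) =>
      heatFlow (t - r) (fun y => N (u r y)) (x₀ + c * z) * hermiteFun n z)
      (gauss.prod (volume.restrict (Ioo 0 t))) := by
    have hHi' : Integrable (fun q : ℝ × ℝ => hermiteFun n q.1)
      (gauss.prod (volume.restrict (Ioo 0 t))) := hHi.comp_fst _
    refine hHi'.bdd_mul (c := B) (f := fun q : ℝ × ℝ =>
      heatFlow (t - q.2) (fun y => N (u q.2 y)) (x₀ + c * q.1)) ?_ ?_
    · have : StronglyMeasurable (fun w : (ℝ × ℝ) × ℝ =>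
          heatKernel (t - w.1.2) (x₀ + c * w.1.1 - w.2) * N (u w.1.2 w.2)) := by
        refine Measurable.stronglyMeasurable (Measurable.mul ?_ ?_)
        · exact measurable_uncurry_heatKernel.comp (f := fun w : (ℝ × ℝ) × ℝ =>
            (t - w.1.2, x₀ + c * w.1.1 - w.2)) (by fun_prop)
        · exact hgm.comp (f := fun w : (ℝ × ℝ) × ℝ => (w.1.2, w.2)) (by fun_prop)
      exact (this.integral_prod_right' (ν := volume)).aestronglyMeasurable
    · have : ∀ᵐ q : ℝ × ℝ ∂(gauss.prod (volume.restrict (Ioo 0 t))), q.2 ∈ Ioo 0 t :=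
        Measure.quasiMeasurePreserving_snd.ae (ae_restrict_mem measurableSet_Ioo)
      filter_upwards [this] with q hq
      exact abs_heatFlow_le (sub_pos.2 hq.2) _ (ae_of_all _ fun y => hB _)
  have e1 : ∫ z, heatFlow t u₀ (x₀ + c * z) * hermiteFun n z ∂gauss =
      Real.sqrt ((T - t) / T) ^ n *
        (∫ z, u₀ (x₀ + Real.sqrt (2 * T) * z) * hermiteFun n z ∂gauss) := by
    rw [hc, integral_heatFlow_mul_hermiteFun ht hb hu₀ hB₀]
    simp
  have e2 : ∫ z, duhamel (fun s y => N (u s y)) t (x₀ + c * z) * hermiteFun n z ∂gauss =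
      ∫ r in (0 : ℝ)..t, Real.sqrt ((T - t) / (T - r)) ^ n *
        ∫ z, N (u r (x₀ + Real.sqrt (2 * (T - r)) * z)) * hermiteFun n z ∂gauss := by
    rw [intervalIntegral.integral_of_le ht.le, integral_Ioc_eq_integral_Ioo]
    simp_rw [duhamel_eq_Ioo ht.le, ← integral_mul_const]
    rw [integral_integral_swap h3]
    refine setIntegral_congr_fun measurableSet_Ioo fun r hr => ?_
    have hm : Measurable fun y => N (u r y) := hgm.comp (measurable_const.prodMk measurable_id)
    have := integral_heatFlow_mul_hermiteFun (sub_pos.2 hr.2) hb hm (fun y => hB _) x₀ n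
    rw [show t - r + (T - t) = T - r by ring] at this
    rw [hc, this]
  rw [← e1, ← e2, ← integral_add h1 h2]
  congr 1; ext z
  rw [h.eq t ht, mildMap]
  ring

/-- Restarting Duhamel's formula at a positive time. -/
theorem abs_le_of_restart (h : IsMildFlow N u₀ u) (hNc : Continuous N)
    (hB : ∀ a, |N a| ≤ B) (hu₀ : Measurable u₀) (hB₀ : ∀ y, |u₀ y| ≤ B₀) {t T : ℝ} (ht : 0 < t)
    (htT : t < T) {A C : ℝ} (hA : ∀ y, |u t y| ≤ A)
    (hC : ∀ s ∈ Ioo t T, ∀ y, |N (u s y)| ≤ C) (x : ℝ) : |u T x| ≤ A + C * (T - t) := by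
  have hT := ht.trans htT
  have hs := h.isSource hNc hB T
  have key := h.integral_mul_hermiteFun hNc hB hu₀ hB₀ ht htT x 0
  simp only [pow_zero, one_mul, hermiteFun, hermitePoly_zero, Polynomial.eval_one,
    Nat.factorial_zero, Nat.cast_one, Real.sqrt_one, div_one, mul_one] at key
  rw [← heatFlow_eq_integral_gauss (sub_pos.2 htT), ← heatFlow_eq_integral_gauss hT,
    intervalIntegral.integral_of_le ht.le, integral_Ioc_eq_integral_Ioo] at key
  have e0 : ∫ r in Ioo 0 t, ∫ z, N (u r (x + Real.sqrt (2 * (T - r)) * z)) ∂gauss =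
      ∫ r in Ioo 0 t, heatFlow (T - r) (fun y => N (u r y)) x := by
    refine setIntegral_congr_fun measurableSet_Ioo fun r hr => ?_
    exact (heatFlow_eq_integral_gauss (sub_pos.2 (hr.2.trans htT)) (fun y => N (u r y)) x).symm
  rw [e0] at key
  have hi := hs.integrableOn le_rfl x
  have e1 : duhamel (fun s y => N (u s y)) T x =
      (∫ s in Ioo 0 t, heatFlow (T - s) (fun y => N (u s y)) x) +
      ∫ s in Ioo t T, heatFlow (T - s) (fun y => N (u s y)) x := by
    rw [duhamel_eq_Ioo hT.le, ← Ioo_union_Ico_eq_Ioo ht htT.le,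
      setIntegral_union (Set.disjoint_left.2 fun s hs hs' => absurd hs.2 (not_lt.2 hs'.1))
        measurableSet_Ico (hi.mono_set (Ioo_subset_Ioo_right htT.le))
        (hi.mono_set fun s hs => ⟨ht.trans_le hs.1, hs.2⟩), integral_Ico_eq_integral_Ioo]
  have e2 : u T x = heatFlow (T - t) (u t) x +
      ∫ s in Ioo t T, heatFlow (T - s) (fun y => N (u s y)) x := by
    rw [h.eq T hT, mildMap, e1, key]; ring
  rw [e2]
  refine (abs_add_le _ _).trans (add_le_add (abs_heatFlow_le (sub_pos.2 htT) x (ae_of_all _ hA)) ?_)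
  refine (abs_setIntegral_heatFlow_le (b := fun _ => C) le_rfl
    (fun s hs => ae_of_all _ (hC s hs)) (by simp)).trans (le_of_eq ?_)
  simp [htT.le, mul_comm]

end IsMildFlow

end Lipschitz

/-! ### The power nonlinearity and its truncations -/

/-- The nonlinearity `|v|^{p-1} v`. -/
noncomputable def powNonlin (p v : ℝ) : ℝ := |v| ^ (p - 1) * v

/-- Truncation to `[-M, M]` (for `M ≥ 0`). -/
noncomputable def clamp (M v : ℝ) : ℝ := max (-M) (min v M)

/-- The nonlinearity `|v|^{p-1} v` frozen outside `[-M, M]`. -/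
noncomputable def truncNonlin (p M v : ℝ) : ℝ := powNonlin p (clamp M v)

theorem clamp_of_abs_le {M v : ℝ} (h : |v| ≤ M) : clamp M v = v := by
  rw [abs_le] at h
  rw [clamp, min_eq_left h.2, max_eq_right h.1]

theorem abs_clamp_le (M v : ℝ) : |clamp M v| ≤ |M| := by
  rw [clamp, abs_le]
  constructor
  · exact le_max_of_le_left (by linarith [le_abs_self M])
  · exact max_le (neg_le_abs M) ((min_le_right _ _).trans (le_abs_self M))

theorem abs_clamp_sub_le (M a b : ℝ) : |clamp M a - clamp M b| ≤ |a - b| := by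
  have h1 := abs_max_sub_max_le_max (-M) (min a M) (-M) (min b M)
  have h2 := abs_min_sub_min_le_max a M b M
  rw [sub_self, abs_zero, max_eq_right (abs_nonneg (min a M - min b M))] at h1
  rw [sub_self, abs_zero, max_eq_left (abs_nonneg (a - b))] at h2
  exact h1.trans h2

theorem continuous_clamp (M : ℝ) : Continuous (clamp M) := by unfold clamp; fun_prop

theorem truncNonlin_of_abs_le {p M v : ℝ} (h : |v| ≤ M) :
    truncNonlin p M v = |v| ^ (p - 1) * v := by
  rw [truncNonlin, clamp_of_abs_le h, powNonlin]

theorem abs_powNonlin {p : ℝ} (hp : 1 < p) (v : ℝ) : |powNonlin p v| = |v| ^ p := by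
  rw [powNonlin, abs_mul, abs_of_nonneg (by positivity : (0 : ℝ) ≤ |v| ^ (p - 1))]
  rcases eq_or_ne v 0 with rfl | hv
  · rw [abs_zero, mul_zero, Real.zero_rpow (by linarith)]
  · rw [← Real.rpow_add_one (abs_ne_zero.2 hv), sub_add_cancel]

theorem abs_truncNonlin_le {p : ℝ} (hp : 1 < p) (M v : ℝ) : |truncNonlin p M v| ≤ |M| ^ p := by
  rw [truncNonlin, abs_powNonlin hp]
  exact Real.rpow_le_rpow (abs_nonneg _) (abs_clamp_le M v) (by linarith)

theorem powNonlin_eq {p : ℝ} (hp : 1 < p) (v : ℝ) :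
    powNonlin p v = max v 0 ^ p - max (-v) 0 ^ p := by
  have h0 : (0 : ℝ) ^ p = 0 := Real.zero_rpow (by linarith)
  rcases lt_trichotomy v 0 with hv | rfl | hv
  · rw [powNonlin, max_eq_right hv.le, max_eq_left (by linarith), abs_of_neg hv, h0]
    have : (-v) ^ p = (-v) ^ (p - 1) * (-v) := by
      rw [← Real.rpow_add_one (by linarith), sub_add_cancel]
    rw [this]; ring
  · simp [powNonlin]
  · rw [powNonlin, max_eq_left hv.le, max_eq_right (by linarith), abs_of_pos hv, h0, sub_zero,
      ← Real.rpow_add_one hv.ne', sub_add_cancel]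

theorem exists_lipschitz_powNonlin {p : ℝ} (hp : 1 < p) (M : ℝ) :
    ∃ K, 0 < K ∧ ∀ a b, |a| ≤ M → |b| ≤ M → |powNonlin p a - powNonlin p b| ≤ K * |a - b| := by
  rcases lt_or_ge M 0 with hM | hM
  · exact ⟨1, one_pos, fun a _ ha => absurd ((abs_nonneg a).trans ha) (not_le.2 hM)⟩
  have hrpow : ∀ a ∈ Icc 0 M, ∀ b ∈ Icc 0 M, |a ^ p - b ^ p| ≤ p * M ^ (p - 1) * |a - b| := by
    intro a ha b hb
    refine (convex_Icc 0 M).norm_image_sub_le_of_norm_hasDerivWithin_le (f := fun x => x ^ p)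
      (f' := fun x => p * x ^ (p - 1))
      (fun x _ => (Real.hasDerivAt_rpow_const (Or.inr hp.le)).hasDerivWithinAt)
      (fun x hx => ?_) hb ha
    have : 0 ≤ x ^ (p - 1) := Real.rpow_nonneg hx.1 _
    rw [Real.norm_of_nonneg (by positivity)]
    have := Real.rpow_le_rpow hx.1 hx.2 (by linarith : 0 ≤ p - 1)
    gcongr
  have hK : 0 ≤ p * M ^ (p - 1) := by positivity
  refine ⟨2 * (p * M ^ (p - 1)) + 1, by linarith, fun a b ha hb => ?_⟩
  rw [powNonlin_eq hp, powNonlin_eq hp]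
  rw [abs_le] at ha hb
  have h1 := hrpow (max a 0) ⟨le_max_right _ _, max_le ha.2 hM⟩ (max b 0)
    ⟨le_max_right _ _, max_le hb.2 hM⟩
  have h2 := hrpow (max (-a) 0) ⟨le_max_right _ _, max_le (by linarith) hM⟩ (max (-b) 0)
    ⟨le_max_right _ _, max_le (by linarith) hM⟩
  have h3 := abs_max_sub_max_le_abs a b 0
  have h4 := abs_max_sub_max_le_abs (-a) (-b) 0
  rw [neg_sub_neg, abs_sub_comm b a] at h4
  have h5 := h1.trans (mul_le_mul_of_nonneg_left h3 hK)
  have h6 := h2.trans (mul_le_mul_of_nonneg_left h4 hK)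
  have h7 : max a 0 ^ p - max (-a) 0 ^ p - (max b 0 ^ p - max (-b) 0 ^ p) =
      (max a 0 ^ p - max b 0 ^ p) - (max (-a) 0 ^ p - max (-b) 0 ^ p) := by ring
  rw [h7]
  have := abs_sub (max a 0 ^ p - max b 0 ^ p) (max (-a) 0 ^ p - max (-b) 0 ^ p)
  have := abs_nonneg (a - b)
  linarith

theorem exists_lipschitz_truncNonlin {p : ℝ} (hp : 1 < p) (M : ℝ) :
    ∃ K, 0 < K ∧ ∀ a b, |truncNonlin p M a - truncNonlin p M b| ≤ K * |a - b| := by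
  obtain ⟨K, hK, h⟩ := exists_lipschitz_powNonlin hp |M|
  refine ⟨K, hK, fun a b => (h _ _ (abs_clamp_le M a) (abs_clamp_le M b)).trans ?_⟩
  exact mul_le_mul_of_nonneg_left (abs_clamp_sub_le M a b) hK.le

theorem continuous_powNonlin {p : ℝ} (hp : 1 < p) : Continuous (powNonlin p) := by
  have : Continuous fun v : ℝ => |v| ^ (p - 1) :=
    continuous_abs.rpow_const fun _ => Or.inr (by linarith)
  exact this.mul continuous_id

theorem continuous_truncNonlin {p : ℝ} (hp : 1 < p) (M : ℝ) : Continuous (truncNonlin p M) :=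
  (continuous_powNonlin hp).comp (continuous_clamp M)

/-- Convexity of the potential `|v|^{p+1} / (p+1)`, which is Young's inequality. -/
theorem powNonlin_mul_sub_le {p : ℝ} (hp : 1 < p) (a b : ℝ) :
    powNonlin p a * (b - a) ≤ |b| ^ (p + 1) / (p + 1) - |a| ^ (p + 1) / (p + 1) := by
  have hpq : Real.HolderConjugate ((p + 1) / p) (p + 1) := by
    rw [Real.holderConjugate_iff]
    constructor
    · rw [lt_div_iff₀ (by linarith)]; linarith
    · field_simp
  have hy := Real.young_inequality_of_nonneg (a := |a| ^ p) (b := |b|) (by positivity)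
    (abs_nonneg b) hpq
  rw [← Real.rpow_mul (abs_nonneg a), mul_div_cancel₀ _ (by linarith : p ≠ 0)] at hy
  have h1 : powNonlin p a * b ≤ |a| ^ p * |b| := by
    rw [← abs_powNonlin hp, ← abs_mul]; exact le_abs_self _
  have h2 : powNonlin p a * a = |a| ^ (p + 1) := by
    rw [powNonlin, mul_assoc, ← abs_mul_abs_self, ← sq, ← Real.rpow_natCast, ← Real.rpow_add']
    · congr 1; push_cast; ring
    · exact abs_nonneg a
    · push_cast; linarith
  rw [mul_sub, h2]
  have h3 : |a| ^ (p + 1) / ((p + 1) / p) = |a| ^ (p + 1) - |a| ^ (p + 1) / (p + 1) := by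
    field_simp; ring
  linarith

theorem powNonlin_mul_self {p : ℝ} (hp : 1 < p) (a : ℝ) :
    powNonlin p a * a = |a| ^ (p + 1) := by
  rw [powNonlin, mul_assoc, ← abs_mul_abs_self, ← sq, ← Real.rpow_natCast, ← Real.rpow_add']
  · congr 1; push_cast; ring
  · exact abs_nonneg a
  · push_cast; linarith

/-! ### Maximal solutions and the blow-up alternative -/

theorem IsNLHSolution.congr_initial {p τ : ℝ} {u₀ v₀ : ℝ → ℝ} {u : ℝ → ℝ → ℝ}
    (h : IsNLHSolution p u₀ τ u) (huv : u₀ =ᵐ[volume] v₀) : IsNLHSolution p v₀ τ u where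
  pos := h.pos
  aemeas := h.aemeas
  memLp := h.memLp
  bounded := h.bounded
  cont := h.cont
  initial := h.initial.trans huv
  duhamel t ht := by
    have := h.duhamel t ht
    simpa only [heatFlow_congr_ae huv t] using this

theorem abs_le_of_continuous_of_ae {f : ℝ → ℝ} (hf : Continuous f) {M : ℝ} (hM : 0 ≤ M)
    (h : ∀ᵐ x, |f x| ≤ M) (x : ℝ) : |f x| ≤ M := by
  have h1 : (fun x => clamp M (f x)) = f := by
    refine (Continuous.ae_eq_iff_eq volume ((continuous_clamp M).comp hf) hf).1 ?_
    filter_upwards [h] with x hx using clamp_of_abs_le hx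
  rw [← congrFun h1 x, ← abs_of_nonneg hM]
  simpa using abs_clamp_le |M| (f x)

theorem ae_abs_le_of_eLpNorm_le {f : ℝ → ℝ} {M : ℝ} (h : eLpNorm f ∞ volume ≤ ENNReal.ofReal M) :
    ∀ᵐ x, |f x| ≤ max M 0 := by
  rw [eLpNorm_exponent_top] at h
  filter_upwards [ae_le_eLpNormEssSup (f := f) (μ := volume)] with x hx
  have h1 := hx.trans h
  rw [← ofReal_norm] at h1
  exact (ENNReal.ofReal_le_ofReal_iff (le_max_right _ _)).1
    (h1.trans (ENNReal.ofReal_le_ofReal (le_max_left _ _)))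

/-- `u₀` is a measurable function bounded by `B₀`, and `U M` is the mild flow from `u₀` with the
nonlinearity truncated at level `M`. -/
structure IsTruncatedFamily (p : ℝ) (u₀ : ℝ → ℝ) (B₀ : ℝ) (U : ℝ → ℝ → ℝ → ℝ) : Prop where
  one_lt : 1 < p
  meas : Measurable u₀
  bound : ∀ y, |u₀ y| ≤ B₀
  flow : ∀ M, IsMildFlow (truncNonlin p M) u₀ (U M)

theorem exists_isTruncatedFamily {p : ℝ} (hp : 1 < p) {u₀ : ℝ → ℝ} (hu₀ : Measurable u₀) {B₀ : ℝ}
    (hB₀ : ∀ y, |u₀ y| ≤ B₀) : ∃ U, IsTruncatedFamily p u₀ B₀ U := by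
  have : ∀ M, ∃ u, IsMildFlow (truncNonlin p M) u₀ u := fun M => by
    obtain ⟨K, hK, hLip⟩ := exists_lipschitz_truncNonlin hp M
    exact exists_isMildFlow hK hLip (abs_truncNonlin_le hp M) hu₀ hB₀
  choose U hU using this
  exact ⟨U, hp, hu₀, hB₀, hU⟩

/-- On `(0, t]` the flow with truncation level `M` does not see the truncation. -/
def IsBelow (U : ℝ → ℝ → ℝ → ℝ) (M t : ℝ) : Prop :=
  ∀ s ∈ Ioc 0 t, ∀ x, |U M s x| ≤ M

namespace IsBelow

variable {U : ℝ → ℝ → ℝ → ℝ}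

theorem mono {M s t : ℝ} (h : IsBelow U M t) (hs : s ≤ t) : IsBelow U M s :=
  fun r hr => h r ⟨hr.1, hr.2.trans hs⟩

end IsBelow

namespace IsTruncatedFamily

variable {p : ℝ} {u₀ : ℝ → ℝ} {B₀ : ℝ} {U : ℝ → ℝ → ℝ → ℝ}

theorem tendstoUniformly (h : IsTruncatedFamily p u₀ B₀ U) (M : ℝ) {t : ℝ} (ht : 0 < t) :
    TendstoUniformly (U M) (U M t) (𝓝 t) :=
  (h.flow M).tendstoUniformly (continuous_truncNonlin h.one_lt M) (abs_truncNonlin_le h.one_lt M)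
    h.meas h.bound ht

theorem continuousOn (h : IsTruncatedFamily p u₀ B₀ U) (M : ℝ) :
    ContinuousOn (Function.uncurry (U M)) (Ioi 0 ×ˢ univ) :=
  (h.flow M).continuousOn (continuous_truncNonlin h.one_lt M) (abs_truncNonlin_le h.one_lt M)
    h.meas h.bound

theorem continuous (h : IsTruncatedFamily p u₀ B₀ U) (M : ℝ) {t : ℝ} (ht : 0 < t) :
    Continuous (U M t) :=
  (h.flow M).continuous (continuous_truncNonlin h.one_lt M) (abs_truncNonlin_le h.one_lt M)
    h.meas h.bound ht

/-- A measurable solution of Duhamel's formula on `(0, S)` with values in `[-M, M]` agrees with the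
flow of truncation level `M`. -/
theorem ae_eq (h : IsTruncatedFamily p u₀ B₀ U) {v : ℝ → ℝ → ℝ} {S M : ℝ}
    (hv : AEStronglyMeasurable (Function.uncurry v) ((volume.restrict (Ioo 0 S)).prod volume))
    (hvs : ∀ t ∈ Ioo 0 S, AEStronglyMeasurable (v t) volume)
    (hM : ∀ t ∈ Ioo 0 S, ∀ᵐ x, |v t x| ≤ M)
    (heq : ∀ t ∈ Ioo 0 S, v t =ᵐ[volume] mildMap u₀ (fun s y => powNonlin p (v s y)) t) :
    ∀ t ∈ Ioo 0 S, v t =ᵐ[volume] U M t := by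
  have hp := h.one_lt
  obtain ⟨K, hK, hLip⟩ := exists_lipschitz_truncNonlin hp M
  refine (h.flow M).ae_eq_of_duhamel hK hLip (abs_truncNonlin_le hp M) ?_ fun t ht => ?_
  · exact ⟨(continuous_truncNonlin hp M).comp_aestronglyMeasurable hv, fun s hs =>
      (continuous_truncNonlin hp M).comp_aestronglyMeasurable (hvs s hs),
      fun s _ y => abs_truncNonlin_le hp M _⟩
  · filter_upwards [heq t ht] with x hx
    rw [hx]
    refine mildMap_congr ht.1.le (fun s hs => ?_) x
    filter_upwards [hM s ⟨hs.1, hs.2.trans ht.2⟩] with y hy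
    rw [truncNonlin_of_abs_le hy, powNonlin]

theorem eq_mildMap (h : IsTruncatedFamily p u₀ B₀ U) {M t : ℝ} (hM : IsBelow U M t)
    (ht : 0 < t) : U M t = mildMap u₀ (fun s y => powNonlin p (U M s y)) t := by
  rw [(h.flow M).eq_mildMap ht]
  ext x
  refine mildMap_congr ht.le (fun s hs => ae_of_all _ fun y => ?_) x
  rw [truncNonlin_of_abs_le (hM s ⟨hs.1, hs.2.le⟩ y), powNonlin]

/-- Flows of different truncation levels agree as long as neither sees its truncation. -/
theorem eq_of_abs_le (h : IsTruncatedFamily p u₀ B₀ U) {M M' t : ℝ} (hM : IsBelow U M t)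
    (hM' : ∀ s ∈ Ioc 0 t, ∀ x, |U M s x| ≤ M') : ∀ s ∈ Ioc 0 t, U M s = U M' s := by
  have hmeas : Measurable (Function.uncurry (U M)) := (h.flow M).meas
  have h1 : ∀ s ∈ Ioo 0 t, U M s =ᵐ[volume] U M' s := by
    refine h.ae_eq hmeas.aestronglyMeasurable
      (fun s hs => (h.continuous M hs.1).aestronglyMeasurable)
      (fun s hs => ae_of_all _ (hM' s ⟨hs.1, hs.2.le⟩)) fun s hs => ?_
    rw [← h.eq_mildMap (hM.mono hs.2.le) hs.1]
  intro s hs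
  rw [h.eq_mildMap (hM.mono hs.2) hs.1, (h.flow M').eq_mildMap hs.1]
  ext x
  refine mildMap_congr hs.1.le (fun r hr => ?_) x
  have hr' : r ∈ Ioo 0 t := ⟨hr.1, hr.2.trans_le hs.2⟩
  filter_upwards [h1 r hr'] with y hy
  have h2 := hM' r ⟨hr'.1, hr'.2.le⟩ y
  rw [← hy, truncNonlin_of_abs_le h2, powNonlin]

theorem eq_of_le (h : IsTruncatedFamily p u₀ B₀ U) {M M' t : ℝ} (hM : IsBelow U M t)
    (hMM : M ≤ M') : ∀ s ∈ Ioc 0 t, U M s = U M' s :=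
  h.eq_of_abs_le hM fun s hs x => (hM s hs x).trans hMM

theorem eq_of_isBelow (h : IsTruncatedFamily p u₀ B₀ U) {M M' t : ℝ} (hM : IsBelow U M t)
    (hM' : IsBelow U M' t) (ht : 0 < t) : U M t = U M' t := by
  rw [h.eq_of_le hM (le_max_left M M') t ⟨ht, le_rfl⟩,
    h.eq_of_le hM' (le_max_right M M') t ⟨ht, le_rfl⟩]

/-- The truncated flow starts below its truncation level, so a solution exists for a short time. -/
theorem exists_isBelow_small (h : IsTruncatedFamily p u₀ B₀ U) :
    ∃ t > 0, IsBelow U (B₀ + 1) t := by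
  have hB : 0 ≤ B₀ := (abs_nonneg _).trans (h.bound 0)
  set C := |B₀ + 1| ^ p with hC
  have hC0 : 0 ≤ C := by positivity
  refine ⟨1 / (C + 1), by positivity, fun s hs x => ?_⟩
  rw [(h.flow _).eq_mildMap hs.1]
  refine (abs_mildMap_le (ae_of_all _ h.bound) ((h.flow _).isSource
    (continuous_truncNonlin h.one_lt _) (abs_truncNonlin_le h.one_lt _) s) hs.1 le_rfl x).trans ?_
  have h1 := hs.2
  rw [le_div_iff₀ (by positivity)] at h1
  have := hs.1
  linarith

/-- Existence up to and including time `t` extends beyond `t`. -/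
theorem exists_isBelow_add (h : IsTruncatedFamily p u₀ B₀ U) {M t : ℝ} (hM : IsBelow U M t)
    (ht : 0 < t) : ∃ ε > 0, IsBelow U (M + 1) (t + ε) := by
  have h1 := Metric.tendstoUniformly_iff.1 (h.tendstoUniformly (M + 1) ht) 1 one_pos
  obtain ⟨ε, hε, h2⟩ := Metric.eventually_nhds_iff.1 h1
  refine ⟨ε / 2, by positivity, fun s hs x => ?_⟩
  have h3 := h.eq_of_le hM (by linarith : M ≤ M + 1)
  rcases le_or_gt s t with hst | hst
  · rw [← h3 s ⟨hs.1, hst⟩]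
    linarith [hM s ⟨hs.1, hst⟩ x]
  · have h4 := h2 (y := s) (by rw [Real.dist_eq, abs_of_pos (by linarith)]; linarith [hs.2]) x
    rw [← h3 t ⟨ht, le_rfl⟩, Real.dist_eq] at h4
    have h5 := hM t ⟨ht, le_rfl⟩ x
    have h6 := abs_sub_abs_le_abs_sub (U (M + 1) s x) (U M t x)
    rw [abs_sub_comm] at h6
    linarith

/-- Every solution agrees with a flow that does not see its truncation. -/
theorem exists_isBelow_of_solution (h : IsTruncatedFamily p u₀ B₀ U) {τ : ℝ} {v : ℝ → ℝ → ℝ}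
    (hv : IsNLHSolution p u₀ τ v) {t : ℝ} (ht : t ∈ Ioo 0 τ) :
    ∃ M, IsBelow U M t ∧ v t =ᵐ[volume] U M t := by
  obtain ⟨S, hS1, hS2⟩ := exists_between ht.2
  obtain ⟨M, hM⟩ := hv.bounded S ⟨(ht.1.trans hS1).le, hS2⟩
  have hb : ∀ s ∈ Ioo 0 S, ∀ᵐ x, |v s x| ≤ max M 0 := fun s hs =>
    ae_abs_le_of_eLpNorm_le (hM s ⟨hs.1.le, hs.2.le⟩)
  have hae : ∀ s ∈ Ioo 0 S, v s =ᵐ[volume] U (max M 0) s := by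
    refine h.ae_eq ?_ (fun s hs => (hv.memLp s ⟨hs.1.le, hs.2.trans hS2⟩).1) hb
      fun s hs => hv.duhamel s ⟨hs.1, hs.2.trans hS2⟩
    have := hv.aemeas
    rw [Measure.restrict_prod_eq_prod_univ] at this ⊢
    exact this.mono_set (prod_mono (Ioo_subset_Ioo_right hS2.le) Subset.rfl)
  refine ⟨max M 0, fun s hs => ?_, hae t ⟨ht.1, hS1⟩⟩
  have hs' : s ∈ Ioo 0 S := ⟨hs.1, hs.2.trans_lt hS1⟩
  refine abs_le_of_continuous_of_ae (h.continuous _ hs.1) (le_max_right _ _) ?_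
  filter_upwards [hb s hs', hae s hs'] with x h1 h2
  rwa [← h2]

/-- Conversely, a function that agrees at all times in `(0, τ)` with the flows that do not see
their truncation is a solution. -/
theorem isNLHSolution (h : IsTruncatedFamily p u₀ B₀ U) {τ : ℝ} (hτ : 0 < τ) {u : ℝ → ℝ → ℝ}
    (hu0 : u 0 = u₀) (hu : ∀ M t, 0 < t → IsBelow U M t → u t = U M t)
    (hex : ∀ t ∈ Ioo 0 τ, ∃ M, IsBelow U M t) : IsNLHSolution p u₀ τ u := by
  have hloc : ∀ t ∈ Ioo 0 τ, ∃ M, IsBelow U M t ∧ ∀ᶠ s in 𝓝 t, u s = U M s := by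
    intro t ht
    obtain ⟨S, hS1, hS2⟩ := exists_between ht.2
    obtain ⟨M, hM⟩ := hex S ⟨ht.1.trans hS1, hS2⟩
    refine ⟨M, hM.mono hS1.le, ?_⟩
    filter_upwards [Ioo_mem_nhds ht.1 hS1] with s hs
    exact hu M s hs.1 (hM.mono hs.2.le)
  have hcont : ContinuousOn (Function.uncurry u) (Ioo 0 τ ×ˢ univ) := by
    rintro ⟨t, x⟩ ⟨ht, -⟩
    obtain ⟨M, hM, hev⟩ := hloc t ht
    have h1 : ContinuousAt (Function.uncurry (U M)) (t, x) :=
      (h.continuousOn M).continuousAt (prod_mem_nhds (Ioi_mem_nhds ht.1) univ_mem)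
    refine (h1.congr ?_).continuousWithinAt
    filter_upwards [(continuous_fst.tendsto (t, x)).eventually hev] with q hq
    exact (congrFun hq q.2).symm
  have hmem : ∀ t ∈ Ico 0 τ, MemLp (u t) ∞ volume := by
    intro t ht
    rcases ht.1.eq_or_lt with rfl | ht0
    · rw [hu0]
      exact memLp_top_of_bound h.meas.aestronglyMeasurable B₀ (ae_of_all _ h.bound)
    · obtain ⟨M, hM⟩ := hex t ⟨ht0, ht.2⟩
      rw [hu M t ht0 hM]
      exact memLp_top_of_bound (h.continuous M ht0).aestronglyMeasurable M
        (ae_of_all _ (hM t ⟨ht0, le_rfl⟩))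
  refine ⟨hτ, ?_, hmem, fun t₁ ht₁ => ?_, fun t ht => ?_, by rw [hu0], fun t ht => ?_⟩
  · rw [Measure.restrict_prod_eq_prod_univ]
    exact hcont.aestronglyMeasurable (measurableSet_Ioo.prod MeasurableSet.univ)
  · obtain ⟨S, hS1, hS2⟩ := exists_between ht₁.2
    have hS0 := ht₁.1.trans_lt hS1
    obtain ⟨M, hM⟩ := hex S ⟨hS0, hS2⟩
    refine ⟨max M B₀, fun t ht => ?_⟩
    rw [eLpNorm_exponent_top]
    refine eLpNormEssSup_le_of_ae_bound (ae_of_all _ fun x => ?_)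
    rcases ht.1.eq_or_lt with rfl | ht0
    · rw [hu0]; exact (h.bound x).trans (le_max_right _ _)
    · have hts : t ≤ S := ht.2.trans hS1.le
      rw [hu M t ht0 (hM.mono hts)]
      exact (hM t ⟨ht0, hts⟩ x).trans (le_max_left _ _)
  · obtain ⟨M, hM, hev⟩ := hloc t ht
    rw [ENNReal.tendsto_nhds_zero]
    intro ε hε
    obtain ⟨δ, hδ, hδε⟩ : ∃ δ : ℝ, 0 < δ ∧ ENNReal.ofReal δ ≤ ε := by
      obtain ⟨δ, hδ0, hδ⟩ := ENNReal.lt_iff_exists_nnreal_btwn.1 hε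
      exact ⟨δ, by exact_mod_cast hδ0, by rw [ENNReal.ofReal_coe_nnreal]; exact hδ.le⟩
    filter_upwards [Metric.tendstoUniformly_iff.1 (h.tendstoUniformly M ht.1) δ hδ, hev]
      with s hs hs'
    refine le_trans ?_ hδε
    rw [eLpNorm_exponent_top]
    refine eLpNormEssSup_le_of_ae_bound (ae_of_all _ fun x => ?_)
    rw [hs', hev.self_of_nhds, Pi.sub_apply, ← dist_eq_norm, dist_comm]
    exact (hs x).le
  · obtain ⟨M, hM⟩ := hex t ht
    rw [hu M t ht.1 hM]
    refine Eventually.of_forall fun x => ?_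
    rw [h.eq_mildMap hM ht.1]
    refine mildMap_congr (g := fun s y => powNonlin p (U M s y))
      (h := fun s y => |u s y| ^ (p - 1) * u s y) ht.1.le (fun s hs => ?_) x
    rw [hu M s hs.1 (hM.mono hs.2.le)]
    rfl

/-- If no truncated flow stays below its truncation up to time `T`, the solution blows up at some
time at most `T`, and it is maximal and unique. -/
theorem exists_blowup (h : IsTruncatedFamily p u₀ B₀ U) {T : ℝ} (hT : ∀ M, ¬ IsBelow U M T) :
    ∃ (tstar : ℝ) (u : ℝ → ℝ → ℝ), 0 < tstar ∧ tstar ≤ T ∧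
      IsNLHSolution p u₀ tstar u ∧
      Tendsto (fun t => eLpNorm (u t) ∞ volume) (𝓝[<] tstar) (𝓝 ∞) ∧
      ∀ (τ : ℝ) (v : ℝ → ℝ → ℝ), IsNLHSolution p u₀ τ v →
        τ ≤ tstar ∧ ∀ t ∈ Ico 0 τ, v t =ᵐ[volume] u t := by
  classical
  -- the times up to which a solution exists
  set A : Set ℝ := {t | 0 < t ∧ ∃ M, IsBelow U M t} with hA
  obtain ⟨t₀, ht₀, ht₀'⟩ := h.exists_isBelow_small
  have hne : A.Nonempty := ⟨t₀, ht₀, _, ht₀'⟩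
  have hAT : ∀ t ∈ A, t ≤ T := fun t ht => by
    by_contra hlt
    obtain ⟨M, hM⟩ := ht.2
    exact hT M (hM.mono (not_le.1 hlt).le)
  have hbdd : BddAbove A := ⟨T, hAT⟩
  set ts := sSup A with hts
  have hts0 : 0 < ts := ht₀.trans_le (le_csSup hbdd ⟨ht₀, _, ht₀'⟩)
  have hex : ∀ t ∈ Ioo 0 ts, ∃ M, IsBelow U M t := by
    intro t ht
    obtain ⟨s, ⟨-, M, hM⟩, hs⟩ := exists_lt_of_lt_csSup hne ht.2
    exact ⟨M, hM.mono hs.le⟩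
  have hnot : ∀ M, ¬ IsBelow U M ts := by
    intro M hM
    obtain ⟨ε, hε, hM'⟩ := h.exists_isBelow_add hM hts0
    have := le_csSup hbdd (⟨by linarith, _, hM'⟩ : ts + ε ∈ A)
    linarith
  let u : ℝ → ℝ → ℝ := fun t =>
    if hM : 0 < t ∧ ∃ M, IsBelow U M t then U hM.2.choose t else u₀
  have hu : ∀ M t, 0 < t → IsBelow U M t → u t = U M t := by
    intro M t ht hM
    have hex : 0 < t ∧ ∃ M, IsBelow U M t := ⟨ht, M, hM⟩
    simp only [u, dif_pos hex]
    exact h.eq_of_isBelow hex.2.choose_spec hM ht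
  have hu0 : u 0 = u₀ := by simp [u]
  refine ⟨ts, u, hts0, csSup_le hne hAT, h.isNLHSolution hts0 hu0 hu hex, ?_, fun τ v hv => ?_⟩
  · rw [ENNReal.tendsto_nhds_top_iff_nnreal]
    by_contra! hcon
    obtain ⟨R, hR⟩ := hcon
    have hR0 : (0 : ℝ) ≤ R := R.2
    set C := ((R : ℝ) + 1) ^ p with hC
    have hC0 : 0 ≤ C := by positivity
    -- the time in which the norm can grow from `R` to at most `R + 1/2`
    set δ := 1 / (2 * (C + 1)) with hδ
    have hδ0 : 0 < δ := by positivity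
    have hCδ : C * δ ≤ 1 / 2 := by
      rw [hδ, mul_one_div, div_le_iff₀ (by positivity)]; linarith
    have hmem : Ioo (max 0 (ts - δ)) ts ∈ 𝓝[<] ts :=
      Ioo_mem_nhdsLT (max_lt hts0 (by linarith))
    obtain ⟨t, htR, ht⟩ := (hR.and_eventually hmem).exists
    have ht0 : 0 < t := (le_max_left _ _).trans_lt ht.1
    have htδ : ts - δ < t := (le_max_right _ _).trans_lt ht.1
    obtain ⟨M₀, hM₀⟩ := hex t ⟨ht0, ht.2⟩
    have hut : ∀ y, |u t y| ≤ R := by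
      rw [hu M₀ t ht0 hM₀] at htR ⊢
      refine abs_le_of_continuous_of_ae (h.continuous M₀ ht0) hR0 ?_
      have : eLpNorm (U M₀ t) ∞ volume ≤ ENNReal.ofReal R := by
        rw [ENNReal.ofReal_coe_nnreal]; exact htR
      simpa [hR0] using ae_abs_le_of_eLpNorm_le this
    have hclaim : ∀ s ∈ Ico t ts, ∀ y, |u s y| ≤ R + 1 := by
      by_contra! hex1
      obtain ⟨s₁, hs₁, y₁, hy₁⟩ := hex1
      have hs₁0 := ht0.trans_le hs₁.1
      obtain ⟨M, hM⟩ := hex s₁ ⟨hs₁0, hs₁.2⟩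
      have huM : ∀ s ∈ Ioc 0 s₁, u s = U M s := fun s hs => hu M s hs.1 (hM.mono hs.2)
      -- first exit time from the ball of radius `R + 1`
      set E : Set ℝ := {s | s ∈ Icc t s₁ ∧ ∃ y, (R : ℝ) + 1 < |U M s y|} with hE
      have hEne : E.Nonempty := ⟨s₁, ⟨hs₁.1, le_rfl⟩, y₁, by rwa [← huM s₁ ⟨hs₁0, le_rfl⟩]⟩
      have hEbdd : BddBelow E := ⟨t, fun s hs => hs.1.1⟩
      set σ := sInf E with hσ
      have hσt : t ≤ σ := le_csInf hEne fun s hs => hs.1.1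
      have hσs : σ ≤ s₁ := csInf_le hEbdd ⟨⟨hs₁.1, le_rfl⟩, y₁, by
        rwa [← huM s₁ ⟨hs₁0, le_rfl⟩]⟩
      have hbelow : ∀ r ∈ Ico t σ, ∀ y, |U M r y| ≤ R + 1 := by
        intro r hr y
        by_contra! hlt
        exact absurd (csInf_le hEbdd (⟨⟨hr.1, hr.2.le.trans hσs⟩, y, hlt⟩ : r ∈ E))
          (not_le.2 hr.2)
      have hutM : ∀ y, |U M t y| ≤ R := by rw [← huM t ⟨ht0, hs₁.1⟩]; exact hut
      have hσb : ∀ y, |U M σ y| ≤ R + 1 / 2 := by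
        intro y
        rcases hσt.eq_or_lt with heq | hlt
        · rw [← heq]; linarith [hutM y]
        · have h1 := (h.flow M).abs_le_of_restart (continuous_truncNonlin h.one_lt M)
            (abs_truncNonlin_le h.one_lt M) h.meas h.bound ht0 hlt hutM (C := C)
            (fun s hs z => by
              have h2 := hM s ⟨ht0.trans hs.1, hs.2.le.trans hσs⟩ z
              rw [truncNonlin, clamp_of_abs_le h2, abs_powNonlin h.one_lt]
              exact Real.rpow_le_rpow (abs_nonneg _) (hbelow s ⟨hs.1.le, hs.2⟩ z)
                (by linarith [h.one_lt])) y
          have h3 : C * (σ - t) ≤ C * δ :=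
            mul_le_mul_of_nonneg_left (by linarith [hs₁.2]) hC0
          linarith
      have hσ0 : 0 < σ := ht0.trans_le hσt
      have hun := Metric.tendstoUniformly_iff.1 (h.tendstoUniformly M hσ0) (1 / 2) (by norm_num)
      obtain ⟨η, hη, hun'⟩ := Metric.eventually_nhds_iff.1 hun
      obtain ⟨e, heE, he⟩ := exists_lt_of_csInf_lt hEne (by linarith : sInf E < σ + η)
      obtain ⟨y, hy⟩ := heE.2
      have he' : σ ≤ e := csInf_le hEbdd heE
      have h1 := hun' (y := e) (by rw [Real.dist_eq, abs_of_nonneg (by linarith)]; linarith) y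
      rw [Real.dist_eq, abs_sub_comm] at h1
      have h2 := abs_sub_abs_le_abs_sub (U M e y) (U M σ y)
      linarith [hσb y]
    -- hence one truncation level serves on the whole of `(0, t*)`, and by continuity at `t*`
    set M₁ := max M₀ (R + 1) with hM₁
    have hbd : ∀ s ∈ Ioo 0 ts, ∀ y, |U M₁ s y| ≤ M₁ := by
      intro s hs y
      obtain ⟨M, hM⟩ := hex s hs
      have h1 : ∀ r ∈ Ioc 0 s, ∀ x, |U M r x| ≤ M₁ := by
        intro r hr x
        rw [← hu M r hr.1 (hM.mono hr.2)]
        rcases le_total r t with hrt | hrt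
        · rw [hu M₀ r hr.1 (hM₀.mono hrt)]
          exact (hM₀ r ⟨hr.1, hrt⟩ x).trans (le_max_left _ _)
        · exact (hclaim r ⟨hrt, hr.2.trans_lt hs.2⟩ x).trans (le_max_right _ _)
      rw [← h.eq_of_abs_le hM h1 s ⟨hs.1, le_rfl⟩]
      exact h1 s ⟨hs.1, le_rfl⟩ y
    refine hnot M₁ fun s hs y => ?_
    rcases hs.2.eq_or_lt with rfl | hlt
    · have h1 := ((h.tendstoUniformly M₁ hts0).tendsto_at y).abs
      refine le_of_tendsto (h1.mono_left (nhdsWithin_le_nhds (s := Iio ts))) ?_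
      filter_upwards [Ioo_mem_nhdsLT hts0] with r hr using hbd r hr y
    · exact hbd s ⟨hs.1, hlt⟩ y
  · have hτ : ∀ t ∈ Ioo 0 τ, t ≤ ts := fun t ht => by
      obtain ⟨M, hM, -⟩ := h.exists_isBelow_of_solution hv ht
      exact le_csSup hbdd ⟨ht.1, M, hM⟩
    refine ⟨?_, fun t ht => ?_⟩
    · by_contra! hlt
      obtain ⟨t, h1, h2⟩ := exists_between hlt
      exact absurd (hτ t ⟨hts0.trans h1, h2⟩) (not_le.2 h1)
    · rcases ht.1.eq_or_lt with rfl | ht0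
      · rw [hu0]; exact hv.initial
      · obtain ⟨M, hM, hae⟩ := h.exists_isBelow_of_solution hv ⟨ht0, ht.2⟩
        rw [hu M t ht0 hM]
        exact hae

end IsTruncatedFamily

/-! ### The Gaussian variable and the weak derivative -/

theorem gaussWeight_eq {T : ℝ} (hT : 0 < T) (x : ℝ) :
    gaussWeight (x / Real.sqrt T) = Real.exp (-(x ^ 2) / (4 * T)) := by
  rw [gaussWeight, div_pow, Real.sq_sqrt hT.le]
  congr 1
  field_simp

theorem gaussWeight_eq_heatKernel {T : ℝ} (hT : 0 < T) (x : ℝ) :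
    gaussWeight (x / Real.sqrt T) = Real.sqrt (4 * Real.pi * T) * heatKernel T x := by
  have : 0 < Real.sqrt (4 * Real.pi * T) := Real.sqrt_pos.2 (by positivity)
  rw [gaussWeight_eq hT, heatKernel, ← mul_assoc, mul_inv_cancel₀ this.ne', one_mul]

theorem heatKernel_neg (t x : ℝ) : heatKernel t (-x) = heatKernel t x := by
  simp [heatKernel]

theorem integral_mul_gaussWeight {T : ℝ} (hT : 0 < T) (g : ℝ → ℝ) :
    ∫ x, g x * gaussWeight (x / Real.sqrt T) =
      Real.sqrt (4 * Real.pi * T) * ∫ z, g (Real.sqrt (2 * T) * z) ∂gauss := by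
  have h := heatFlow_eq_integral_gauss hT g 0
  simp only [zero_add] at h
  rw [← h, heatFlow, ← integral_const_mul]
  congr 1; ext x
  rw [gaussWeight_eq_heatKernel hT, zero_sub, heatKernel_neg]
  ring

theorem gaussDensity_eq_gaussWeight {T : ℝ} (hT : 0 < T) (z : ℝ) :
    gaussDensity z = (Real.sqrt (2 * Real.pi))⁻¹ *
      gaussWeight (Real.sqrt (2 * T) * z / Real.sqrt T) := by
  rw [gaussDensity_eq, gaussWeight_eq hT, mul_pow, Real.sq_sqrt (by positivity)]
  congr 2
  field_simp
  norm_num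

theorem integrable_comp_gauss {T : ℝ} (hT : 0 < T) {g : ℝ → ℝ}
    (hg : Integrable fun x => g x * gaussWeight (x / Real.sqrt T)) :
    Integrable (fun z => g (Real.sqrt (2 * T) * z)) gauss := by
  rw [integrable_gauss_iff]
  have hc : Real.sqrt (2 * T) ≠ 0 := (Real.sqrt_pos.2 (by positivity)).ne'
  refine ((hg.comp_mul_left' hc).const_mul (Real.sqrt (2 * Real.pi))⁻¹).congr
    (ae_of_all _ fun z => ?_)
  simp only
  rw [gaussDensity_eq_gaussWeight hT]
  ring

/-- Integration by parts for a weak derivative, with a test function that is not compactly supported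
but integrable against everything involved. -/
theorem HasWeakDerivative.integral_mul_deriv {f g : ℝ → ℝ} (h : HasWeakDerivative f g) {B : ℝ}
    (hB : ∀ x, |f x| ≤ B) {φ : ℝ → ℝ} (hφ : ContDiff ℝ ∞ φ) (hφi : Integrable φ)
    (hφi' : Integrable (deriv φ)) (hgφ : Integrable fun x => g x * φ x) :
    ∫ x, f x * deriv φ x = -∫ x, g x * φ x := by
  obtain ⟨χ, hχ, hχs, hχ1, hχ0⟩ : ∃ χ : ℝ → ℝ, ContDiff ℝ ∞ χ ∧ HasCompactSupport χ ∧
      (∀ x, |χ x| ≤ 1) ∧ χ 0 = 1 := by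
    let b : ContDiffBump (0 : ℝ) := ⟨1, 2, one_pos, one_lt_two⟩
    refine ⟨b, b.contDiff, b.hasCompactSupport, fun x => ?_,
      b.one_of_mem_closedBall (Metric.mem_closedBall_self zero_le_one)⟩
    rw [abs_of_nonneg b.nonneg]; exact b.le_one
  have hχd : Differentiable ℝ χ := hχ.differentiable (by simp)
  have hφd : Differentiable ℝ φ := hφ.differentiable (by simp)
  obtain ⟨C, hC⟩ := hχs.deriv.exists_bound_of_continuous
    (hχ.continuous_deriv (by simp))
  -- cut off with `χ (ε x)` and let `ε → 0`
  let ε : ℕ → ℝ := fun k => 1 / ((k : ℝ) + 1)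
  have hε0 : ∀ k, 0 < ε k := fun k => by positivity
  have hε1 : ∀ k, ε k ≤ 1 := fun k => by
    simp only [ε]; rw [div_le_one (by positivity)]; linarith [Nat.cast_nonneg (α := ℝ) k]
  have hεlim : Tendsto ε atTop (𝓝 0) := tendsto_one_div_add_atTop_nhds_zero_nat
  let ψ : ℕ → ℝ → ℝ := fun k x => φ x * χ (ε k * x)
  have hψ : ∀ k, ContDiff ℝ ∞ (ψ k) := fun k => by
    have : ContDiff ℝ ∞ fun x : ℝ => χ (ε k * x) := hχ.comp (by fun_prop)
    exact hφ.mul this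
  have hψc : ∀ k, HasCompactSupport (ψ k) := fun k => by
    have : HasCompactSupport fun x : ℝ => χ (ε k * x) :=
      hχs.comp_homeomorph (Homeomorph.mulLeft₀ (ε k) (hε0 k).ne')
    exact this.mul_left
  have hψd : ∀ k x, deriv (ψ k) x = deriv φ x * χ (ε k * x) + φ x * (ε k * deriv χ (ε k * x)) := by
    intro k x
    have h1 : HasDerivAt (fun x => χ (ε k * x)) (deriv χ (ε k * x) * (ε k * 1)) x :=
      HasDerivAt.comp x (hχd (ε k * x)).hasDerivAt ((hasDerivAt_id x).const_mul (ε k))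
    refine ((hφd x).hasDerivAt.mul h1).deriv.trans ?_
    ring
  have hχlim : ∀ x, Tendsto (fun k => χ (ε k * x)) atTop (𝓝 1) := by
    intro x
    have h1 : Tendsto (fun k => ε k * x) atTop (𝓝 0) := by simpa using hεlim.mul_const x
    have h2 := (hχ.continuous.tendsto 0).comp h1
    rwa [hχ0] at h2
  have hfm := h.1.aestronglyMeasurable
  have hgm := h.2.1.aestronglyMeasurable
  have hB0 : 0 ≤ B := (abs_nonneg _).trans (hB 0)
  have hC0 : 0 ≤ C := (norm_nonneg _).trans (hC 0)
  have lim1 : Tendsto (fun k => ∫ x, f x * deriv (ψ k) x) atTop (𝓝 (∫ x, f x * deriv φ x)) := by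
    refine tendsto_integral_of_dominated_convergence
      (fun x => B * (|deriv φ x| + |φ x| * C)) (fun k => ?_) ?_ (fun k => ae_of_all _ fun x => ?_)
      (ae_of_all _ fun x => ?_)
    · exact hfm.mul ((hψ k).continuous_deriv (by simp)).aestronglyMeasurable
    · exact (hφi'.abs.add (hφi.abs.mul_const C)).const_mul B
    · rw [Real.norm_eq_abs, abs_mul, hψd]
      refine mul_le_mul (hB x) ?_ (abs_nonneg _) hB0
      refine (abs_add_le _ _).trans ?_
      rw [abs_mul, abs_mul, abs_mul, abs_of_pos (hε0 k)]
      gcongr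
      · exact mul_le_of_le_one_right (abs_nonneg _) (hχ1 _)
      · calc _ ≤ 1 * C := by
              gcongr
              · exact hε1 k
              · exact hC _
          _ = C := one_mul C
    · simp_rw [hψd]
      have h1 : Tendsto (fun k => φ x * (ε k * deriv χ (ε k * x))) atTop (𝓝 0) := by
        have : Tendsto (fun k => ε k * deriv χ (ε k * x)) atTop (𝓝 0) := by
          refine squeeze_zero_norm (a := fun k => ε k * C) (fun k => ?_)
            (by simpa using hεlim.mul_const C)
          rw [norm_mul, Real.norm_of_nonneg (hε0 k).le]
          exact mul_le_mul_of_nonneg_left (hC _) (hε0 k).le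
        simpa using this.const_mul (φ x)
      simpa using (((hχlim x).const_mul (deriv φ x)).add h1).const_mul (f x)
  have lim2 : Tendsto (fun k => -∫ x, g x * ψ k x) atTop (𝓝 (-∫ x, g x * φ x)) := by
    refine (tendsto_integral_of_dominated_convergence (fun x => |g x * φ x|) (fun k => ?_) hgφ.abs
      (fun k => ae_of_all _ fun x => ?_) (ae_of_all _ fun x => ?_)).neg
    · exact hgm.mul (hψ k).continuous.aestronglyMeasurable
    · rw [Real.norm_eq_abs, ← mul_assoc, abs_mul]
      exact mul_le_of_le_one_right (abs_nonneg _) (hχ1 _)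
    · simpa [ψ] using ((hχlim x).const_mul (φ x)).const_mul (g x)
  exact tendsto_nhds_unique (lim1.congr fun k => h.2.2 _ (hψ k) (hψc k)) lim2

theorem integral_comp_affine (G : ℝ → ℝ) (x₀ : ℝ) {c : ℝ} (hc : 0 < c) :
    ∫ z, G (x₀ + c * z) = c⁻¹ * ∫ y, G y := by
  rw [Measure.integral_comp_mul_left (fun z => G (x₀ + z)) c, integral_add_left_eq_self G x₀,
    abs_of_pos (inv_pos.2 hc), smul_eq_mul]

theorem integrable_comp_affine_iff (G : ℝ → ℝ) (x₀ : ℝ) {c : ℝ} (hc : 0 < c) :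
    Integrable (fun z => G (x₀ + c * z)) ↔ Integrable G := by
  rw [integrable_comp_mul_left_iff (fun z => G (x₀ + z)) hc.ne']
  exact ⟨fun h => by simpa using h.comp_add_left (-x₀), fun h => h.comp_add_left x₀⟩

theorem hasDerivAt_hermitePoly_mul_gaussDensity (n : ℕ) (z : ℝ) :
    HasDerivAt (fun z => (hermitePoly n).eval z * gaussDensity z)
      (-((hermitePoly (n + 1)).eval z * gaussDensity z)) z := by
  refine (((hermitePoly n).hasDerivAt z).mul (hasDerivAt_gaussDensity z)).congr_deriv ?_
  rw [hermitePoly_succ]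
  simp
  ring

theorem contDiff_hermitePoly_mul_gaussDensity (n : ℕ) :
    ContDiff ℝ ∞ (fun z => (hermitePoly n).eval z * gaussDensity z) := by
  have e : (fun z => (hermitePoly n).eval z * gaussDensity z) = fun z =>
      (hermitePoly n).eval z * ((Real.sqrt (2 * Real.pi))⁻¹ * Real.exp (-(z ^ 2) / 2)) := by
    ext z; rw [gaussDensity_eq]
  rw [e]
  have : ContDiff ℝ ∞ fun z => (hermitePoly n).eval z := by
    simpa only [Polynomial.coe_aeval_eq_eval] using (hermitePoly n).contDiff_aeval (𝕜 := ℝ) ∞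
  fun_prop

theorem norm_sq_toLp_gauss {g : ℝ → ℝ} (hg : MemLp g 2 gauss) :
    ‖hg.toLp g‖ ^ 2 = ∫ z, g z ^ 2 ∂gauss := by
  rw [← real_inner_self_eq_norm_sq, L2.inner_def]
  refine integral_congr_ae ?_
  filter_upwards [hg.coeFn_toLp] with z hz
  rw [hz]; simp [sq]

section WeakDerivative

variable {f g : ℝ → ℝ} {B c : ℝ}

/-- Test the weak derivative with `Heₙ γ`, where `γ` is the Gaussian density:
`(Heₙ γ)` has derivative `-Heₙ₊₁ γ`. -/
theorem HasWeakDerivative.integral_mul_hermitePoly_succ (h : HasWeakDerivative f g)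
    (hB : ∀ x, |f x| ≤ B) (hc : 0 < c) (x₀ : ℝ)
    (hg : MemLp (fun z => g (x₀ + c * z)) 2 gauss) (n : ℕ) :
    ∫ z, f (x₀ + c * z) * (hermitePoly (n + 1)).eval z ∂gauss =
      c * ∫ z, g (x₀ + c * z) * (hermitePoly n).eval z ∂gauss := by
  set Θ : ℝ → ℝ := fun z => (hermitePoly n).eval z * gaussDensity z with hΘ
  set φ : ℝ → ℝ := fun y => Θ (c⁻¹ * (y - x₀)) with hφ
  have hφc : ∀ z, φ (x₀ + c * z) = Θ z := by
    intro z; simp only [hφ]; congr 1; field_simp; ring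
  have hφd : ∀ y, HasDerivAt φ (-((hermitePoly (n + 1)).eval (c⁻¹ * (y - x₀)) *
      gaussDensity (c⁻¹ * (y - x₀))) * c⁻¹) y := by
    intro y
    have h1 : HasDerivAt (fun y => c⁻¹ * (y - x₀)) c⁻¹ y := by
      simpa using ((hasDerivAt_id y).sub_const x₀).const_mul c⁻¹
    exact HasDerivAt.comp y (hasDerivAt_hermitePoly_mul_gaussDensity n _) h1
  have hφdc : ∀ z, deriv φ (x₀ + c * z) =
      -((hermitePoly (n + 1)).eval z * gaussDensity z) * c⁻¹ := by
    intro z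
    rw [(hφd _).deriv]
    have : c⁻¹ * (x₀ + c * z - x₀) = z := by field_simp; ring
    rw [this]
  have hi : ∀ m, Integrable fun z => (hermitePoly m).eval z * gaussDensity z := fun m => by
    have := (integrable_gauss_iff _).1 (integrable_polynomial_gauss (hermitePoly m))
    simpa only [mul_comm] using this
  have key := h.integral_mul_deriv hB (φ := φ) ?_ ?_ ?_ ?_
  · have e1 : ∫ y, f y * deriv φ y =
        -∫ z, f (x₀ + c * z) * (hermitePoly (n + 1)).eval z ∂gauss := by
      have := integral_comp_affine (fun y => f y * deriv φ y) x₀ hc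
      rw [integral_gauss, ← integral_neg]
      rw [eq_inv_mul_iff_mul_eq₀ hc.ne'] at this
      rw [← this, ← integral_const_mul]
      congr 1; ext z
      rw [hφdc]
      field_simp
    have e2 : ∫ y, g y * φ y = c * ∫ z, g (x₀ + c * z) * (hermitePoly n).eval z ∂gauss := by
      have := integral_comp_affine (fun y => g y * φ y) x₀ hc
      rw [integral_gauss]
      rw [eq_inv_mul_iff_mul_eq₀ hc.ne'] at this
      rw [← this]
      congr 2; ext z
      rw [hφc]
      simp only [hΘ]; ring
    rw [e1, e2, neg_inj] at key
    exact key
  · exact (contDiff_hermitePoly_mul_gaussDensity n).comp (by fun_prop)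
  · rw [← integrable_comp_affine_iff φ x₀ hc]
    simp_rw [hφc]
    exact hi n
  · rw [← integrable_comp_affine_iff (deriv φ) x₀ hc]
    simp_rw [hφdc]
    exact (hi (n + 1)).neg.mul_const _
  · rw [← integrable_comp_affine_iff (fun y => g y * φ y) x₀ hc]
    simp_rw [hφc]
    have := (integrable_gauss_iff _).1
      (integrable_mul_of_memLp_two hg (memLp_polynomial_gauss (hermitePoly n)))
    refine this.congr (ae_of_all _ fun z => ?_)
    simp only [hΘ]; ring

/-- Differentiation lowers the Hermite index, so Bessel's inequality for the derivative bounds the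
weighted sum of the Hermite coefficients of the function. -/
theorem HasWeakDerivative.sum_hermite_le (h : HasWeakDerivative f g)
    (hB : ∀ x, |f x| ≤ B) (hc : 0 < c) (x₀ : ℝ)
    (hg : MemLp (fun z => g (x₀ + c * z)) 2 gauss) (N : ℕ) :
    ∑ n ∈ Finset.range N, (n : ℝ) * (∫ z, f (x₀ + c * z) * hermiteFun n z ∂gauss) ^ 2 ≤
      c ^ 2 * ∫ z, g (x₀ + c * z) ^ 2 ∂gauss := by
  have hr : 0 ≤ c ^ 2 * ∫ z, g (x₀ + c * z) ^ 2 ∂gauss := by positivity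
  cases N with
  | zero => simpa using hr
  | succ N =>
    rw [Finset.sum_range_succ']
    have hterm : ∀ m : ℕ, ((m + 1 : ℕ) : ℝ) *
        (∫ z, f (x₀ + c * z) * hermiteFun (m + 1) z ∂gauss) ^ 2 =
          c ^ 2 * inner ℝ (hermiteBasis m) (hg.toLp _) ^ 2 := by
      intro m
      rw [inner_hermiteBasis]
      have e : ∀ (k : ℕ) (F : ℝ → ℝ), ∫ z, F z * hermiteFun k z ∂gauss =
          (∫ z, F z * (hermitePoly k).eval z ∂gauss) / Real.sqrt k.factorial := by
        intro k F
        rw [← integral_div]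
        simp only [hermiteFun, mul_div_assoc]
      rw [e, e, h.integral_mul_hermitePoly_succ hB hc x₀ hg, div_pow, div_pow,
        Real.sq_sqrt (by positivity), Real.sq_sqrt (by positivity), Nat.factorial_succ]
      push_cast
      field_simp
    simp_rw [hterm]
    rw [← Finset.mul_sum, ← norm_sq_toLp_gauss hg]
    simp only [Nat.cast_zero, zero_mul, add_zero]
    gcongr
    exact hermiteBasis.sum_sq_inner_le _ N

end WeakDerivative

/-! ### Similarity variables -/

/-- The homogeneity of the nonlinearity that matches the scaling of similarity variables. -/
theorem powNonlin_rpow_mul {p c : ℝ} (hp : 1 < p) (hc : 0 < c) (v : ℝ) :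
    powNonlin p (c ^ (1 / (p - 1)) * v) = c ^ (1 / (p - 1) + 1) * powNonlin p v := by
  have hp1 : p - 1 ≠ 0 := by linarith
  have h1 : 0 < c ^ (1 / (p - 1)) := Real.rpow_pos_of_pos hc _
  rw [powNonlin, powNonlin, abs_mul, abs_of_pos h1, Real.mul_rpow h1.le (abs_nonneg v),
    ← Real.rpow_mul hc.le, one_div_mul_cancel hp1, Real.rpow_one, Real.rpow_add_one hc.ne']
  ring

/-- The solution in similarity variables around `(x₀, T)`, as a function on the Gaussian space: `s`
is minus the logarithm of the backward time relative to `T`, and `z` is scaled so that the weight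
is the standard Gaussian. -/
noncomputable def selfSim (p T x₀ : ℝ) (u : ℝ → ℝ → ℝ) (s z : ℝ) : ℝ :=
  (T * Real.exp (-s)) ^ (1 / (p - 1)) *
    u (T - T * Real.exp (-s)) (x₀ + Real.sqrt (2 * (T * Real.exp (-s))) * z)

/-- The class in `L²` of the Gaussian measure of a square integrable function (zero otherwise). -/
noncomputable def toGaussLp (g : ℝ → ℝ) : Lp ℝ 2 gauss :=
  open Classical in if h : MemLp g 2 gauss then h.toLp g else 0

theorem toGaussLp_eq {g : ℝ → ℝ} (h : MemLp g 2 gauss) : toGaussLp g = h.toLp g := by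
  rw [toGaussLp, dif_pos h]

theorem coeFn_toGaussLp {g : ℝ → ℝ} (h : MemLp g 2 gauss) : toGaussLp g =ᵐ[gauss] g := by
  rw [toGaussLp_eq h]; exact h.coeFn_toLp

theorem inner_toGaussLp {f g : ℝ → ℝ} (hf : MemLp f 2 gauss) (hg : MemLp g 2 gauss) :
    inner ℝ (toGaussLp f) (toGaussLp g) = ∫ z, f z * g z ∂gauss := by
  rw [L2.inner_def]
  refine integral_congr_ae ?_
  filter_upwards [coeFn_toGaussLp hf, coeFn_toGaussLp hg] with z h1 h2
  rw [h1, h2]; simp [mul_comm]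

theorem memLp_gauss_of_bound {g : ℝ → ℝ} (hg : Measurable g) {C : ℝ} (hC : ∀ z, |g z| ≤ C) :
    MemLp g 2 gauss := MemLp.of_bound hg.aestronglyMeasurable C (ae_of_all _ hC)

theorem norm_toGaussLp_le {g : ℝ → ℝ} (hg : Measurable g) {C : ℝ} (hC : ∀ z, |g z| ≤ C) :
    ‖toGaussLp g‖ ≤ C := by
  have h := memLp_gauss_of_bound hg hC
  have hC0 : 0 ≤ C := (abs_nonneg _).trans (hC 0)
  have := Lp.norm_le_of_ae_bound (f := toGaussLp g) hC0 (by
    filter_upwards [coeFn_toGaussLp h] with z hz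
    rw [hz]; exact hC z)
  simpa [measureUnivNNReal] using this

namespace IsTruncatedFamily

variable {p : ℝ} {u₀ : ℝ → ℝ} {B₀ : ℝ} {U : ℝ → ℝ → ℝ → ℝ} {M T x₀ : ℝ}

theorem measurable_selfSim (h : IsTruncatedFamily p u₀ B₀ U) (s : ℝ) :
    Measurable (selfSim p T x₀ (U M) s) := by
  have h1 : Measurable fun z : ℝ => U M (T - T * Real.exp (-s))
      (x₀ + Real.sqrt (2 * (T * Real.exp (-s))) * z) :=
    (h.flow M).meas.comp (f := fun z : ℝ => (T - T * Real.exp (-s),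
      x₀ + Real.sqrt (2 * (T * Real.exp (-s))) * z)) (by fun_prop)
  exact h1.const_mul _

theorem abs_selfSim_le (h : IsTruncatedFamily p u₀ B₀ U) (hT : 0 < T) (hM : IsBelow U M T)
    {s : ℝ} (hs : 0 ≤ s) (z : ℝ) :
    |selfSim p T x₀ (U M) s z| ≤ T ^ (1 / (p - 1)) * max M B₀ := by
  have hp := h.one_lt
  have h1 : Real.exp (-s) ≤ 1 := by rw [Real.exp_le_one_iff]; linarith
  have h2 : T * Real.exp (-s) ≤ T := mul_le_of_le_one_right hT.le h1
  have h3 : 0 < T * Real.exp (-s) := by positivity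
  rw [selfSim, abs_mul, abs_of_nonneg (by positivity)]
  refine mul_le_mul (Real.rpow_le_rpow h3.le h2 (div_nonneg zero_le_one (by linarith))) ?_
    (abs_nonneg _) (by positivity)
  rcases (sub_nonneg.2 h2).eq_or_lt with h0 | h0
  · rw [← h0, (h.flow M).initial]; exact (h.bound _).trans (le_max_right _ _)
  · exact (hM _ ⟨h0, by linarith⟩ _).trans (le_max_left _ _)

/-- The Hermite coefficient of the nonlinear term, before rescaling. -/
noncomputable def sourceCoeff (p M T x₀ : ℝ) (u : ℝ → ℝ → ℝ) (n : ℕ) (r : ℝ) : ℝ :=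
  ∫ z, truncNonlin p M (u r (x₀ + Real.sqrt (2 * (T - r)) * z)) * hermiteFun n z ∂gauss

theorem continuousOn_sourceCoeff (h : IsTruncatedFamily p u₀ B₀ U) (n : ℕ) :
    ContinuousOn (sourceCoeff p M T x₀ (U M) n) (Ioi 0) := by
  intro r hr
  have hr : 0 < r := hr
  have hHi : Integrable (hermiteFun n) gauss := (memLp_hermiteFun n).integrable (by norm_num)
  have hN := continuous_truncNonlin h.one_lt M
  have hm : ∀ r, AEStronglyMeasurable (fun z => truncNonlin p M
      (U M r (x₀ + Real.sqrt (2 * (T - r)) * z)) * hermiteFun n z) gauss := by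
    intro r
    have h1 : Measurable fun z : ℝ => U M r (x₀ + Real.sqrt (2 * (T - r)) * z) :=
      (h.flow M).meas.comp (f := fun z : ℝ => (r, x₀ + Real.sqrt (2 * (T - r)) * z)) (by fun_prop)
    exact (hN.measurable.comp h1).aestronglyMeasurable.mul hHi.1
  refine ContinuousAt.continuousWithinAt ?_
  refine continuousAt_of_dominated (bound := fun z => |M| ^ p * |hermiteFun n z|)
    (Eventually.of_forall hm) (Eventually.of_forall fun r => ae_of_all _ fun z => ?_)
    (hHi.abs.const_mul _) (ae_of_all _ fun z => ?_)
  · rw [Real.norm_eq_abs, abs_mul]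
    gcongr
    exact abs_truncNonlin_le h.one_lt M _
  · have h1 : ContinuousAt (Function.uncurry (U M)) (r, x₀ + Real.sqrt (2 * (T - r)) * z) :=
      (h.continuousOn M).continuousAt (prod_mem_nhds (Ioi_mem_nhds hr) univ_mem)
    have h2 : ContinuousAt (fun r => (r, x₀ + Real.sqrt (2 * (T - r)) * z)) r := by fun_prop
    have h3 := ContinuousAt.comp (f := fun r => (r, x₀ + Real.sqrt (2 * (T - r)) * z)) h1 h2
    exact (hN.continuousAt.comp h3).mul continuousAt_const

theorem abs_sourceCoeff_le (h : IsTruncatedFamily p u₀ B₀ U) (n : ℕ) (r : ℝ) :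
    |sourceCoeff p M T x₀ (U M) n r| ≤ |M| ^ p * ∫ z, |hermiteFun n z| ∂gauss := by
  have hHi : Integrable (hermiteFun n) gauss := (memLp_hermiteFun n).integrable (by norm_num)
  rw [← integral_const_mul]
  rw [← Real.norm_eq_abs]
  refine norm_integral_le_of_norm_le (hHi.abs.const_mul _) (ae_of_all _ fun z => ?_)
  rw [Real.norm_eq_abs, abs_mul]
  gcongr
  exact abs_truncNonlin_le h.one_lt M _

/-- The integrand of the Hermite coefficients of the solution, as functions of time. -/
noncomputable def coeffRate (p M T x₀ : ℝ) (u : ℝ → ℝ → ℝ) (n : ℕ) (r : ℝ) : ℝ :=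
  Real.sqrt (T / (T - r)) ^ n * sourceCoeff p M T x₀ u n r

theorem continuousOn_coeffRate (h : IsTruncatedFamily p u₀ B₀ U) (n : ℕ) :
    ContinuousOn (coeffRate p M T x₀ (U M) n) (Ioo 0 T) := by
  refine ContinuousOn.mul ?_ ((h.continuousOn_sourceCoeff n).mono fun r hr => hr.1)
  refine ContinuousOn.pow (ContinuousOn.sqrt ?_) n
  exact continuousOn_const.div (by fun_prop) fun r hr => (sub_pos.2 hr.2).ne'

theorem intervalIntegrable_coeffRate (h : IsTruncatedFamily p u₀ B₀ U) (n : ℕ)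
    {t : ℝ} (ht : 0 ≤ t) (htT : t < T) :
    IntervalIntegrable (coeffRate p M T x₀ (U M) n) volume 0 t := by
  have hT := ht.trans_lt htT
  rw [intervalIntegrable_iff_integrableOn_Ioo_of_le ht]
  refine IntegrableOn.of_bound (C := Real.sqrt (T / (T - t)) ^ n *
    (|M| ^ p * ∫ z, |hermiteFun n z| ∂gauss)) (by simp) ?_ ?_
  · exact ((h.continuousOn_coeffRate n).mono
      (Ioo_subset_Ioo_right htT.le)).aestronglyMeasurable measurableSet_Ioo
  · refine (ae_restrict_iff' measurableSet_Ioo).2 (ae_of_all _ fun r hr => ?_)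
    rw [coeffRate, norm_mul, Real.norm_of_nonneg (by positivity)]
    have := sub_pos.2 htT
    have := hr.2
    gcongr
    exact h.abs_sourceCoeff_le n r

theorem hasDerivAt_integral_coeffRate (h : IsTruncatedFamily p u₀ B₀ U) (n : ℕ) {t : ℝ}
    (ht : t ∈ Ioo 0 T) : HasDerivAt (fun t => ∫ r in (0 : ℝ)..t, coeffRate p M T x₀ (U M) n r)
      (coeffRate p M T x₀ (U M) n t) t :=
  intervalIntegral.integral_hasDerivAt_right (h.intervalIntegrable_coeffRate n ht.1.le ht.2)
    ((h.continuousOn_coeffRate n).stronglyMeasurableAtFilter isOpen_Ioo t ht)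
    ((h.continuousOn_coeffRate n).continuousAt (isOpen_Ioo.mem_nhds ht))

/-- The variation of constants formula for the Hermite coefficients in similarity variables: the
`n`-th one relaxes at the rate `n / 2 + 1 / (p - 1)`. -/
theorem integral_selfSim_mul_hermiteFun (h : IsTruncatedFamily p u₀ B₀ U) (hT : 0 < T) (n : ℕ)
    {s : ℝ} (hs : 0 ≤ s) :
    ∫ z, selfSim p T x₀ (U M) s z * hermiteFun n z ∂gauss =
      Real.exp (-((n / 2 + 1 / (p - 1)) * s)) * (T ^ (1 / (p - 1)) *
        ((∫ z, u₀ (x₀ + Real.sqrt (2 * T) * z) * hermiteFun n z ∂gauss) +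
          ∫ r in (0 : ℝ)..(T - T * Real.exp (-s)), coeffRate p M T x₀ (U M) n r)) := by
  have e0 : ∫ z, selfSim p T x₀ (U M) s z * hermiteFun n z ∂gauss =
      (T * Real.exp (-s)) ^ (1 / (p - 1)) * ∫ z, U M (T - T * Real.exp (-s))
        (x₀ + Real.sqrt (2 * (T * Real.exp (-s))) * z) * hermiteFun n z ∂gauss := by
    rw [← integral_const_mul]
    simp only [selfSim, mul_assoc]
  rw [e0]
  rcases hs.eq_or_lt with rfl | hs0
  · simp [(h.flow M).initial]
  set θ := T * Real.exp (-s) with hθ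
  have h1 : Real.exp (-s) < 1 := by rw [Real.exp_lt_one_iff]; linarith
  have hθ0 : 0 < θ := by positivity
  have hθT : θ < T := mul_lt_of_lt_one_right hT h1
  have key := (h.flow M).integral_mul_hermiteFun (continuous_truncNonlin h.one_lt M)
    (abs_truncNonlin_le h.one_lt M) h.meas h.bound (sub_pos.2 hθT) (by linarith : T - θ < T) x₀ n
  rw [sub_sub_cancel] at key
  rw [key]
  have e1 : Real.sqrt (θ / T) ^ n = Real.exp (-(n / 2 * s)) := by
    have : θ / T = Real.exp (-s) := by rw [hθ]; field_simp
    rw [this, ← Real.exp_half, ← Real.exp_nat_mul]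
    congr 1; ring
  have e2 : ∫ r in (0 : ℝ)..(T - θ), Real.sqrt (θ / (T - r)) ^ n *
      ∫ z, truncNonlin p M (U M r (x₀ + Real.sqrt (2 * (T - r)) * z)) * hermiteFun n z ∂gauss =
      Real.exp (-(n / 2 * s)) *
        ∫ r in (0 : ℝ)..(T - θ), coeffRate p M T x₀ (U M) n r := by
    rw [← intervalIntegral.integral_const_mul]
    refine intervalIntegral.integral_congr fun r _ => ?_
    rw [coeffRate, sourceCoeff, ← e1, ← mul_assoc, ← mul_pow,
      ← Real.sqrt_mul (by positivity : 0 ≤ θ / T), div_mul_div_comm, mul_comm T,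
      mul_div_mul_right _ _ hT.ne']
  have e3 : θ ^ (1 / (p - 1)) = T ^ (1 / (p - 1)) * Real.exp (-(1 / (p - 1) * s)) := by
    rw [hθ, Real.mul_rpow hT.le (Real.exp_pos _).le, ← Real.exp_mul]
    congr 2; ring
  have e4 : Real.exp (-((n / 2 + 1 / (p - 1)) * s)) =
      Real.exp (-(n / 2 * s)) * Real.exp (-(1 / (p - 1) * s)) := by
    rw [← Real.exp_add]; congr 1; ring
  rw [e1, e2, e3, e4]
  ring

theorem integral_powNonlin_selfSim_mul_hermiteFun (h : IsTruncatedFamily p u₀ B₀ U) (hT : 0 < T)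
    (hM : IsBelow U M T) (n : ℕ) {s : ℝ} (hs : 0 < s) :
    ∫ z, powNonlin p (selfSim p T x₀ (U M) s z) * hermiteFun n z ∂gauss =
      (T * Real.exp (-s)) ^ (1 / (p - 1) + 1) *
        sourceCoeff p M T x₀ (U M) n (T - T * Real.exp (-s)) := by
  have h1 : Real.exp (-s) < 1 := by rw [Real.exp_lt_one_iff]; linarith
  have hθ0 : 0 < T * Real.exp (-s) := by positivity
  have hθT : T * Real.exp (-s) < T := mul_lt_of_lt_one_right hT h1
  rw [sourceCoeff, ← integral_const_mul, sub_sub_cancel]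
  congr 1; ext z
  rw [selfSim, powNonlin_rpow_mul h.one_lt hθ0, truncNonlin, clamp_of_abs_le
    (hM _ ⟨sub_pos.2 hθT, by linarith⟩ _), mul_assoc]

/-- In Hermite coordinates the equation in similarity variables reads `w_s = -l w + f` with
`l = n / 2 + 1 / (p - 1)`, where `f` is the coefficient of the nonlinearity. -/
theorem hasDerivAt_integral_selfSim (h : IsTruncatedFamily p u₀ B₀ U) (hT : 0 < T)
    (hM : IsBelow U M T) (n : ℕ) {s : ℝ} (hs : 0 < s) :
    HasDerivAt (fun s => ∫ z, selfSim p T x₀ (U M) s z * hermiteFun n z ∂gauss)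
      (-(n / 2 + 1 / (p - 1)) * (∫ z, selfSim p T x₀ (U M) s z * hermiteFun n z ∂gauss) +
        ∫ z, powNonlin p (selfSim p T x₀ (U M) s z) * hermiteFun n z ∂gauss) s := by
  have h1 : Real.exp (-s) < 1 := by rw [Real.exp_lt_one_iff]; linarith
  have hθ0 : 0 < T * Real.exp (-s) := by positivity
  have hθT : T * Real.exp (-s) < T := mul_lt_of_lt_one_right hT h1
  have hev : (fun s => ∫ z, selfSim p T x₀ (U M) s z * hermiteFun n z ∂gauss) =ᶠ[𝓝 s]
      fun s => Real.exp (-((n / 2 + 1 / (p - 1)) * s)) * (T ^ (1 / (p - 1)) *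
        ((∫ z, u₀ (x₀ + Real.sqrt (2 * T) * z) * hermiteFun n z ∂gauss) +
          ∫ r in (0 : ℝ)..(T - T * Real.exp (-s)), coeffRate p M T x₀ (U M) n r)) := by
    filter_upwards [lt_mem_nhds hs] with s' hs'
    exact h.integral_selfSim_mul_hermiteFun (M := M) (x₀ := x₀) hT n hs'.le
  refine HasDerivAt.congr_of_eventuallyEq ?_ hev
  rw [h.integral_powNonlin_selfSim_mul_hermiteFun hT hM n hs,
    h.integral_selfSim_mul_hermiteFun hT n hs.le]
  set l := (n : ℝ) / 2 + 1 / (p - 1) with hl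
  set A := ∫ z, u₀ (x₀ + Real.sqrt (2 * T) * z) * hermiteFun n z ∂gauss
  have hI := h.hasDerivAt_integral_coeffRate (M := M) (x₀ := x₀) n
    (T := T) (t := T - T * Real.exp (-s)) ⟨sub_pos.2 hθT, by linarith⟩
  have ht : HasDerivAt (fun s => T - T * Real.exp (-s)) (T * Real.exp (-s)) s := by
    refine (((hasDerivAt_neg s).exp.const_mul T).const_sub T).congr_deriv ?_
    ring
  have hI' := HasDerivAt.comp s hI ht
  have he : HasDerivAt (fun s => Real.exp (-(l * s))) (Real.exp (-(l * s)) * -(l * 1)) s :=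
    (((hasDerivAt_id s).const_mul l).neg).exp
  refine (he.mul ((hI'.const_add A).const_mul (T ^ (1 / (p - 1))))).congr_deriv ?_
  simp only [Function.comp]
  have e3 : (T * Real.exp (-s)) ^ (1 / (p - 1) + 1) =
      T ^ (1 / (p - 1)) * Real.exp (-(1 / (p - 1) * s)) * (T * Real.exp (-s)) := by
    rw [Real.rpow_add_one hθ0.ne', Real.mul_rpow hT.le (Real.exp_pos _).le, ← Real.exp_mul]
    congr 3; ring
  have e4 : Real.exp (-(l * s)) * Real.sqrt (T / (T * Real.exp (-s))) ^ n =
      Real.exp (-(1 / (p - 1) * s)) := by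
    have : T / (T * Real.exp (-s)) = Real.exp s := by
      rw [Real.exp_neg]; field_simp
    rw [this, ← Real.exp_half, ← Real.exp_nat_mul, ← Real.exp_add, hl]
    congr 1; ring
  rw [coeffRate, sub_sub_cancel, e3]
  linear_combination (T ^ (1 / (p - 1)) * (T * Real.exp (-s)) *
    sourceCoeff p M T x₀ (U M) n (T - T * Real.exp (-s))) * e4

theorem continuousOn_integral_selfSim (h : IsTruncatedFamily p u₀ B₀ U) (hT : 0 < T) (n : ℕ) :
    ContinuousOn (fun s => ∫ z, selfSim p T x₀ (U M) s z * hermiteFun n z ∂gauss) (Ici 0) := by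
  have hev : ∀ s ∈ Ici (0 : ℝ), (fun s => ∫ z, selfSim p T x₀ (U M) s z * hermiteFun n z ∂gauss) s
      = _ := fun s hs => h.integral_selfSim_mul_hermiteFun (M := M) (x₀ := x₀) hT n hs
  refine ContinuousOn.congr ?_ hev
  have hI : ContinuousOn (fun t => ∫ r in (0 : ℝ)..t, coeffRate p M T x₀ (U M) n r) (Ico 0 T) := by
    intro t ht
    obtain ⟨t', h1, h2⟩ := exists_between ht.2
    have ht' := ht.1.trans h1.le
    have := intervalIntegral.continuousOn_primitive_interval (μ := volume) (a := 0) (b := t')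
      (f := coeffRate p M T x₀ (U M) n) (by
        rw [uIcc_of_le ht', integrableOn_Icc_iff_integrableOn_Ioc]
        exact (intervalIntegrable_iff_integrableOn_Ioc_of_le ht').1
          (h.intervalIntegrable_coeffRate n ht' h2))
    rw [uIcc_of_le ht'] at this
    refine (this t ⟨ht.1, h1.le⟩).mono_of_mem_nhdsWithin ?_
    filter_upwards [self_mem_nhdsWithin, nhdsWithin_le_nhds (Iio_mem_nhds h1)] with y hy hy'
    exact ⟨hy.1, (mem_Iio.1 hy').le⟩
  have hmaps : MapsTo (fun s => T - T * Real.exp (-s)) (Ici 0) (Ico 0 T) := by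
    intro s hs
    have hs : 0 ≤ s := hs
    have h1 : Real.exp (-s) ≤ 1 := by rw [Real.exp_le_one_iff]; linarith
    have h2 : 0 < T * Real.exp (-s) := by positivity
    exact ⟨sub_nonneg.2 (mul_le_of_le_one_right hT.le h1), by linarith⟩
  have hcomp := hI.comp (f := fun s => T - T * Real.exp (-s)) (by fun_prop) hmaps
  have he : ContinuousOn (fun s => Real.exp (-((n / 2 + 1 / (p - 1)) * s))) (Ici 0) := by fun_prop
  exact he.mul (continuousOn_const.mul (continuousOn_const.add hcomp))

theorem continuousOn_integral_powNonlin_selfSim (h : IsTruncatedFamily p u₀ B₀ U) (hT : 0 < T)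
    (hM : IsBelow U M T) (n : ℕ) : ContinuousOn
      (fun s => ∫ z, powNonlin p (selfSim p T x₀ (U M) s z) * hermiteFun n z ∂gauss) (Ioi 0) := by
  have hev : ∀ s ∈ Ioi (0 : ℝ),
      (fun s => ∫ z, powNonlin p (selfSim p T x₀ (U M) s z) * hermiteFun n z ∂gauss) s = _ :=
    fun s hs => h.integral_powNonlin_selfSim_mul_hermiteFun (x₀ := x₀) hT hM n hs
  refine ContinuousOn.congr ?_ hev
  have hmaps : MapsTo (fun s => T - T * Real.exp (-s)) (Ioi 0) (Ioi 0) := by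
    intro s hs
    have hs : 0 < s := hs
    have h1 : Real.exp (-s) < 1 := by rw [Real.exp_lt_one_iff]; linarith
    exact sub_pos.2 (mul_lt_of_lt_one_right hT h1)
  refine ContinuousOn.mul ?_ ((h.continuousOn_sourceCoeff (M := M) (x₀ := x₀) (T := T) n).comp
    (f := fun s => T - T * Real.exp (-s)) (by fun_prop) hmaps)
  refine ContinuousOn.rpow_const (by fun_prop) fun s _ => Or.inl ?_
  positivity

/-! ### The energy argument -/

/-- In similarity variables the flow is a gradient flow in the Gaussian `L²` space. -/
theorem isGradientFlow (h : IsTruncatedFamily p u₀ B₀ U) (hT : 0 < T) (hM : IsBelow U M T)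
    {g : ℝ → ℝ} (hw : HasWeakDerivative u₀ g)
    (hg : MemLp (fun z => g (x₀ + Real.sqrt (2 * T) * z)) 2 gauss) :
    ∃ B Λ, IsGradientFlow hermiteBasis (fun n => (n : ℝ) / 2 + 1 / (p - 1))
      (fun s => toGaussLp (selfSim p T x₀ (U M) s))
      (fun s => toGaussLp fun z => powNonlin p (selfSim p T x₀ (U M) s z))
      (fun s => ∫ z, |selfSim p T x₀ (U M) s z| ^ (p + 1) / (p + 1) ∂gauss) B Λ
      (T ^ (2 * (1 / (p - 1))) * (T * (∫ z, g (x₀ + Real.sqrt (2 * T) * z) ^ 2 ∂gauss) +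
        1 / (p - 1) * ∫ z, u₀ (x₀ + Real.sqrt (2 * T) * z) ^ 2 ∂gauss)) := by
  have hp := h.one_lt
  have hp1 : 0 < p - 1 := by linarith
  set κ := 1 / (p - 1) with hκ
  have hκ0 : 0 < κ := by positivity
  set w := selfSim p T x₀ (U M) with hwdef
  set R := T ^ κ * max M B₀ with hR
  have hwm : ∀ s, Measurable (w s) := h.measurable_selfSim
  have hwb : ∀ s, 0 ≤ s → ∀ z, |w s z| ≤ R := fun s hs z => h.abs_selfSim_le hT hM hs z
  have hF := (continuous_powNonlin hp).measurable
  have hfm : ∀ s, Measurable fun z => powNonlin p (w s z) := fun s => hF.comp (hwm s)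
  have hfb : ∀ s, 0 ≤ s → ∀ z, |powNonlin p (w s z)| ≤ R ^ p := fun s hs z => by
    rw [abs_powNonlin hp]
    exact Real.rpow_le_rpow (abs_nonneg _) (hwb s hs z) (by linarith)
  have hwL : ∀ s, 0 ≤ s → MemLp (w s) 2 gauss := fun s hs => memLp_gauss_of_bound (hwm s) (hwb s hs)
  have hfL : ∀ s, 0 ≤ s → MemLp (fun z => powNonlin p (w s z)) 2 gauss := fun s hs =>
    memLp_gauss_of_bound (hfm s) (hfb s hs)
  have ew : ∀ n s, 0 ≤ s → inner ℝ (hermiteBasis n) (toGaussLp (w s)) =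
      ∫ z, w s z * hermiteFun n z ∂gauss := fun n s hs => by
    rw [toGaussLp_eq (hwL s hs), inner_hermiteBasis]
  have ef : ∀ n s, 0 ≤ s → inner ℝ (hermiteBasis n) (toGaussLp fun z => powNonlin p (w s z)) =
      ∫ z, powNonlin p (w s z) * hermiteFun n z ∂gauss := fun n s hs => by
    rw [toGaussLp_eq (hfL s hs), inner_hermiteBasis]
  obtain ⟨K, hK, hLip⟩ := exists_lipschitz_powNonlin hp R
  refine ⟨R ^ p, K, fun n => by positivity, fun n => ?_, fun n s hs => ?_, fun n => ?_,
    fun s hs => norm_toGaussLp_le (hfm s) (hfb s hs), fun r s hr hs => ?_, fun r s hr hs => ?_,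
    fun N => ?_⟩
  · exact (h.continuousOn_integral_selfSim hT n).congr fun s hs => ew n s hs
  · rw [ew n s hs.le, ef n s hs.le]
    refine (h.hasDerivAt_integral_selfSim hT hM n hs).congr_of_eventuallyEq ?_
    filter_upwards [lt_mem_nhds hs] with s' hs'
    exact ew n s' hs'.le
  · exact (h.continuousOn_integral_powNonlin_selfSim hT hM n).congr fun s hs =>
      ef n s (le_of_lt hs)
  · refine Lp.norm_le_mul_norm_of_ae_le_mul ?_
    filter_upwards [coeFn_toGaussLp (hwL s hs), coeFn_toGaussLp (hwL r hr),
      coeFn_toGaussLp (hfL s hs), coeFn_toGaussLp (hfL r hr),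
      Lp.coeFn_sub (toGaussLp (w s)) (toGaussLp (w r)),
      Lp.coeFn_sub (toGaussLp fun z => powNonlin p (w s z))
        (toGaussLp fun z => powNonlin p (w r z))] with z h1 h2 h3 h4 h5 h6
    rw [h5, h6, Pi.sub_apply, Pi.sub_apply, h1, h2, h3, h4]
    exact hLip _ _ (hwb s hs z) (hwb r hr z)
  · have hpot : ∀ s, 0 ≤ s → Integrable (fun z => |w s z| ^ (p + 1) / (p + 1)) gauss := by
      intro s hs
      refine Integrable.of_bound (C := R ^ (p + 1) / (p + 1)) ?_ (ae_of_all _ fun z => ?_)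
      · have := hwm s
        exact Measurable.aestronglyMeasurable (by fun_prop)
      · rw [Real.norm_of_nonneg (by positivity)]
        have := hwb s hs z
        gcongr
    rw [inner_sub_right, inner_toGaussLp (hfL r hr) (hwL s hs),
      inner_toGaussLp (hfL r hr) (hwL r hr), ← integral_sub, ← integral_sub (hpot s hs) (hpot r hr)]
    · refine integral_mono ?_ ((hpot s hs).sub (hpot r hr)) fun z => ?_
      · exact (integrable_mul_of_memLp_two (hfL r hr) (hwL s hs)).sub
          (integrable_mul_of_memLp_two (hfL r hr) (hwL r hr))
      · have := powNonlin_mul_sub_le hp (w r z) (w s z)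
        simp only
        linarith
    · exact integrable_mul_of_memLp_two (hfL r hr) (hwL s hs)
    · exact integrable_mul_of_memLp_two (hfL r hr) (hwL r hr)
  · have hu0L : MemLp (fun z => u₀ (x₀ + Real.sqrt (2 * T) * z)) 2 gauss :=
      memLp_gauss_of_bound (h.meas.comp (by fun_prop)) fun z => h.bound _
    have e0 : ∀ n, inner ℝ (hermiteBasis n) (toGaussLp (w 0)) =
        T ^ κ * inner ℝ (hermiteBasis n) (hu0L.toLp _) := by
      intro n
      rw [ew n 0 le_rfl, inner_hermiteBasis, ← integral_const_mul]
      congr 1; ext z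
      simp [hwdef, selfSim, (h.flow M).initial, hκ, mul_assoc]
    have hTκ : (T ^ κ) ^ 2 = T ^ (2 * κ) := by
      rw [← Real.rpow_natCast, ← Real.rpow_mul hT.le]; congr 1; push_cast; ring
    simp_rw [e0, mul_pow, hTκ]
    have h1 := hw.sum_hermite_le h.bound (Real.sqrt_pos.2 (by positivity : 0 < 2 * T)) x₀ hg N
    rw [Real.sq_sqrt (by positivity)] at h1
    have h2 := hermiteBasis.sum_sq_inner_le (hu0L.toLp _) N
    rw [norm_sq_toLp_gauss] at h2
    simp_rw [← inner_hermiteBasis _ hu0L] at h1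
    have e : ∑ n ∈ Finset.range N, ((n : ℝ) / 2 + κ) *
        (T ^ (2 * κ) * inner ℝ (hermiteBasis n) (hu0L.toLp _) ^ 2) =
        T ^ (2 * κ) * ((∑ n ∈ Finset.range N, (n : ℝ) *
          inner ℝ (hermiteBasis n) (hu0L.toLp _) ^ 2) / 2 +
          κ * ∑ n ∈ Finset.range N, inner ℝ (hermiteBasis n) (hu0L.toLp _) ^ 2) := by
      rw [Finset.sum_div, Finset.mul_sum, ← Finset.sum_add_distrib, Finset.mul_sum]
      exact Finset.sum_congr rfl fun n _ => by ring
    rw [e]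
    gcongr
    linarith

/-- A solution that is bounded up to time `T` has nonnegative initial energy: otherwise its norm in
similarity variables would grow without bound. -/
theorem not_isBelow (h : IsTruncatedFamily p u₀ B₀ U) (hT : 0 < T)
    {g : ℝ → ℝ} (hw : HasWeakDerivative u₀ g)
    (hg : MemLp (fun z => g (x₀ + Real.sqrt (2 * T) * z)) 2 gauss)
    (hneg : T ^ (2 * (1 / (p - 1))) * (T * (∫ z, g (x₀ + Real.sqrt (2 * T) * z) ^ 2 ∂gauss) +
        1 / (p - 1) * ∫ z, u₀ (x₀ + Real.sqrt (2 * T) * z) ^ 2 ∂gauss) / 2 <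
      T ^ (2 * (1 / (p - 1)) + 1) *
        ∫ z, |u₀ (x₀ + Real.sqrt (2 * T) * z)| ^ (p + 1) / (p + 1) ∂gauss) (M : ℝ) :
    ¬ IsBelow U M T := by
  intro hM
  have hp := h.one_lt
  have hp1 : 0 < p - 1 := by linarith
  obtain ⟨B, Λ, hflow⟩ := h.isGradientFlow hT hM hw hg
  set w := selfSim p T x₀ (U M) with hwdef
  set R := T ^ (1 / (p - 1)) * max M B₀ with hR
  have hwm : ∀ s, Measurable (w s) := h.measurable_selfSim
  have hwb : ∀ s, 0 ≤ s → ∀ z, |w s z| ≤ R := fun s hs z => h.abs_selfSim_le hT hM hs z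
  have hgrow := fun s hs => hflow.linear_growth (s := s) (fun s hs => ?_)
    (W := R) (fun s hs => norm_toGaussLp_le (hwm s) (hwb s hs)) hs
  · have e0 : ∫ z, |w 0 z| ^ (p + 1) / (p + 1) ∂gauss = T ^ (2 * (1 / (p - 1)) + 1) *
        ∫ z, |u₀ (x₀ + Real.sqrt (2 * T) * z)| ^ (p + 1) / (p + 1) ∂gauss := by
      rw [← integral_const_mul]
      congr 1; ext z
      have e1 : w 0 z = T ^ (1 / (p - 1)) * u₀ (x₀ + Real.sqrt (2 * T) * z) := by
        simp [hwdef, selfSim, (h.flow M).initial]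
      have e2 : (T ^ (1 / (p - 1))) ^ (p + 1) = T ^ (2 * (1 / (p - 1)) + 1) := by
        rw [← Real.rpow_mul hT.le]; congr 1; field_simp; ring
      rw [e1, abs_mul, abs_of_pos (Real.rpow_pos_of_pos hT _),
        Real.mul_rpow (by positivity) (abs_nonneg _), e2]
      ring
    rw [← e0] at hneg
    set e := (∫ z, |w 0 z| ^ (p + 1) / (p + 1) ∂gauss) -
      T ^ (2 * (1 / (p - 1))) * (T * (∫ z, g (x₀ + Real.sqrt (2 * T) * z) ^ 2 ∂gauss) +
        1 / (p - 1) * ∫ z, u₀ (x₀ + Real.sqrt (2 * T) * z) ^ 2 ∂gauss) / 2 with he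
    have he0 : 0 < e := sub_pos.2 hneg
    -- the time at which the linear lower bound for the squared norm exceeds the upper bound `R ^ 2`
    have h1 := hgrow ((R ^ 2 + 1) / (4 * e)) (by positivity)
    have h2 : ‖toGaussLp (w ((R ^ 2 + 1) / (4 * e)))‖ ≤ R :=
      norm_toGaussLp_le (hwm _) (hwb _ (by positivity))
    have h3 := pow_le_pow_left₀ (norm_nonneg _) h2 2
    have h4 : 4 * e * ((R ^ 2 + 1) / (4 * e)) = R ^ 2 + 1 := by field_simp
    rw [h4] at h1
    linarith
  · have hF := (continuous_powNonlin hp).measurable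
    have hfm : Measurable fun z => powNonlin p (w s z) := hF.comp (hwm s)
    have hfb : ∀ z, |powNonlin p (w s z)| ≤ R ^ p := fun z => by
      rw [abs_powNonlin hp]
      exact Real.rpow_le_rpow (abs_nonneg _) (hwb s hs z) (by linarith)
    rw [inner_toGaussLp (memLp_gauss_of_bound hfm hfb) (memLp_gauss_of_bound (hwm s) (hwb s hs)),
      integral_div]
    simp_rw [powNonlin_mul_self hp]
    have h0 : 0 ≤ ∫ z, |w s z| ^ (p + 1) ∂gauss := integral_nonneg fun z => by positivity
    rw [mul_div_assoc', div_le_iff₀ (by linarith)]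
    nlinarith

end IsTruncatedFamily

/-! ### The energy of the initial value and the blow-up theorem -/

theorem energyST_congr_ae {p T : ℝ} {f₁ f₂ g₁ g₂ : ℝ → ℝ} (hf : f₁ =ᵐ[volume] f₂)
    (hg : g₁ =ᵐ[volume] g₂) : energyST p T f₁ g₁ = energyST p T f₂ g₂ := by
  unfold energyST
  congr 2
  · refine integral_congr_ae ?_
    filter_upwards [hf, hg] with x h1 h2
    rw [h1, h2]
  · refine integral_congr_ae ?_
    filter_upwards [hf] with x h1
    rw [h1]

/-- Up to the factor `√(4π)`, the functional `S_T` is the energy of the initial value in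
similarity variables, written with the normalised Gaussian measure. -/
theorem energyST_eq {p T : ℝ} (hp : 1 < p) (hT : 0 < T) {f g : ℝ → ℝ}
    (hf : Integrable (fun z => |f (Real.sqrt (2 * T) * z)| ^ (p + 1)) gauss)
    (hg : Integrable (fun z => g (Real.sqrt (2 * T) * z) ^ 2) gauss) :
    energyST p T f g = Real.sqrt (4 * Real.pi) *
      (T ^ (2 * (1 / (p - 1))) * (T * (∫ z, g (Real.sqrt (2 * T) * z) ^ 2 ∂gauss) +
          1 / (p - 1) * ∫ z, f (Real.sqrt (2 * T) * z) ^ 2 ∂gauss) / 2 -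
        T ^ (2 * (1 / (p - 1)) + 1) *
          ∫ z, |f (Real.sqrt (2 * T) * z)| ^ (p + 1) / (p + 1) ∂gauss) := by
  have hp1 : p - 1 ≠ 0 := by linarith
  have hsq : Real.sqrt (4 * Real.pi * T) = Real.sqrt (4 * Real.pi) * T ^ (1 / 2 : ℝ) := by
    rw [Real.sqrt_mul (by positivity), Real.sqrt_eq_rpow T]
  have e1 : T ^ ((1 / 2) * ((p + 3) / (p - 1))) * T ^ (1 / 2 : ℝ) =
      T ^ (2 * (1 / (p - 1)) + 1) := by
    rw [← Real.rpow_add hT]; congr 1; field_simp; ring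
  have e2 : T ^ (-(1 / 2) * ((p - 5) / (p - 1))) * T ^ (1 / 2 : ℝ) =
      T ^ (2 * (1 / (p - 1))) := by
    rw [← Real.rpow_add hT]; congr 1; field_simp; ring
  have e3 : T ^ (2 * (1 / (p - 1)) + 1) = T ^ (2 * (1 / (p - 1))) * T :=
    Real.rpow_add_one hT.ne' _
  rw [energyST, integral_mul_gaussWeight hT
      (fun x => (1 / 2) * |g x| ^ 2 - (1 / (p + 1)) * |f x| ^ (p + 1)),
    integral_mul_gaussWeight hT (fun x => |f x| ^ 2), hsq]
  simp only [sq_abs]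
  rw [integral_sub (hg.const_mul _) (hf.const_mul _), integral_const_mul, integral_const_mul,
    integral_div]
  set G := ∫ z, g (Real.sqrt (2 * T) * z) ^ 2 ∂gauss
  set F := ∫ z, |f (Real.sqrt (2 * T) * z)| ^ (p + 1) ∂gauss
  set K := ∫ z, f (Real.sqrt (2 * T) * z) ^ 2 ∂gauss
  linear_combination Real.sqrt (4 * Real.pi) * (1 / 2 * G - 1 / (p + 1) * F) * e1 +
    Real.sqrt (4 * Real.pi) * (1 / 2 * (1 / (p - 1)) * K) * e2 +
    Real.sqrt (4 * Real.pi) * (1 / 2 * G) * e3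

theorem MeasureTheory.MemLp.exists_measurable_bounded {f : ℝ → ℝ} (hf : MemLp f ∞ volume) :
    ∃ (v : ℝ → ℝ) (B : ℝ), Measurable v ∧ (∀ y, |v y| ≤ B) ∧ f =ᵐ[volume] v := by
  set B := (eLpNorm f ∞ volume).toReal with hB
  refine ⟨fun y => clamp B (hf.1.mk f y), |B|, ?_, fun y => abs_clamp_le B _, ?_⟩
  · exact (continuous_clamp B).measurable.comp hf.1.measurable_mk
  · filter_upwards [hf.1.ae_eq_mk, ae_le_eLpNormEssSup (f := f) (μ := volume)] with y h1 h2
    rw [← h1, clamp_of_abs_le]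
    rw [← eLpNorm_exponent_top] at h2
    have := ENNReal.toReal_mono hf.2.ne h2
    rwa [toReal_enorm, Real.norm_eq_abs] at this

theorem HasWeakDerivative.congr_ae {f₁ f₂ g₁ g₂ : ℝ → ℝ} (h : HasWeakDerivative f₁ g₁)
    (hf : f₁ =ᵐ[volume] f₂) (hg : g₁ =ᵐ[volume] g₂) : HasWeakDerivative f₂ g₂ := by
  refine ⟨h.1.congr hf, h.2.1.congr hg, fun φ hφ hc => ?_⟩
  have e1 : ∫ x, f₂ x * deriv φ x = ∫ x, f₁ x * deriv φ x := by
    refine integral_congr_ae ?_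
    filter_upwards [hf] with x hx
    rw [hx]
  have e2 : ∫ x, g₂ x * φ x = ∫ x, g₁ x * φ x := by
    refine integral_congr_ae ?_
    filter_upwards [hg] with x hx
    rw [hx]
  rw [e1, e2, h.2.2 φ hφ hc]

theorem theoremA2 (p : ℝ) (hp : 1 < p) (u₀ u₀' : ℝ → ℝ)
    (hu₀ : MemLp u₀ ∞ volume) (hu₀' : HasWeakDerivative u₀ u₀')
    (T : ℝ) (hT : 0 < T) (x₀ : ℝ)
    (hfin : Integrable (fun x => |u₀' (x + x₀)| ^ 2 * gaussWeight (x / Real.sqrt T)) volume)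
    (hS : energyST p T (fun x => u₀ (x + x₀)) (fun x => u₀' (x + x₀)) < 0) :
    ∃ (tstar : ℝ) (u : ℝ → ℝ → ℝ), 0 < tstar ∧ tstar ≤ T ∧
      IsNLHSolution p u₀ tstar u ∧
      Tendsto (fun t => eLpNorm (u t) ∞ volume) (𝓝[<] tstar) (𝓝 ∞) ∧
      ∀ (τ : ℝ) (v : ℝ → ℝ → ℝ), IsNLHSolution p u₀ τ v →
        τ ≤ tstar ∧ ∀ t ∈ Ico 0 τ, v t =ᵐ[volume] u t := by
  obtain ⟨v, B, hvm, hvB, huv⟩ := hu₀.exists_measurable_bounded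
  have hgm := hu₀'.2.1.aestronglyMeasurable
  set g := hgm.mk u₀' with hg_def
  have hg : Measurable g := hgm.measurable_mk
  have hug : u₀' =ᵐ[volume] g := hgm.ae_eq_mk
  have hshift := (measurePreserving_add_right volume x₀).quasiMeasurePreserving
  have huv' : (fun x => u₀ (x + x₀)) =ᵐ[volume] fun x => v (x + x₀) := hshift.ae_eq_comp huv
  have hug' : (fun x => u₀' (x + x₀)) =ᵐ[volume] fun x => g (x + x₀) := hshift.ae_eq_comp hug
  have hgi : Integrable (fun z => g (Real.sqrt (2 * T) * z + x₀) ^ 2) gauss := by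
    refine integrable_comp_gauss (g := fun x => g (x + x₀) ^ 2) hT (hfin.congr ?_)
    filter_upwards [hug'] with x hx
    rw [hx, sq_abs]
  have hvi : Integrable (fun z => |v (Real.sqrt (2 * T) * z + x₀)| ^ (p + 1)) gauss := by
    have hm : Measurable fun z => v (Real.sqrt (2 * T) * z + x₀) := hvm.comp (by fun_prop)
    refine Integrable.of_bound (C := B ^ (p + 1)) ?_ (ae_of_all _ fun z => ?_)
    · exact (hm.abs.pow_const _).aestronglyMeasurable
    · rw [Real.norm_of_nonneg (by positivity)]
      exact Real.rpow_le_rpow (abs_nonneg _) (hvB _) (by linarith)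
  rw [energyST_congr_ae huv' hug',
    energyST_eq hp hT (f := fun x => v (x + x₀)) (g := fun x => g (x + x₀)) hvi hgi] at hS
  have hneg := sub_neg.1 (neg_of_mul_neg_right hS (Real.sqrt_nonneg _))
  simp only [add_comm _ x₀] at hneg hgi
  obtain ⟨U, hU⟩ := exists_isTruncatedFamily hp hvm hvB
  have hgL : MemLp (fun z => g (x₀ + Real.sqrt (2 * T) * z)) 2 gauss :=
    (memLp_two_iff_integrable_sq (hg.comp (by fun_prop)).aestronglyMeasurable).2 hgi
  obtain ⟨t, u, ht, htT, hu, hblow, huniq⟩ := hU.exists_blowup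
    (hU.not_isBelow hT (hu₀'.congr_ae huv hug) hgL hneg)
  exact ⟨t, u, ht, htT, hu.congr_initial huv.symm, hblow,
    fun τ w hw => huniq τ w (hw.congr_initial huv)⟩
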